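/- Let $G=(N,M)$ be a finite simple graph with vertex set $N=\{a_1,\dots,a_n\}$. The vertices are the agents and the edges are indivisible items. Each agent $a_i$ has a valuation $v_i:2^M\to\mathbb R$, not necessarily additive. An edge $e$ is a good for $a_i$ if $v_i(S\cup\{e\})>v_i(S)$ for all $S\subseteq M\setminus\{e\}$, a chore for $a_i$ if $v_i(S\cup\{e\})<v_i(S)$ for all such $S$, and a dummy for $a_i$ if $v_i(S\cup\{e\})=v_i(S)$ for all such $S$. Assume that, for every agent $a_i$, every edge incident to $a_i$ is a good, a chore or a dummy for $a_i$, and every edge not incident to $a_i$ is a dummy for $a_i$. An allocation is a tuple $\mathbf X=(X_1,\dots,X_n)$ of pairwise disjoint, possibly empty, sets with union $M$. It is $\mathrm{EFX}^0_-$ if for all agents $a_i,a_j$ with $v_i(X_j)>v_i(X_i)$: - for every $e\in X_j$ with $v_i(X_j\setminus\{e\})\le v_i(X_j)$ we have $v_i(X_i)\ge v_i(X_j\setminus\{e\})$; and - for every $e\in X_i$ with $v_i(X_i\setminus\{e\})>v_i(X_i)$ we have $v_i(X_i\setminus\{e\})\ge v_i(X_j)$. **Theorem.** For every such $G$ and $v_1,\dots,v_n$,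 an $\mathrm{EFX}^0_-$ allocation exists, and it can be computed in polynomial time. That is, there are a single algorithm and a polynomial $p$ such that on every such instance with $n$ agents the algorithm halts after at most $p(n)$ steps and outputs an $\mathrm{EFX}^0_-$ allocation. Here an algorithm is a program for a random access machine that is given $n$ and the adjacency matrix of $G$ and has value-query access to the valuations: for an agent $a_i$ and a set $S\subseteq M$ that it has written in its memory, it obtains the real number $v_i(S)$ in one step. The machine can add, subtract (truncated at $0$) and compare natural numbers at unit cost, and it can compare the real numbers returned by value queries, but performs no other operation on them. -/

import Mathlib

namespace GraphEFX

/-! ### Instances and fairness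

The agents are the vertices of a simple graph `G` and the items are its edges. A bundle is a
`Set G.edgeSet`, and `v i S` is the value of the bundle `S` for agent `i`. -/

section Fairness

variable {V : Type*} {E : Type*}

/-- The item `e` is a good for the valuation `w`: adding it always strictly increases the value. -/
def IsGood (w : Set E → ℝ) (e : E) : Prop :=
  ∀ S : Set E, e ∉ S → w S < w (insert e S)

/-- The item `e` is a chore for `w`: adding it always strictly decreases the value. -/
def IsChore (w : Set E → ℝ) (e : E) : Prop :=
  ∀ S : Set E, e ∉ S → w (insert e S) < w S

/-- The item `e` is a dummy for `w`: adding it never changes the value. -/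
def IsDummy (w : Set E → ℝ) (e : E) : Prop :=
  ∀ S : Set E, e ∉ S → w (insert e S) = w S

/-- `(G, v)` is a mixed instance: every edge is a good, a chore or a dummy for each of its two
endpoints, and it is a dummy for every other agent. -/
structure IsMixedInstance (G : SimpleGraph V) (v : V → Set G.edgeSet → ℝ) : Prop where
  incident : ∀ (i : V) (e : G.edgeSet), i ∈ (e : Sym2 V) →
    IsGood (v i) e ∨ IsChore (v i) e ∨ IsDummy (v i) e
  not_incident : ∀ (i : V) (e : G.edgeSet), i ∉ (e : Sym2 V) → IsDummy (v i) e

/-- `X` is a (complete) allocation: its bundles are pairwise disjoint and cover all items.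
Bundles may be empty. -/
structure IsAllocation (X : V → Set E) : Prop where
  disjoint : ∀ i j : V, i ≠ j → Disjoint (X i) (X j)
  cover : ⋃ i : V, X i = Set.univ

/-- Agent `i` envies agent `j` in `X`. -/
def Envies (v : V → Set E → ℝ) (X : V → Set E) (i j : V) : Prop :=
  v i (X i) < v i (X j)

/-- `X` is `EFX⁰₋`. -/
def IsEFXZeroMinus (v : V → Set E → ℝ) (X : V → Set E) : Prop :=
  ∀ i j : V, Envies v X i j →
    (∀ e ∈ X j, v i (X j \ {e}) ≤ v i (X j) → v i (X j \ {e}) ≤ v i (X i)) ∧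
    (∀ e ∈ X i, v i (X i) < v i (X i \ {e}) → v i (X j) ≤ v i (X i \ {e}))

end Fairness

/-! ### Algorithms with value queries

A random access machine, programmed with `while`, with natural-number variables and
two-dimensional arrays, and separate registers for the real numbers that value queries return.
The natural-number operations are addition and truncated subtraction, so that the bit length of
the stored numbers grows at most linearly with the number of steps; the real registers can only
be filled by value queries and compared with each other. -/

/-- Natural-number expressions: constants, variables, array entries `a[i, j]`, sums and truncated
differences. -/
inductive Expr : Type
  | const (c : ℕ)
  | var (x : ℕ)
  | get (a : ℕ) (i j : Expr)
  | add (e f : Expr)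
  | sub (e f : Expr)

/-- Tests: comparison of two natural numbers, comparison of two real registers, negation and
conjunction. -/
inductive Test : Type
  | le (e f : Expr)
  | valLe (r r' : ℕ)
  | not (b : Test)
  | and (b c : Test)

/-- Programs. `query r i a` asks for the value, for agent `i`, of the set of edges marked by
nonzero entries in the array `a`, and puts the answer into the real register `r`. -/
inductive Prog : Type
  | skip
  | assign (x : ℕ) (e : Expr)
  | store (a : ℕ) (i j e : Expr)
  | query (r : ℕ) (i : Expr) (a : ℕ)
  | seq (p q : Prog)
  | ite (b : Test) (p q : Prog)
  | while (b : Test) (p : Prog)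

/-- The memory: variables, two-dimensional arrays, and real registers. -/
structure Mem where
  var : ℕ → ℕ
  arr : ℕ → ℕ → ℕ → ℕ
  val : ℕ → ℝ

/-- The value of an expression. -/
def Expr.eval (s : Mem) : Expr → ℕ
  | .const c => c
  | .var x => s.var x
  | .get a i j => s.arr a (i.eval s) (j.eval s)
  | .add e f => e.eval s + f.eval s
  | .sub e f => e.eval s - f.eval s

/-- The number of steps needed to evaluate an expression: one for each node. -/
def Expr.cost : Expr → ℕ
  | .const _ => 1
  | .var _ => 1
  | .get _ i j => i.cost + j.cost + 1
  | .add e f => e.cost + f.cost + 1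
  | .sub e f => e.cost + f.cost + 1

/-- The truth of a test. -/
def Test.Holds (s : Mem) : Test → Prop
  | .le e f => e.eval s ≤ f.eval s
  | .valLe r r' => s.val r ≤ s.val r'
  | .not b => ¬ b.Holds s
  | .and b c => b.Holds s ∧ c.Holds s

/-- The number of steps needed to evaluate a test. -/
def Test.cost : Test → ℕ
  | .le e f => e.cost + f.cost + 1
  | .valLe _ _ => 1
  | .not b => b.cost + 1
  | .and b c => b.cost + c.cost + 1

/-- Write `n` to the variable `x`. -/
def Mem.setVar (s : Mem) (x n : ℕ) : Mem :=
  { s with var := fun y => if y = x then n else s.var y }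

/-- Write `n` to the array entry `a[i, j]`. -/
def Mem.setArr (s : Mem) (a i j n : ℕ) : Mem :=
  { s with arr := fun b k l => if b = a ∧ k = i ∧ l = j then n else s.arr b k l }

/-- Write `z` to the real register `r`. -/
def Mem.setVal (s : Mem) (r : ℕ) (z : ℝ) : Mem :=
  { s with val := fun q => if q = r then z else s.val q }

/-- `Exec O p s s' t`: with the value oracle `O`, the program `p` started in the memory `s` halts
in the memory `s'` after exactly `t` steps. -/
inductive Exec (O : ℕ → (ℕ → ℕ → ℕ) → ℝ) : Prog → Mem → Mem → ℕ → Prop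
  | skip (s : Mem) : Exec O .skip s s 1
  | assign (s : Mem) (x : ℕ) (e : Expr) :
      Exec O (.assign x e) s (s.setVar x (e.eval s)) (e.cost + 1)
  | store (s : Mem) (a : ℕ) (i j e : Expr) :
      Exec O (.store a i j e) s (s.setArr a (i.eval s) (j.eval s) (e.eval s))
        (i.cost + j.cost + e.cost + 1)
  | query (s : Mem) (r : ℕ) (i : Expr) (a : ℕ) :
      Exec O (.query r i a) s (s.setVal r (O (i.eval s) (s.arr a))) (i.cost + 1)
  | seq {p q : Prog} {s s' s'' : Mem} {t t' : ℕ} :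
      Exec O p s s' t → Exec O q s' s'' t' → Exec O (.seq p q) s s'' (t + t')
  | ite_true {b : Test} {p q : Prog} {s s' : Mem} {t : ℕ} :
      b.Holds s → Exec O p s s' t → Exec O (.ite b p q) s s' (b.cost + t)
  | ite_false {b : Test} {p q : Prog} {s s' : Mem} {t : ℕ} :
      ¬ b.Holds s → Exec O q s s' t → Exec O (.ite b p q) s s' (b.cost + t)
  | while_true {b : Test} {p : Prog} {s s' s'' : Mem} {t t' : ℕ} :
      b.Holds s → Exec O p s s' t → Exec O (.while b p) s' s'' t' →
        Exec O (.while b p) s s'' (b.cost + t + t')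
  | while_false {b : Test} {p : Prog} {s : Mem} :
      ¬ b.Holds s → Exec O (.while b p) s s b.cost

variable {n : ℕ}

/-- The set of edges of `G` marked by the table `B`. The edge between `j` and `k` is marked if
`B j k ≠ 0` or `B k j ≠ 0`, since `s(j, k) = s(k, j)`. -/
def markedEdges (G : SimpleGraph (Fin n)) (B : ℕ → ℕ → ℕ) : Set G.edgeSet :=
  {e | ∃ j k : Fin n, (e : Sym2 (Fin n)) = s(j, k) ∧ B j k ≠ 0}

/-- The value oracle of an instance on the agents `0, …, n - 1`. A query about a number that is
not an agent returns `0`. -/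
noncomputable def valueOracle (G : SimpleGraph (Fin n)) (v : Fin n → Set G.edgeSet → ℝ) :
    ℕ → (ℕ → ℕ → ℕ) → ℝ :=
  fun i B => if h : i < n then v ⟨i, h⟩ (markedEdges G B) else 0

open Classical in
/-- The input: variable `0` holds `n`, array `0` holds the adjacency matrix of `G`, and the rest
of the memory is `0`. -/
noncomputable def inputMem (G : SimpleGraph (Fin n)) : Mem where
  var := fun x => if x = 0 then n else 0
  arr := fun a i j =>
    if a = 0 ∧ ∃ (hi : i < n) (hj : j < n), G.Adj ⟨i, hi⟩ ⟨j, hj⟩ then 1 else 0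
  val := fun _ => 0

/-- The output: the edge between `j` and `k` goes to the agent whose number stands in the entry
`[j, k]` of array `1`. For the bundles to be disjoint, the entries `[j, k]` and `[k, j]` have to
name the same agent. -/
def outputBundles (G : SimpleGraph (Fin n)) (s : Mem) : Fin n → Set G.edgeSet :=
  fun i => {e | ∃ j k : Fin n, (e : Sym2 (Fin n)) = s(j, k) ∧ s.arr 1 j k = (i : ℕ)}

end GraphEFX

/-!
An item is named by its endpoints, so that everything about an agent `i` can be said with sets of
neighbours: `good i`, `chore i` and the value `val i S` of the items between `i` and `S`, which is
monotone below `good i` (`LocalInstance`, `localInstance`). A partial orientation `X` gives some goods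
to one of their endpoints. If every envied agent holds a single item (`Oriented`), then removing this
item ends the envy, and the only danger lies in the items that nobody holds yet. These are
distributed at the very end, in one go: an unheld item goes to an agent who is not envied and whom no
endpoint that likes the item would envy even if she got all unheld items; or to an endpoint who is
not envied and for whom the item is no chore; or to an agent envied by an endpoint for whom it is a
chore, since fairness only speaks about removing items from an envied bundle that are no chores
(`Receiver`). If every unheld item has such a receiver (`Completable`), then the resulting allocation
is `EFX⁰₋` (`isEFXZeroMinus_tableBundles`).

It remains to find a completable orientation. The agents first pick in turn one best item each among
those not yet taken (`Picking`). Now every agent envies only agents with smaller numbers, hence each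
chain of enviers ends in a free agent, the `root`. As long as an envied agent `l` would envy some free
agent `w` after `w` had received all unheld items, and `w` is the root of `l` or can give up her
bundle, `l` takes these items and everybody along the chain of enviers moves up by one (`CanRelease`,
`IsRelease`); and a free agent who stops envying by taking all her unheld goods does so
(`CanAbsorb`). Each exchange keeps the invariant `Inv` and reduces the number of envied agents, so
that after at most `n` passes none is possible (`Stable`).

In a stable orientation the only unheld items without a receiver are goods for both endpoints `x` and
`y`, both envied (`Trouble`, `Stable.completable`). If there is one, then no exchange has taken place,
since the last one would have left a free agent who is safe for both (`Clean`), and all bundles have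
at most one item. Then the chains of `x` and `y` are shifted, `x` chooses between the item and her
other unheld goods, and `y` takes what is left of hers. After one such swap every item has a receiver,
whatever other items were in trouble before (`IsSwap.completable`).

The running time comes from the form of the program. `Cmd` has no `while` but only loops over the
agents, so that every command runs in polynomial time (`Cmd.exec_prog`), and correctness can be shown
about its denotation `Cmd.den`. Before each exchange, all data about the current orientation is
computed anew into tables (`Cmd.analyze`, `Tables`), after which the exchange consists of
natural-number operations. The argument needs a third agent; with fewer there is at most one item, and
every allocation will do (`isEFXZeroMinus_of_le_two`).
-/

/-! ### Partial orientations -/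

namespace GraphEFX

/-- What an instance looks like from the agents: agents and neighbours are natural numbers, an item
incident to `i` is named by its other endpoint, `good i` and `chore i` are the items that are goods
and chores for `i`, and `val i S` is the value for `i` of the set of items between `i` and `S`. -/
structure LocalInstance where
  n : ℕ
  adj : ℕ → ℕ → Prop
  good : ℕ → Set ℕ
  chore : ℕ → Set ℕ
  val : ℕ → Set ℕ → ℝ
  adj_symm : ∀ {i k}, adj i k → adj k i
  adj_irrefl : ∀ i, ¬ adj i i
  adj_lt : ∀ {i k}, adj i k → i < n
  good_adj : ∀ {i k}, k ∈ good i → adj i k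
  not_chore : ∀ {i k}, k ∈ good i → k ∉ chore i
  mono : ∀ {i S T}, S ⊆ T → T ⊆ good i → val i S ≤ val i T

namespace LocalInstance

variable (I : LocalInstance)

/-- The items that are goods for `i` and that nobody holds. The bundle of `i` is `X i`. -/
def unheld (X : ℕ → Set ℕ) (i : ℕ) : Set ℕ := {k | k ∈ I.good i ∧ k ∉ X i ∧ i ∉ X k}

/-- Agent `l` wants to exchange her whole bundle for the item between `l` and `i`, which `i`
holds. -/
def Wants (X : ℕ → Set ℕ) (l i : ℕ) : Prop :=
  l ∈ X i ∧ i ∈ I.good l ∧ I.val l (X l) < I.val l {i}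

/-- Nobody envies `i`. -/
def Free (X : ℕ → Set ℕ) (i : ℕ) : Prop := ∀ l, ¬ I.Wants X l i

/-- The goods of `l` that `w` would hold after having received all unheld items. -/
def offer (X : ℕ → Set ℕ) (l w : ℕ) : Set ℕ :=
  {k | k ∈ I.unheld X l ∨ k = w ∧ l ∈ X w ∧ w ∈ I.good l}

/-- Agent `l` would not envy `w` even if `w` received all unheld items. -/
def Safe (X : ℕ → Set ℕ) (l w : ℕ) : Prop := I.val l (I.offer X l w) ≤ I.val l (X l)

open Classical in
/-- The agent who envies `i`, or `i` itself if there is none. -/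
noncomputable def envier (X : ℕ → Set ℕ) (i : ℕ) : ℕ :=
  if h : ∃ l, I.Wants X l i then h.choose else i

/-- The end of the chain of enviers that starts in `i`. -/
noncomputable def root (X : ℕ → Set ℕ) (i : ℕ) : ℕ := (I.envier X)^[I.n] i

/-- The part of the invariant that makes the final distribution of the unheld items possible. -/
structure Oriented (X : ℕ → Set ℕ) : Prop where
  sub : ∀ i, X i ⊆ I.good i
  disj : ∀ {i k}, k ∈ X i → i ∉ X k
  single : ∀ {l i}, I.Wants X l i → X i = {l}
  le : ∀ {i k}, k ∈ I.unheld X i → I.val i {k} ≤ I.val i (X i)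

/-- The invariant of the improvement phase. Agents are only envied by agents with larger numbers,
so that chains of enviers end. -/
structure Inv (X : ℕ → Set ℕ) : Prop extends I.Oriented X where
  lt : ∀ {l i}, I.Wants X l i → i < l

/-- A free agent who holds nothing that an envied agent has an interest in. -/
def Clean (X : ℕ → Set ℕ) (u : ℕ) : Prop := u < I.n ∧ I.Free X u ∧ ∀ l ∈ X u, I.Free X l

/-- The chain of enviers that starts in `l`. -/
def OnChain (X : ℕ → Set ℕ) : ℕ → ℕ → Prop := Relation.ReflTransGen fun a b => I.Wants X b a

/-- `X'` arises from `X₁` by giving every agent on the chain of enviers from `l` in `X`, except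
`l` itself, the one item that she envies her predecessor for. -/
def IsShift (X : ℕ → Set ℕ) (l : ℕ) (X₁ X' : ℕ → Set ℕ) : Prop :=
  ∀ z, (∃ q, I.OnChain X l q ∧ I.Wants X z q ∧ X' z = {q}) ∨
    ((∀ q, I.OnChain X l q → ¬ I.Wants X z q) ∧ X' z = X₁ z)

variable {I} {X : ℕ → Set ℕ}

theorem good_lt {i k : ℕ} (h : k ∈ I.good i) : i < I.n ∧ k < I.n :=
  ⟨I.adj_lt (I.good_adj h), I.adj_lt (I.adj_symm (I.good_adj h))⟩

theorem not_mem_good (i : ℕ) : i ∉ I.good i := fun h => I.adj_irrefl i (I.good_adj h)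

theorem unheld_sub (i : ℕ) : I.unheld X i ⊆ I.good i := fun _ h => h.1

theorem unheld_symm {i k : ℕ} (h : k ∈ I.unheld X i) (h' : i ∈ I.good k) : i ∈ I.unheld X k :=
  ⟨h', h.2.2, h.2.1⟩

theorem offer_sub (l w : ℕ) : I.offer X l w ⊆ I.good l := by
  rintro k (h | ⟨rfl, _, h⟩)
  · exact h.1
  · exact h

theorem unheld_sub_offer (l w : ℕ) : I.unheld X l ⊆ I.offer X l w := fun _ h => Or.inl h

theorem offer_eq_unheld {l w : ℕ} (h : l ∉ X w) : I.offer X l w = I.unheld X l := by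
  ext k
  simp [offer, h]

theorem Wants.lt_n {l i : ℕ} (h : I.Wants X l i) : l < I.n ∧ i < I.n := good_lt h.2.1

theorem Oriented.val_single_le (hX : I.Oriented X) {i k : ℕ} (h : k ∈ X i) :
    I.val i {k} ≤ I.val i (X i) := I.mono (by simpa using h) (hX.sub i)

/-- Every good that somebody does not hold, and for which she envies nobody, is worth at most her
bundle. -/
theorem Oriented.val_le (hX : I.Oriented X) {i k : ℕ} (h : k ∈ I.good i) (hw : ¬ I.Wants X i k) :
    I.val i {k} ≤ I.val i (X i) := by
  by_cases h1 : k ∈ X i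
  · exact hX.val_single_le h1
  by_cases h2 : i ∈ X k
  · by_contra h3
    exact hw ⟨h2, h, not_le.1 h3⟩
  · exact hX.le ⟨h, h1, h2⟩

theorem Oriented.wants_unique (hX : I.Oriented X) {l l' i : ℕ} (h : I.Wants X l i)
    (h' : I.Wants X l' i) : l = l' := by
  have := (hX.single h).symm.trans (hX.single h')
  simpa using this

theorem envier_of_free {i : ℕ} (h : I.Free X i) : I.envier X i = i := by
  rw [envier, dif_neg (by simpa [Free] using h)]

theorem wants_envier {i : ℕ} (h : ¬ I.Free X i) : I.Wants X (I.envier X i) i := by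
  have h' : ∃ l, I.Wants X l i := by simpa [Free] using h
  rw [envier, dif_pos h']
  exact h'.choose_spec

theorem Oriented.envier_eq (hX : I.Oriented X) {l i : ℕ} (h : I.Wants X l i) :
    I.envier X i = l :=
  hX.wants_unique (wants_envier fun hf => hf l h) h

theorem Oriented.envier_eq_iff (hX : I.Oriented X) {i : ℕ} : I.envier X i = i ↔ I.Free X i := by
  refine ⟨fun h => ?_, envier_of_free⟩
  by_contra hf
  have := (wants_envier hf).1
  rw [h] at this
  exact not_mem_good _ (hX.sub i this)

theorem OnChain.le (hX : I.Inv X) {l q : ℕ} (h : I.OnChain X l q) : l ≤ q := by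
  induction h with
  | refl => exact le_rfl
  | tail _ h ih => exact ih.trans (hX.lt h).le

theorem Inv.rightUnique (hX : I.Inv X) : Relator.RightUnique fun a b => I.Wants X b a :=
  fun _ _ _ h h' => hX.wants_unique h h'

theorem OnChain.head_unique (hX : I.Inv X) {a z q : ℕ} (h : I.OnChain X a q) (hw : I.Wants X z a)
    (hq : I.Wants X z q) : a = q := by
  rcases Relation.ReflTransGen.cases_head h with h | ⟨b, hb, hbq⟩
  · exact h
  · have hb : I.Wants X b a := hb
    obtain rfl := hX.wants_unique hw hb
    have h1 := OnChain.le hX hbq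
    have h2 := hX.lt hq
    omega

/-- An agent on a chain of enviers envies only one agent of the chain. -/
theorem OnChain.pred_unique (hX : I.Inv X) {l z q q' : ℕ} (h : I.OnChain X l q)
    (h' : I.OnChain X l q') (hw : I.Wants X z q) (hw' : I.Wants X z q') : q = q' := by
  rcases Relation.ReflTransGen.total_of_right_unique hX.rightUnique h h' with h | h
  · exact OnChain.head_unique hX h hw hw'
  · exact (OnChain.head_unique hX h hw' hw).symm

theorem onChain_iterate (i s : ℕ) : I.OnChain X i ((I.envier X)^[s] i) := by
  induction s with
  | zero => exact Relation.ReflTransGen.refl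
  | succ s ih =>
    rw [Function.iterate_succ_apply']
    by_cases hf : I.Free X ((I.envier X)^[s] i)
    · rw [envier_of_free hf]; exact ih
    · exact ih.tail (wants_envier hf)

theorem Inv.free_or_le (hX : I.Inv X) (i s : ℕ) :
    I.Free X ((I.envier X)^[s] i) ∨ i + s ≤ (I.envier X)^[s] i := by
  induction s with
  | zero => right; simp
  | succ s ih =>
    rw [Function.iterate_succ_apply']
    by_cases hf : I.Free X ((I.envier X)^[s] i)
    · left; rw [envier_of_free hf]; exact hf
    · right
      have := hX.lt (wants_envier hf)
      have := ih.resolve_left hf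
      omega

theorem Inv.free_root (hX : I.Inv X) (i : ℕ) : I.Free X (I.root X i) := by
  by_contra hf
  have h1 := ((hX.free_or_le i I.n).resolve_left hf)
  have h2 := (wants_envier hf).lt_n.2
  rw [root] at h2
  omega

theorem onChain_root (i : ℕ) : I.OnChain X i (I.root X i) := onChain_iterate i _

/-- Every agent on the chain is reached within `n` steps. -/
theorem OnChain.exists_iterate (hX : I.Inv X) {l q z : ℕ} (h : I.OnChain X l q)
    (hq : I.Wants X z q) : ∃ s < I.n, (I.envier X)^[s] l = q := by
  have key : ∃ s, (I.envier X)^[s] l = q := by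
    clear hq
    induction h with
    | refl => exact ⟨0, rfl⟩
    | tail _ h ih =>
      obtain ⟨s, hs⟩ := ih
      exact ⟨s + 1, by rw [Function.iterate_succ_apply', hs, hX.envier_eq h]⟩
  obtain ⟨s, hs⟩ := key
  refine ⟨s, ?_, hs⟩
  rcases hX.free_or_le l s with hf | hf
  · exact absurd hq (hs ▸ hf z)
  · have := hq.lt_n.2
    omega

theorem OnChain.free_eq_root (hX : I.Inv X) {l w : ℕ} (h : I.OnChain X l w) (hw : I.Free X w) :
    w = I.root X l := by
  rcases Relation.ReflTransGen.total_of_right_unique hX.rightUnique h (onChain_root l) with h | h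
  · rcases Relation.ReflTransGen.cases_head h with h | ⟨b, hb, _⟩
    · exact h
    · exact absurd hb (hw b)
  · rcases Relation.ReflTransGen.cases_head h with h | ⟨b, hb, _⟩
    · exact h.symm
    · exact absurd hb (hX.free_root l b)

theorem OnChain.root_eq (hX : I.Inv X) {l q : ℕ} (h : I.OnChain X l q) :
    I.root X q = I.root X l :=
  OnChain.free_eq_root hX (h.trans (onChain_root q)) (hX.free_root q)

/-- The root of an envied agent envies an agent of the chain. -/
theorem root_wants {l : ℕ} (hl : I.root X l ≠ l) :
    ∃ q, I.OnChain X l q ∧ I.Wants X (I.root X l) q := by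
  rcases Relation.ReflTransGen.cases_tail (onChain_root (I := I) (X := X) l) with h | h
  · exact absurd h hl
  · exact h

theorem Inv.root_ne (hX : I.Inv X) {l : ℕ} (hl : ¬ I.Free X l) : I.root X l ≠ l :=
  fun h => hl (by have := hX.free_root l; rwa [h] at this)

theorem root_lt {l : ℕ} (hl : l < I.n) : I.root X l < I.n := by
  by_cases h : I.root X l = l
  · rwa [h]
  · obtain ⟨q, _, hq⟩ := root_wants h
    exact hq.lt_n.1

end LocalInstance
end GraphEFX

/-! ### Improving exchanges -/

namespace GraphEFX
namespace LocalInstance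

variable {I : LocalInstance} {X : ℕ → Set ℕ}

variable (I) in
/-- The envied agent `l` can be made better off by taking all her unheld goods together with the
item that the free agent `w` may hold and `l` has an interest in, in such a way that `w` does not
lose: either `w` is the root of `l` and is compensated by the shift along the chain, or `w` can take
all her unheld goods instead. -/
def CanRelease (X : ℕ → Set ℕ) (l w : ℕ) : Prop :=
  ¬ I.Free X l ∧ I.Free X w ∧ ¬ I.Safe X l w ∧
    (I.root X l = w ∨ l ∈ X w ∧ I.val w (X w) ≤ I.val w (I.unheld X w))

variable (I) in
/-- The free agent `w` stops envying `i` if she takes all her unheld goods. -/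
def CanAbsorb (X : ℕ → Set ℕ) (w i : ℕ) : Prop :=
  I.Wants X w i ∧ I.Free X w ∧ I.val w {i} ≤ I.val w (X w ∪ I.unheld X w)

variable (I) in
/-- `X'` is the result of the exchange that `CanRelease X l w` describes. -/
def IsRelease (X : ℕ → Set ℕ) (l w : ℕ) (X' : ℕ → Set ℕ) : Prop :=
  I.IsShift X l (Function.update (Function.update X w (I.unheld X w)) l (I.offer X l w)) X'

/-- The four kinds of bundles after a release. -/
theorem IsRelease.cases (hX : I.Inv X) {l w : ℕ} {X' : ℕ → Set ℕ} (hc : I.CanRelease X l w)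
    (h : I.IsRelease X l w X') (z : ℕ) :
    (∃ q, I.OnChain X l q ∧ I.Wants X z q ∧ X' z = {q}) ∨
    (z = l ∧ X' z = I.offer X l w) ∨
    (z = w ∧ l ∈ X w ∧ I.val w (X w) ≤ I.val w (I.unheld X w) ∧ X' z = I.unheld X w) ∨
    (z ≠ l ∧ z ≠ w ∧ (∀ q, I.OnChain X l q → ¬ I.Wants X z q) ∧ X' z = X z) := by
  obtain ⟨hl, hw, -, hr⟩ := hc
  rcases h z with h | ⟨hch, hz⟩
  · exact Or.inl h
  · right
    by_cases hzl : z = l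
    · subst hzl
      exact Or.inl ⟨rfl, by simpa using hz⟩
    · right
      by_cases hzw : z = w
      · left
        subst hzw
        have hne : I.root X l ≠ z := by
          rintro rfl
          obtain ⟨q, hq, hq'⟩ := root_wants (hX.root_ne hl)
          exact hch q hq hq'
        refine ⟨rfl, (hr.resolve_left hne).1, (hr.resolve_left hne).2, ?_⟩
        rw [hz, Function.update_of_ne hzl, Function.update_self]
      · right
        refine ⟨hzl, hzw, hch, ?_⟩
        rw [hz, Function.update_of_ne hzl, Function.update_of_ne hzw]

theorem IsRelease.val_le (hX : I.Inv X) {l w : ℕ} {X' : ℕ → Set ℕ} (hc : I.CanRelease X l w)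
    (h : I.IsRelease X l w X') (z : ℕ) : I.val z (X z) ≤ I.val z (X' z) := by
  rcases h.cases hX hc z with ⟨q, _, hq, hz⟩ | ⟨rfl, hz⟩ | ⟨rfl, _, h, hz⟩ | ⟨_, _, _, hz⟩
  · rw [hz]; exact hq.2.2.le
  · rw [hz]; exact (not_le.1 hc.2.2.1).le
  · rw [hz]; exact h
  · rw [hz]

theorem IsRelease.val_lt (hX : I.Inv X) {l w : ℕ} {X' : ℕ → Set ℕ} (hc : I.CanRelease X l w)
    (h : I.IsRelease X l w X') {q : ℕ} (hq : I.OnChain X l q) (hf : ¬ I.Free X q) :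
    I.val q (X q) < I.val q (X' q) := by
  rcases h.cases hX hc q with ⟨q, _, hq, hz⟩ | ⟨rfl, hz⟩ | ⟨rfl, _, h, hz⟩ | ⟨hl, _, hz, _⟩
  · rw [hz]; exact hq.2.2
  · rw [hz]; exact not_le.1 hc.2.2.1
  · exact absurd hc.2.1 hf
  · rcases Relation.ReflTransGen.cases_tail hq with h | ⟨b, hb, hbq⟩
    · exact absurd h hl
    · exact absurd hbq (hz b hb)

/-- Nobody becomes envied by a release, and the agents that are still envied keep their bundles. -/
theorem IsRelease.wants (hX : I.Inv X) {l w : ℕ} {X' : ℕ → Set ℕ} (hc : I.CanRelease X l w)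
    (h : I.IsRelease X l w X') {a i : ℕ} (ha : I.Wants X' a i) :
    I.Wants X a i ∧ X' i = X i ∧ i ≠ l ∧ ∀ q, I.OnChain X l q → ¬ I.Wants X i q := by
  have hval := h.val_le hX hc a
  obtain ⟨h1, h2, h3⟩ := ha
  rcases h.cases hX hc i with ⟨q, hq, hw, hz⟩ | ⟨rfl, hz⟩ | ⟨rfl, _, _, hz⟩ | ⟨hi1, _, hi, hz⟩
  · rw [hz] at h1
    obtain rfl : a = q := h1
    have hai : I.val a (X a) < I.val a (X' a) := h.val_lt hX hc hq fun hf => hf _ hw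
    rw [hX.single hw] at hai
    exact absurd h3 hai.le.not_gt
  · rw [hz] at h1
    rcases h1 with h1 | ⟨rfl, h1, _⟩
    · exact absurd h3 ((hX.le (unheld_symm h1 h2)).trans hval).not_gt
    · exact absurd h3 ((hX.val_single_le h1).trans hval).not_gt
  · rw [hz] at h1
    exact absurd h3 ((hX.le (unheld_symm h1 h2)).trans hval).not_gt
  · rw [hz] at h1
    exact ⟨⟨h1, h2, hval.trans_lt h3⟩, hz, hi1, hi⟩

theorem IsRelease.disj (hX : I.Inv X) {l w : ℕ} {X' : ℕ → Set ℕ} (hc : I.CanRelease X l w)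
    (h : I.IsRelease X l w X') {i k : ℕ} (hk : k ∈ X' i) : i ∉ X' k := by
  intro hi
  have chain_offer : ∀ z q, I.OnChain X l q → I.Wants X z q → q = l → z ∉ I.offer X l w := by
    rintro z q _ hw rfl (h | ⟨rfl, h, _⟩)
    · exact h.2.1 hw.1
    · exact hX.disj hw.1 h
  have chain_old : ∀ z q, I.OnChain X l q → I.Wants X z q → q ≠ l →
      (∀ b, I.OnChain X l b → ¬ I.Wants X q b) → False := by
    intro z q hq _ hl hb
    rcases Relation.ReflTransGen.cases_tail hq with h | ⟨b, hb', hbq⟩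
    · exact hl h
    · exact hb b hb' hbq
  rcases h.cases hX hc i with ⟨q, hq, hw, hz⟩ | ⟨rfl, hz⟩ | ⟨rfl, hlw1, _, hz⟩ | ⟨hi1, hi2, hi3, hz⟩ <;>
  rcases h.cases hX hc k with
    ⟨q', hq', hw', hz'⟩ | ⟨rfl, hz'⟩ | ⟨rfl, hlw', _, hz'⟩ | ⟨hk1, hk2, hk3, hz'⟩ <;>
  rw [hz] at hk <;> rw [hz'] at hi
  · obtain rfl : k = q := hk
    obtain rfl : i = q' := hi
    exact absurd (hX.lt hw) (hX.lt hw').not_gt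
  · obtain rfl : k = q := hk
    exact chain_offer i k hq hw rfl hi
  · obtain rfl : k = q := hk
    exact hc.2.1 i hw
  · obtain rfl : k = q := hk
    exact chain_old i k hq hw hk1 hk3
  · obtain rfl : i = q' := hi
    exact chain_offer k i hq' hw' rfl hk
  · exact not_mem_good _ (offer_sub _ _ hk)
  · exact absurd hlw' hi.2.1
  · rcases hk with h | ⟨h, _⟩
    · exact h.2.2 hi
    · exact hk2 h
  · obtain rfl : i = q' := hi
    exact hc.2.1 k hw'
  · exact absurd hlw1 hk.2.1
  · exact not_mem_good _ hk.1
  · exact hk.2.2 hi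
  · obtain rfl : i = q' := hi
    exact chain_old k i hq' hw' hi1 hi3
  · rcases hi with h | ⟨h, _⟩
    · exact h.2.2 hk
    · exact hi2 h
  · exact hi.2.2 hk
  · exact hX.disj hk hi

theorem IsRelease.inv (hX : I.Inv X) {l w : ℕ} {X' : ℕ → Set ℕ} (hc : I.CanRelease X l w)
    (h : I.IsRelease X l w X') : I.Inv X' where
  sub z := by
    rcases h.cases hX hc z with ⟨q, _, hq, hz⟩ | ⟨rfl, hz⟩ | ⟨rfl, _, _, hz⟩ | ⟨_, _, _, hz⟩ <;> rw [hz]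
    · simpa using hq.2.1
    · exact offer_sub _ _
    · exact unheld_sub _
    · exact hX.sub z
  disj hk := h.disj hX hc hk
  single ha := by
    obtain ⟨h1, h2, -⟩ := h.wants hX hc ha
    rw [h2]; exact hX.single h1
  lt ha := hX.lt (h.wants hX hc ha).1
  le := by
    intro i k hk
    by_cases hw : I.Wants X i k
    · -- an item that was wanted is still held by the same agent or has gone to the one who wanted it
      exfalso
      rcases h.cases hX hc k with ⟨q, hq, hwk, hz⟩ | ⟨rfl, hz⟩ | ⟨rfl, hlw', _, hz⟩ | ⟨hk1, hk2, hk3, hz⟩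
      · rcases h i with ⟨q', hq', hw', hi⟩ | ⟨hi, _⟩
        · have := OnChain.pred_unique hX (hq.tail hwk) hq' hw hw'
          exact hk.2.1 (by rw [hi, this]; rfl)
        · exact hi k (hq.tail hwk) hw
      · rcases h i with ⟨q', hq', hw', hi⟩ | ⟨hi, _⟩
        · have := OnChain.pred_unique hX Relation.ReflTransGen.refl hq' hw hw'
          exact hk.2.1 (by rw [hi, this]; rfl)
        · exact hi k Relation.ReflTransGen.refl hw
      · exact hc.2.1 i hw
      · exact hk.2.2 (hz ▸ hw.1)
    · exact (hX.val_le hk.1 hw).trans (h.val_le hX hc i)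

theorem IsRelease.free (hX : I.Inv X) {l w : ℕ} {X' : ℕ → Set ℕ} (hc : I.CanRelease X l w)
    (h : I.IsRelease X l w X') : I.Free X' l :=
  fun _ ha => (h.wants hX hc ha).2.2.1 rfl

/-- The agent who envied `l` now holds a single item, in which only `l` has an interest. -/
theorem IsRelease.clean (hX : I.Inv X) {l w : ℕ} {X' : ℕ → Set ℕ} (hc : I.CanRelease X l w)
    (h : I.IsRelease X l w X') : I.Clean X' (I.envier X l) := by
  have hp := wants_envier hc.1
  refine ⟨hp.lt_n.1, fun _ ha => (h.wants hX hc ha).2.2.2 l Relation.ReflTransGen.refl hp, ?_⟩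
  rcases h (I.envier X l) with ⟨q', hq', hw', hi⟩ | ⟨hi, _⟩
  · have := OnChain.pred_unique hX Relation.ReflTransGen.refl hq' hp hw'
    rw [hi, ← this]
    rintro a rfl
    exact h.free hX hc
  · exact absurd hp (hi l Relation.ReflTransGen.refl)

section Absorb

variable {w i : ℕ}

theorem CanAbsorb.val_le (hX : I.Inv X) (z : ℕ) :
    I.val z (X z) ≤ I.val z (Function.update X w (X w ∪ I.unheld X w) z) := by
  by_cases hz : z = w
  · subst hz
    rw [Function.update_self]
    exact I.mono Set.subset_union_left (Set.union_subset (hX.sub z) (unheld_sub z))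
  · rw [Function.update_of_ne hz]

theorem CanAbsorb.wants (hX : I.Inv X) (hc : I.CanAbsorb X w i) {a b : ℕ}
    (ha : I.Wants (Function.update X w (X w ∪ I.unheld X w)) a b) :
    I.Wants X a b ∧ b ≠ w ∧ b ≠ i := by
  have hval := CanAbsorb.val_le (w := w) hX a
  obtain ⟨h1, h2, h3⟩ := ha
  by_cases hb : b = w
  · subst hb
    rw [Function.update_self] at h1
    rcases h1 with h1 | h1
    · exact absurd ⟨h1, h2, hval.trans_lt h3⟩ (hc.2.1 a)
    · exact absurd h3 ((hX.le (unheld_symm h1 h2)).trans hval).not_gt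
  · rw [Function.update_of_ne hb] at h1
    refine ⟨⟨h1, h2, hval.trans_lt h3⟩, hb, ?_⟩
    rintro rfl
    obtain rfl : a = w := by simpa [hX.single hc.1] using h1
    rw [Function.update_self] at h3
    exact absurd h3 hc.2.2.not_gt

theorem CanAbsorb.inv (hX : I.Inv X) (hc : I.CanAbsorb X w i) :
    I.Inv (Function.update X w (X w ∪ I.unheld X w)) where
  sub z := by
    by_cases hz : z = w
    · subst hz
      rw [Function.update_self]
      exact Set.union_subset (hX.sub z) (unheld_sub z)
    · rw [Function.update_of_ne hz]; exact hX.sub z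
  disj := by
    have key : ∀ k, k ∈ X w ∪ I.unheld X w → w ∉ X k := by
      rintro k (h | h)
      · exact hX.disj h
      · exact h.2.2
    intro a k hk hi
    by_cases ha : a = w <;> by_cases hkw : k = w
    · subst ha hkw
      rw [Function.update_self] at hk
      rcases hk with h | h
      · exact not_mem_good _ (hX.sub _ h)
      · exact not_mem_good _ h.1
    · subst ha
      rw [Function.update_self] at hk
      rw [Function.update_of_ne hkw] at hi
      exact key k hk hi
    · subst hkw
      rw [Function.update_self] at hi
      rw [Function.update_of_ne ha] at hk
      exact key a hi hk
    · rw [Function.update_of_ne ha] at hk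
      rw [Function.update_of_ne hkw] at hi
      exact hX.disj hk hi
  single ha := by
    obtain ⟨h1, h2, -⟩ := hc.wants hX ha
    rw [Function.update_of_ne h2]; exact hX.single h1
  lt ha := hX.lt (hc.wants hX ha).1
  le := by
    intro a k hk
    have hsub : ∀ z, X z ⊆ Function.update X w (X w ∪ I.unheld X w) z := by
      intro z
      by_cases hz : z = w
      · subst hz; rw [Function.update_self]; exact Set.subset_union_left
      · rw [Function.update_of_ne hz]
    exact (hX.le ⟨hk.1, fun h => hk.2.1 (hsub _ h), fun h => hk.2.2 (hsub _ h)⟩).trans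
      (CanAbsorb.val_le hX a)

theorem CanAbsorb.clean (hX : I.Inv X) (hc : I.CanAbsorb X w i) :
    I.Clean (Function.update X w (X w ∪ I.unheld X w)) i := by
  have hiw : i ≠ w := by
    rintro rfl
    exact not_mem_good _ hc.1.2.1
  refine ⟨hc.1.lt_n.2, fun a ha => (hc.wants hX ha).2.2 rfl, ?_⟩
  rw [Function.update_of_ne hiw, hX.single hc.1]
  rintro a rfl b hb
  exact (hc.wants hX hb).2.1 rfl

end Absorb

variable (I) in
open Classical in
/-- The agents that are envied. -/
noncomputable def envied (X : ℕ → Set ℕ) : Finset ℕ :=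
  (Finset.range I.n).filter fun i => ¬ I.Free X i

theorem mem_envied {i : ℕ} : i ∈ I.envied X ↔ ¬ I.Free X i := by
  simp only [envied, Finset.mem_filter, Finset.mem_range, and_iff_right_iff_imp]
  intro h
  exact (wants_envier h).lt_n.2

theorem IsRelease.card_lt (hX : I.Inv X) {l w : ℕ} {X' : ℕ → Set ℕ} (hc : I.CanRelease X l w)
    (h : I.IsRelease X l w X') : (I.envied X').card < (I.envied X).card := by
  refine Finset.card_lt_card (Finset.ssubset_iff_of_subset ?_ |>.2 ⟨l, ?_, ?_⟩)
  · intro i hi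
    rw [mem_envied] at hi ⊢
    exact fun hf => hf _ (h.wants hX hc (wants_envier hi)).1
  · exact mem_envied.2 hc.1
  · rw [mem_envied, not_not]; exact h.free hX hc

theorem CanAbsorb.card_lt {w i : ℕ} (hX : I.Inv X) (hc : I.CanAbsorb X w i) :
    (I.envied (Function.update X w (X w ∪ I.unheld X w))).card < (I.envied X).card := by
  refine Finset.card_lt_card (Finset.ssubset_iff_of_subset ?_ |>.2 ⟨i, ?_, ?_⟩)
  · intro a ha
    rw [mem_envied] at ha ⊢
    exact fun hf => hf _ (hc.wants hX (wants_envier ha)).1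
  · exact mem_envied.2 fun hf => hf _ hc.1
  · rw [mem_envied, not_not]; exact (hc.clean hX).2.1

/-- The agent with the largest number is never envied. -/
theorem Inv.card_envied_lt (hX : I.Inv X) (hn : 0 < I.n) : (I.envied X).card < I.n := by
  refine (Finset.card_lt_card (Finset.ssubset_iff_of_subset ?_ |>.2 ⟨I.n - 1, ?_, ?_⟩)).trans_eq
    (Finset.card_range I.n)
  · intro i hi
    exact Finset.mem_range.2 (wants_envier (mem_envied.1 hi)).lt_n.2
  · simpa using hn
  · rw [mem_envied, not_not]
    intro l hl
    have := hX.lt hl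
    have := hl.lt_n.1
    omega

end LocalInstance
end GraphEFX

/-! ### Receivers for the unheld items -/

namespace GraphEFX
namespace LocalInstance

variable {I : LocalInstance} {X : ℕ → Set ℕ}

variable (I) in
/-- The agent `w` may receive the unheld item between `a` and `b`: she is free and an endpoint for
whom it is no chore; or she is free, not an endpoint, and safe for each endpoint that has the item
as a good; or she is envied by an endpoint for whom the item is a chore. -/
def Receiver (X : ℕ → Set ℕ) (w a b : ℕ) : Prop :=
  (w = a ∧ I.Free X w ∧ b ∉ I.chore a) ∨ (w = b ∧ I.Free X w ∧ a ∉ I.chore b) ∨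
    (w ≠ a ∧ w ≠ b ∧ I.Free X w ∧ (b ∈ I.good a → I.Safe X a w) ∧
      (a ∈ I.good b → I.Safe X b w)) ∨
    (I.Wants X a w ∧ b ∈ I.chore a) ∨ (I.Wants X b w ∧ a ∈ I.chore b)

theorem Receiver.symm {w a b : ℕ} (h : I.Receiver X w a b) : I.Receiver X w b a := by
  unfold Receiver at *
  tauto

variable (I) in
/-- A partial orientation for which every unheld item has a receiver. -/
structure Completable (X : ℕ → Set ℕ) : Prop extends I.Oriented X where
  receiver : ∀ {a b}, I.adj a b → b ∉ X a → a ∉ X b → ∃ w < I.n, I.Receiver X w a b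

variable (I) in
/-- No improving exchange is possible any more; if there has been one, then there is a clean
agent. -/
structure Stable (X : ℕ → Set ℕ) : Prop extends I.Inv X where
  subsingleton_or_clean : (∀ i, (X i).Subsingleton) ∨ ∃ u, I.Clean X u
  not_release : ∀ l w, ¬ I.CanRelease X l w
  not_absorb : ∀ w i, ¬ I.CanAbsorb X w i

variable (I) in
/-- The unheld item between the envied agents `x` and `y` is a good for both, and nobody is safe for
both of them. -/
def Trouble (X : ℕ → Set ℕ) (x y : ℕ) : Prop :=
  y ∈ I.unheld X x ∧ x ∈ I.unheld X y ∧ ¬ I.Free X x ∧ ¬ I.Free X y ∧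
    ∀ w < I.n, I.Free X w → ¬ (I.Safe X x w ∧ I.Safe X y w)

theorem Completable.not_trouble (hX : I.Completable X) (x y : ℕ) : ¬ I.Trouble X x y := by
  rintro ⟨h1, h2, h3, h4, h5⟩
  obtain ⟨w, hw, h | h | h | h | h⟩ := hX.receiver (I.good_adj h1.1) h1.2.1 h1.2.2
  · exact h3 (h.1 ▸ h.2.1)
  · exact h4 (h.1 ▸ h.2.1)
  · exact h5 w hw h.2.2.1 ⟨h.2.2.2.1 h1.1, h.2.2.2.2 h2.1⟩
  · exact I.not_chore h1.1 h.2
  · exact I.not_chore h2.1 h.2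

theorem Stable.safe_root (hX : I.Stable X) {l : ℕ} (hl : ¬ I.Free X l) :
    I.Safe X l (I.root X l) := by
  by_contra h
  exact hX.not_release l _ ⟨hl, hX.free_root l, h, Or.inl rfl⟩

/-- If the root of another agent is an endpoint, it can receive the item itself, or some agent it
envies can. -/
theorem Stable.receiver_of_root_eq (hX : I.Stable X) {a b z : ℕ} (h : I.root X z = a)
    (hz : z ≠ a) (ha : a < I.n) : ∃ w < I.n, I.Receiver X w a b := by
  by_cases hc : b ∈ I.chore a
  · obtain ⟨q, _, hq⟩ := root_wants (I := I) (X := X) (l := z) (by rw [h]; exact hz.symm)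
    rw [h] at hq
    exact ⟨q, hq.lt_n.2, Or.inr (Or.inr (Or.inr (Or.inl ⟨hq, hc⟩)))⟩
  · exact ⟨a, ha, Or.inl ⟨rfl, h ▸ hX.free_root z, hc⟩⟩

theorem Stable.receiver_of_good (hX : I.Stable X) {a b : ℕ} (hab : I.adj a b)
    (ha : b ∉ I.good a) (hb : a ∈ I.good b) : ∃ w < I.n, I.Receiver X w a b := by
  have hbn := (good_lt hb).1
  by_cases hf : I.Free X b
  · exact ⟨b, hbn, Or.inr (Or.inl ⟨rfl, hf, I.not_chore hb⟩)⟩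
  by_cases hwa : I.root X b = a
  · exact hX.receiver_of_root_eq hwa (fun h => I.adj_irrefl _ (h ▸ hab)) (I.adj_lt hab)
  · exact ⟨_, root_lt hbn, Or.inr (Or.inr (Or.inl ⟨hwa, hX.root_ne hf, hX.free_root b,
      fun h => absurd h ha, fun _ => hX.safe_root hf⟩))⟩

theorem Stable.completable (hX : I.Stable X) (hT : ∀ x y, ¬ I.Trouble X x y) (hn : 2 < I.n) :
    I.Completable X where
  toOriented := hX.toOriented
  receiver := by
    intro a b hab h1 h2
    have han := I.adj_lt hab
    have hbn := I.adj_lt (I.adj_symm hab)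
    by_cases ha : b ∈ I.good a <;> by_cases hb : a ∈ I.good b
    · by_cases hfa : I.Free X a
      · exact ⟨a, han, Or.inl ⟨rfl, hfa, I.not_chore ha⟩⟩
      by_cases hfb : I.Free X b
      · exact ⟨b, hbn, Or.inr (Or.inl ⟨rfl, hfb, I.not_chore hb⟩)⟩
      have := hT a b
      simp only [Trouble, not_and, not_forall, not_not] at this
      obtain ⟨w, hw, hwf, hs⟩ := this ⟨ha, h1, h2⟩ ⟨hb, h2, h1⟩ hfa hfb
      exact ⟨w, hw, Or.inr (Or.inr (Or.inl ⟨fun h => hfa (h ▸ hwf), fun h => hfb (h ▸ hwf), hwf,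
        fun _ => hs.1, fun _ => hs.2⟩))⟩
    · obtain ⟨w, hw, h⟩ := hX.receiver_of_good (I.adj_symm hab) hb ha
      exact ⟨w, hw, h.symm⟩
    · exact hX.receiver_of_good hab ha hb
    · obtain ⟨z, hz, hza, hzb⟩ : ∃ z < I.n, z ≠ a ∧ z ≠ b := by
        by_contra! h
        have h0 := h 0 (by omega)
        have h1 := h 1 (by omega)
        have h2 := h 2 (by omega)
        omega
      by_cases hwa : I.root X z = a
      · exact hX.receiver_of_root_eq hwa hza han
      by_cases hwb : I.root X z = b
      · obtain ⟨w, hw, h⟩ := hX.receiver_of_root_eq (b := a) hwb hzb hbn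
        exact ⟨w, hw, h.symm⟩
      exact ⟨_, root_lt hz, Or.inr (Or.inr (Or.inl ⟨hwa, hwb, hX.free_root z,
        fun h => absurd h ha, fun h => absurd h hb⟩))⟩

/-! ### The exchange for an item without a receiver -/

variable (I) in
/-- The goods of `x` that nobody holds after a shift in the chains of `x` and `y`. -/
def pool (X : ℕ → Set ℕ) (x y : ℕ) : Set ℕ := {k | k ∈ I.unheld X x ∨ k = I.root X y}

variable (I) in
/-- The result of the exchange for the item between `x` and `y`: after a shift in the chains of `x`
and `y`, agent `x` chooses between this item and all her other goods that nobody holds, and `y` takes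
all her goods that are left. -/
def IsSwap (X : ℕ → Set ℕ) (x y : ℕ) (X' : ℕ → Set ℕ) : Prop :=
  ∃ X₁ X₂, I.IsShift X x X X₁ ∧ I.IsShift X y X₁ X₂ ∧ (∀ z, z ≠ x → z ≠ y → X' z = X₂ z) ∧
    (I.val x {y} ≤ I.val x (I.pool X x y \ {y}) ∧ X' x = I.pool X x y \ {y} ∧
        X' y = I.pool X y x ∨
      I.val x (I.pool X x y \ {y}) < I.val x {y} ∧ X' x = {y} ∧ X' y = I.pool X y x \ {x})

section Swap

variable {x y : ℕ} {X' : ℕ → Set ℕ}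

theorem Trouble.symm (hT : I.Trouble X x y) : I.Trouble X y x :=
  ⟨hT.2.1, hT.1, hT.2.2.2.1, hT.2.2.1, fun w h1 h2 h3 => hT.2.2.2.2 w h1 h2 h3.symm⟩

theorem Stable.unheld_le (hX : I.Stable X) {l : ℕ} (hl : ¬ I.Free X l) :
    I.val l (I.unheld X l) ≤ I.val l (X l) :=
  (I.mono (unheld_sub_offer _ _) (offer_sub _ _)).trans (hX.safe_root hl)

theorem Stable.safe_of_not_mem (hX : I.Stable X) {l w : ℕ} (hl : ¬ I.Free X l) (h : l ∉ X w) :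
    I.Safe X l w := by
  rw [Safe, offer_eq_unheld h]
  exact hX.unheld_le hl

theorem Trouble.subsingleton (hX : I.Stable X) (hT : I.Trouble X x y) (i : ℕ) :
    (X i).Subsingleton := by
  rcases hX.subsingleton_or_clean with h | ⟨u, hu, hf, hc⟩
  · exact h i
  · exact absurd ⟨hX.safe_of_not_mem hT.2.2.1 fun h => hT.2.2.1 (hc _ h),
      hX.safe_of_not_mem hT.2.2.2.1 fun h => hT.2.2.2.1 (hc _ h)⟩ (hT.2.2.2.2 u hu hf)

theorem Trouble.mem_root (hX : I.Stable X) (hT : I.Trouble X x y) : y ∈ X (I.root X x) := by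
  by_contra h
  exact hT.2.2.2.2 _ (root_lt (good_lt hT.1.1).1) (hX.free_root x)
    ⟨hX.safe_root hT.2.2.1, hX.safe_of_not_mem hT.2.2.2.1 h⟩

theorem Trouble.root_eq (hX : I.Stable X) (hT : I.Trouble X x y) : X (I.root X x) = {y} :=
  Set.eq_singleton_iff_unique_mem.2
    ⟨hT.mem_root hX, fun _ h => hT.subsingleton hX _ h (hT.mem_root hX)⟩

theorem Trouble.ne (hT : I.Trouble X x y) : x ≠ y := by
  rintro rfl
  exact not_mem_good _ hT.1.1

theorem Trouble.root_ne_root (hX : I.Stable X) (hT : I.Trouble X x y) :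
    I.root X x ≠ I.root X y := by
  intro h
  have h1 := hT.root_eq hX
  rw [h, hT.symm.root_eq hX] at h1
  exact hT.ne (by simpa using h1)

theorem Trouble.root_mem_good (hX : I.Stable X) (hT : I.Trouble X x y) :
    I.root X x ∈ I.good y := by
  by_contra h
  refine hT.2.2.2.2 _ (root_lt (good_lt hT.1.1).1) (hX.free_root x) ⟨hX.safe_root hT.2.2.1, ?_⟩
  have : I.offer X y (I.root X x) = I.unheld X y := by
    ext k
    simp [offer, h]
  rw [Safe, this]
  exact hX.unheld_le hT.2.2.2.1

theorem Trouble.pool_sub (hX : I.Stable X) (hT : I.Trouble X x y) : I.pool X x y ⊆ I.good x := by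
  rintro k (h | rfl)
  · exact h.1
  · exact hT.symm.root_mem_good hX

/-- Belonging to one of the two chains that are shifted. -/
def OnChains (I : LocalInstance) (X : ℕ → Set ℕ) (x y q : ℕ) : Prop :=
  I.OnChain X x q ∨ I.OnChain X y q

theorem OnChains.symm {q : ℕ} (h : OnChains I X x y q) : OnChains I X y x q := Or.symm h

theorem OnChains.not_wants_left (hX : I.Stable X) (hT : I.Trouble X x y) {q : ℕ}
    (h : OnChains I X x y q) : ¬ I.Wants X x q := by
  intro hw
  rcases h with h | h
  · exact absurd (OnChain.le hX.toInv h) (hX.lt hw).not_ge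
  · exact hT.root_ne_root hX (OnChain.root_eq hX.toInv (h.tail hw))

theorem OnChains.pred_unique (hX : I.Stable X) (hT : I.Trouble X x y) {q q' z : ℕ}
    (h : OnChains I X x y q) (h' : OnChains I X x y q') (hw : I.Wants X z q)
    (hw' : I.Wants X z q') : q = q' := by
  rcases h with h | h <;> rcases h' with h' | h'
  · exact OnChain.pred_unique hX.toInv h h' hw hw'
  · exact absurd ((OnChain.root_eq hX.toInv (h.tail hw)).symm.trans
      (OnChain.root_eq hX.toInv (h'.tail hw'))) (hT.root_ne_root hX)
  · exact absurd ((OnChain.root_eq hX.toInv (h'.tail hw')).symm.trans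
      (OnChain.root_eq hX.toInv (h.tail hw))) (hT.root_ne_root hX)
  · exact OnChain.pred_unique hX.toInv h h' hw hw'

theorem OnChains.tail {q z : ℕ} (h : OnChains I X x y q) (hw : I.Wants X z q) :
    OnChains I X x y z := h.imp (fun h => h.tail hw) fun h => h.tail hw

theorem OnChains.exists_pred {q : ℕ} (h : OnChains I X x y q) (hx : q ≠ x) (hy : q ≠ y) :
    ∃ q', OnChains I X x y q' ∧ I.Wants X q q' := by
  rcases h with h | h
  · rcases Relation.ReflTransGen.cases_tail h with h | ⟨b, hb, hbq⟩
    · exact absurd h hx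
    · exact ⟨b, Or.inl hb, hbq⟩
  · rcases Relation.ReflTransGen.cases_tail h with h | ⟨b, hb, hbq⟩
    · exact absurd h hy
    · exact ⟨b, Or.inr hb, hbq⟩

theorem OnChains.root_left : OnChains I X x y (I.root X x) := Or.inl (onChain_root x)

theorem OnChains.root_right : OnChains I X x y (I.root X y) := Or.inr (onChain_root y)

theorem OnChains.free (hX : I.Stable X) {q : ℕ} (h : OnChains I X x y q)
    (hq : I.Free X q) : q = I.root X x ∨ q = I.root X y :=
  h.imp (fun h => OnChain.free_eq_root hX.toInv h hq) fun h => OnChain.free_eq_root hX.toInv h hq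

theorem IsSwap.cases (h : I.IsSwap X x y X') {z : ℕ} (hzx : z ≠ x) (hzy : z ≠ y) :
    (∃ q, OnChains I X x y q ∧ I.Wants X z q ∧ X' z = {q}) ∨
      ((∀ q, OnChains I X x y q → ¬ I.Wants X z q) ∧ X' z = X z) := by
  obtain ⟨X₁, X₂, h1, h2, h3, -⟩ := h
  rw [h3 z hzx hzy]
  rcases h2 z with ⟨q, hq, hw, h⟩ | ⟨hy, h⟩
  · exact Or.inl ⟨q, Or.inr hq, hw, h⟩
  rcases h1 z with ⟨q, hq, hw, h'⟩ | ⟨hx, h'⟩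
  · exact Or.inl ⟨q, Or.inl hq, hw, h.trans h'⟩
  · exact Or.inr ⟨fun q hq => hq.elim (hx q) (hy q), h.trans h'⟩

theorem IsSwap.eq_of_wants (hX : I.Stable X) (hT : I.Trouble X x y) (h : I.IsSwap X x y X')
    {z q : ℕ} (hq : OnChains I X x y q) (hw : I.Wants X z q) : X' z = {q} := by
  have hzx : z ≠ x := by
    rintro rfl
    exact hq.not_wants_left hX hT hw
  have hzy : z ≠ y := by
    rintro rfl
    exact hq.symm.not_wants_left hX hT.symm hw
  rcases h.cases hzx hzy with ⟨q', hq', hw', hz⟩ | ⟨hz, _⟩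
  · rw [hz, hq.pred_unique hX hT hq' hw hw']
  · exact absurd hw (hz q hq)

theorem IsSwap.val_le (h : I.IsSwap X x y X') {z : ℕ} (hzx : z ≠ x) (hzy : z ≠ y) :
    I.val z (X z) ≤ I.val z (X' z) := by
  rcases h.cases hzx hzy with ⟨q, _, hq, hz⟩ | ⟨_, hz⟩ <;> rw [hz]
  exact hq.2.2.le

theorem IsSwap.val_lt (hX : I.Stable X) (hT : I.Trouble X x y) (h : I.IsSwap X x y X') {z : ℕ}
    (hz : OnChains I X x y z) (hzx : z ≠ x) (hzy : z ≠ y) :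
    I.val z (X z) < I.val z (X' z) := by
  obtain ⟨q, hq, hw⟩ := hz.exists_pred hzx hzy
  rw [h.eq_of_wants hX hT hq hw]
  exact hw.2.2

theorem Trouble.root_ne_left (hX : I.Stable X) (hT : I.Trouble X x y) :
    I.root X x ≠ x ∧ I.root X x ≠ y :=
  ⟨fun h => hT.2.2.1 (by have := hX.free_root x; rwa [h] at this),
    fun h => hT.2.2.2.1 (by have := hX.free_root x; rwa [h] at this)⟩

/-- After the swap, the members of the pool of `x`, apart from `y`, do not envy `x`. -/
theorem IsSwap.le_of_mem_pool (hX : I.Stable X) (hT : I.Trouble X x y) (h : I.IsSwap X x y X')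
    {a : ℕ} (ha : a ∈ I.pool X x y) (hax : a ≠ x) (hay : a ≠ y) (hg : x ∈ I.good a) :
    I.val a {x} ≤ I.val a (X' a) := by
  refine (?_ : _ ≤ I.val a (X a)).trans (h.val_le hax hay)
  rcases ha with ha | rfl
  · exact hX.le (unheld_symm ha hg)
  · rw [hT.symm.root_eq hX]

theorem IsSwap.le_of_mem_pool_right (hX : I.Stable X) (hT : I.Trouble X x y)
    (h : I.IsSwap X x y X') {a : ℕ} (ha : a ∈ I.pool X y x) (hax : a ≠ x) (hay : a ≠ y)
    (hg : y ∈ I.good a) : I.val a {y} ≤ I.val a (X' a) := by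
  refine (?_ : _ ≤ I.val a (X a)).trans (h.val_le hax hay)
  rcases ha with ha | rfl
  · exact hX.le (unheld_symm ha hg)
  · rw [hT.root_eq hX]

theorem not_self_mem_pool (hX : I.Stable X) (hT : I.Trouble X x y) : x ∉ I.pool X x y :=
  fun h => not_mem_good _ (hT.pool_sub hX h)

/-- What remains of the old situation of an agent who is envied after the swap. -/
theorem IsSwap.wants_cases (hX : I.Stable X) (hT : I.Trouble X x y) (h : I.IsSwap X x y X')
    {a i : ℕ} (ha : I.Wants X' a i) :
    (i = x ∧ a = y ∧ I.val x (I.pool X x y \ {y}) < I.val x {y} ∧ X' x = {y} ∧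
        X' y = I.pool X y x \ {x}) ∨
      (i ≠ x ∧ i ≠ y ∧ X' i = {a} ∧ ((a = x ∨ a = y) ∨ I.Wants X a i ∧ X' i = X i)) := by
  obtain ⟨h1, h2, h3⟩ := ha
  by_cases hix : i = x
  · subst hix
    left
    obtain ⟨X₁, X₂, -, -, -, ⟨-, hx, hy⟩ | ⟨hlt, hx, hy⟩⟩ := id h
    · exfalso
      rw [hx] at h1
      exact absurd h3 (h.le_of_mem_pool hX hT h1.1
        (fun e => not_self_mem_pool hX hT (e ▸ h1.1)) h1.2 h2).not_gt
    · rw [hx] at h1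
      exact ⟨rfl, h1, hlt, hx, hy⟩
  by_cases hiy : i = y
  · subst hiy
    exfalso
    obtain ⟨X₁, X₂, -, -, -, ⟨hle, hx, hy⟩ | ⟨hlt, hx, hy⟩⟩ := id h
    · rw [hy] at h1
      by_cases hax : a = x
      · subst hax
        rw [hx] at h3
        exact absurd h3 hle.not_gt
      · exact absurd h3 (h.le_of_mem_pool_right hX hT h1 hax
          (fun e => not_self_mem_pool hX hT.symm (e ▸ h1)) h2).not_gt
    · rw [hy] at h1
      exact absurd h3 (h.le_of_mem_pool_right hX hT h1.1 h1.2
        (fun e => not_self_mem_pool hX hT.symm (e ▸ h1.1)) h2).not_gt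
  right
  refine ⟨hix, hiy, ?_⟩
  rcases h.cases hix hiy with ⟨q, hq, hw, hz⟩ | ⟨hq, hz⟩
  · rw [hz] at h1 ⊢
    obtain rfl : a = q := h1
    refine ⟨rfl, Or.inl ?_⟩
    by_contra! hc
    have := h.val_lt hX hT hq hc.1 hc.2
    rw [hX.single hw] at this
    exact absurd h3 this.le.not_gt
  · rw [hz] at h1
    refine ⟨?_, ?_⟩
    · rw [hz]
      exact Set.eq_singleton_iff_unique_mem.2 ⟨h1, fun _ h => hT.subsingleton hX _ h h1⟩
    · by_contra! hc
      exact absurd hz (hc.2 ⟨h1, h2, (h.val_le hc.1.1 hc.1.2).trans_lt h3⟩)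

/-- An unheld item after the swap was unheld before, unless it was held by somebody who did not
envy anybody for it. -/
theorem IsSwap.unheld_cases (hX : I.Stable X) (hT : I.Trouble X x y) (h : I.IsSwap X x y X')
    {i k : ℕ} (hk : k ∈ I.unheld X' i) :
    k ∈ I.unheld X i ∨ (k ∈ X i ∧ (i = I.root X x ∨ i = I.root X y)) ∨
      (i ∈ X k ∧ (k = I.root X x ∨ k = I.root X y)) := by
  -- an item that an agent of the two chains holds cannot be unheld unless the agent is a root
  have key : ∀ a b, b ∈ X a → b ∉ X' a → a ∉ X' b → a = I.root X x ∨ a = I.root X y := by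
    intro a b h1 h2 h3
    have hch : OnChains I X x y a := by
      by_cases hax : a = x
      · subst hax; exact Or.inl Relation.ReflTransGen.refl
      by_cases hay : a = y
      · subst hay; exact Or.inr Relation.ReflTransGen.refl
      rcases h.cases hax hay with ⟨q, hq, hw, _⟩ | ⟨_, hz⟩
      · exact hq.tail hw
      · exact absurd (hz ▸ h1) h2
    by_cases hf : I.Free X a
    · exact hch.free hX hf
    · exfalso
      have hw := wants_envier hf
      rw [hX.single hw] at h1
      rw [h1, h.eq_of_wants hX hT hch hw] at h3
      exact h3 rfl
  by_cases h1 : k ∈ X i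
  · exact Or.inr (Or.inl ⟨h1, key i k h1 hk.2.1 hk.2.2⟩)
  by_cases h2 : i ∈ X k
  · exact Or.inr (Or.inr ⟨h2, key k i h2 hk.2.2 hk.2.1⟩)
  · exact Or.inl ⟨hk.1, h1, h2⟩

theorem Trouble.not_mem_chain (hX : I.Stable X) (hT : I.Trouble X x y) {q z : ℕ}
    (hq : OnChains I X x y q) (hw : I.Wants X z q) :
    (q = x → z ∉ I.pool X x y ∧ z ≠ y) ∧ (q = y → z ∉ I.pool X y x ∧ z ≠ x) := by
  refine ⟨?_, ?_⟩
  · rintro rfl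
    refine ⟨?_, ?_⟩
    · rintro (h | rfl)
      · exact h.2.1 hw.1
      · exact hT.root_ne_root hX (OnChain.free_eq_root hX.toInv
          (Relation.ReflTransGen.single hw) (hX.free_root _)).symm
    · rintro rfl
      exact hT.1.2.1 hw.1
  · rintro rfl
    refine ⟨?_, ?_⟩
    · rintro (h | rfl)
      · exact h.2.1 hw.1
      · exact hT.root_ne_root hX (OnChain.free_eq_root hX.toInv
          (Relation.ReflTransGen.single hw) (hX.free_root _))
    · rintro rfl
      exact hT.2.1.2.1 hw.1

/-- A member of the pool of `x` whose bundle the swap does not change does not hold an item of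
`x`. -/
theorem Trouble.not_mem_of_pool (hX : I.Stable X) (hT : I.Trouble X x y) {k : ℕ}
    (hk : k ∈ I.pool X x y) (hold : ∀ q, OnChains I X x y q → ¬ I.Wants X k q) : x ∉ X k := by
  rcases hk with h | rfl
  · exact h.2.2
  · obtain ⟨q, hq, hw⟩ := root_wants (hX.root_ne hT.2.2.2.1)
    exact absurd hw (hold q (Or.inr hq))

theorem IsSwap.disj (hX : I.Stable X) (hT : I.Trouble X x y) (h : I.IsSwap X x y X') {i k : ℕ}
    (hk : k ∈ X' i) : i ∉ X' k := by
  have hne := hT.ne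
  have hxy : (X' x = I.pool X x y \ {y} ∧ X' y = I.pool X y x) ∨
      (X' x = {y} ∧ X' y = I.pool X y x \ {x}) := by
    obtain ⟨X₁, X₂, -, -, -, ⟨-, h⟩ | ⟨-, h⟩⟩ := h
    · exact Or.inl h
    · exact Or.inr h
  have hx : ∀ k, k ∈ X' x → k = y ∨ k ∈ I.pool X x y := by
    intro k hk
    rcases hxy with ⟨hx, -⟩ | ⟨hx, -⟩ <;> rw [hx] at hk
    · exact Or.inr hk.1
    · exact Or.inl hk
  have hy : ∀ k, k ∈ X' y → k = x ∨ k ∈ I.pool X y x := by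
    intro k hk
    rcases hxy with ⟨-, hx⟩ | ⟨-, hx⟩ <;> rw [hx] at hk
    · exact Or.inr hk
    · exact Or.inr hk.1
  -- the agents other than `x` and `y` do not hold an item that `x` or `y` also holds
  have key : ∀ i k, i ≠ x → i ≠ y → k ∈ X' i → i ∈ X' k → k ≠ x ∧ k ≠ y := by
    intro i k hix hiy hk hi
    rcases h.cases hix hiy with ⟨q, hq, hw, hz⟩ | ⟨hold, hz⟩ <;> rw [hz] at hk
    · obtain rfl : k = q := hk
      obtain ⟨h1, h2⟩ := hT.not_mem_chain hX hq hw
      refine ⟨fun e => ?_, fun e => ?_⟩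
      · rcases hx i (e ▸ hi) with h | h
        · exact hiy h
        · exact (h1 e).1 h
      · rcases hy i (e ▸ hi) with h | h
        · exact hix h
        · exact (h2 e).1 h
    · refine ⟨fun e => ?_, fun e => ?_⟩
      · subst e
        rcases hx i hi with h | h
        · exact hiy h
        · exact hT.not_mem_of_pool hX h hold hk
      · subst e
        rcases hy i hi with h | h
        · exact hix h
        · exact hT.symm.not_mem_of_pool hX h (fun q hq => hold q hq.symm) hk
  intro hi
  by_cases hix : i = x <;> by_cases hiy : i = y <;> by_cases hkx : k = x <;>
    by_cases hky : k = y
  all_goals try (exact hne (by omega))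
  · subst hix hkx
    rcases hx _ hk with h | h
    · exact hiy h
    · exact not_self_mem_pool hX hT h
  · subst hix hky
    rcases hxy with ⟨h1, h2⟩ | ⟨h1, h2⟩
    · rw [h1] at hk; exact hk.2 rfl
    · rw [h2] at hi; exact hi.2 rfl
  · subst hix
    exact (key k i hkx hky hi hk).1 rfl
  · subst hiy hkx
    rcases hxy with ⟨h1, h2⟩ | ⟨h1, h2⟩
    · rw [h1] at hi; exact hi.2 rfl
    · rw [h2] at hk; exact hk.2 rfl
  · subst hiy hky
    rcases hy _ hk with h | h
    · exact hix h
    · exact not_self_mem_pool hX hT.symm h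
  · subst hiy
    exact (key k i hkx hky hi hk).2 rfl
  · exact (key i k hix hiy hk hi).1 hkx
  · exact (key i k hix hiy hk hi).2 hky
  · rcases h.cases hix hiy with ⟨q, hq, hw, hz⟩ | ⟨hold, hz⟩ <;>
    rcases h.cases hkx hky with ⟨q', hq', hw', hz'⟩ | ⟨hold', hz'⟩ <;>
    rw [hz] at hk <;> rw [hz'] at hi
    · obtain rfl : k = q := hk
      obtain rfl : i = q' := hi
      exact absurd (hX.lt hw) (hX.lt hw').not_gt
    · obtain rfl : k = q := hk
      obtain ⟨b, hb, hbk⟩ := hq.exists_pred hkx hky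
      exact hold' b hb hbk
    · obtain rfl : i = q' := hi
      obtain ⟨b, hb, hbk⟩ := hq'.exists_pred hix hiy
      exact hold b hb hbk
    · exact hX.disj hk hi

theorem IsSwap.unheld_left_sub (hX : I.Stable X) (hT : I.Trouble X x y) (h : I.IsSwap X x y X') :
    I.unheld X' x ⊆ I.pool X x y := by
  intro k hk
  rcases h.unheld_cases hX hT hk with h | ⟨-, h⟩ | ⟨h1, rfl | rfl⟩
  · exact Or.inl h
  · rcases h with h | h
    · exact absurd h.symm (hT.root_ne_left hX).1
    · exact absurd h.symm (hT.symm.root_ne_left hX).2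
  · rw [hT.root_eq hX] at h1
    exact absurd h1 hT.ne
  · exact Or.inr rfl

theorem IsSwap.unheld_right_sub (hX : I.Stable X) (hT : I.Trouble X x y)
    (h : I.IsSwap X x y X') : I.unheld X' y ⊆ I.pool X y x := by
  intro k hk
  rcases h.unheld_cases hX hT hk with h | ⟨-, h⟩ | ⟨h1, rfl | rfl⟩
  · exact Or.inl h
  · rcases h with h | h
    · exact absurd h.symm (hT.root_ne_left hX).2
    · exact absurd h.symm (hT.symm.root_ne_left hX).1
  · exact Or.inr rfl
  · rw [hT.symm.root_eq hX] at h1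
    exact absurd h1.symm hT.ne

theorem IsSwap.unheld_right (hX : I.Stable X) (hT : I.Trouble X x y)
    (h : I.IsSwap X x y X') : I.unheld X' y = ∅ := by
  refine Set.eq_empty_iff_forall_notMem.2 fun k hk => ?_
  have := h.unheld_right_sub hX hT hk
  obtain ⟨X₁, X₂, -, -, -, ⟨-, hx, hy⟩ | ⟨-, hx, hy⟩⟩ := h
  · exact hk.2.1 (hy ▸ this)
  · by_cases hkx : k = x
    · subst hkx
      exact hk.2.2 (by rw [hx]; rfl)
    · exact hk.2.1 (by rw [hy]; exact ⟨this, hkx⟩)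

/-- If `x` chooses the item between `x` and `y`, then she is satisfied with it even if all the rest
of her pool stays unheld; otherwise she has no unheld goods. -/
theorem IsSwap.unheld_left (hX : I.Stable X) (hT : I.Trouble X x y) (h : I.IsSwap X x y X') :
    I.unheld X' x = ∅ ∨ (x ∉ X' y ∧ I.val x (I.unheld X' x) ≤ I.val x (X' x)) := by
  have hsub := h.unheld_left_sub hX hT
  have hy' : x ∈ I.pool X y x := Or.inl hT.2.1
  obtain ⟨X₁, X₂, -, -, -, ⟨-, hx, hy⟩ | ⟨hlt, hx, hy⟩⟩ := h
  · left
    refine Set.eq_empty_iff_forall_notMem.2 fun k hk => ?_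
    by_cases hky : k = y
    · subst hky
      exact hk.2.2 (by rw [hy]; exact hy')
    · exact hk.2.1 (by rw [hx]; exact ⟨hsub hk, hky⟩)
  · right
    refine ⟨by rw [hy]; exact fun h => h.2 rfl, ?_⟩
    rw [hx]
    refine le_trans (I.mono ?_ (Set.sdiff_subset.trans (hT.pool_sub hX))) hlt.le
    intro k hk
    exact ⟨hsub hk, fun e => hk.2.1 (by rw [hx]; exact e)⟩

theorem IsSwap.oriented (hX : I.Stable X) (hT : I.Trouble X x y) (h : I.IsSwap X x y X') :
    I.Oriented X' where
  sub z := by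
    by_cases hzx : z = x
    · subst hzx
      obtain ⟨X₁, X₂, -, -, -, ⟨-, hx, -⟩ | ⟨-, hx, -⟩⟩ := h <;> rw [hx]
      · exact Set.sdiff_subset.trans (hT.pool_sub hX)
      · exact Set.singleton_subset_iff.2 hT.1.1
    by_cases hzy : z = y
    · subst hzy
      obtain ⟨X₁, X₂, -, -, -, ⟨-, -, hx⟩ | ⟨-, -, hx⟩⟩ := h <;> rw [hx]
      · exact hT.symm.pool_sub hX
      · exact Set.sdiff_subset.trans (hT.symm.pool_sub hX)
    rcases h.cases hzx hzy with ⟨q, _, hq, hz⟩ | ⟨_, hz⟩ <;> rw [hz]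
    · simpa using hq.2.1
    · exact hX.sub z
  disj hk := h.disj hX hT hk
  single ha := by
    rcases h.wants_cases hX hT ha with ⟨rfl, rfl, -, hx, -⟩ | ⟨-, -, hx, -⟩ <;> exact hx
  le := by
    intro i k hk
    by_cases hix : i = x
    · subst hix
      rcases h.unheld_left hX hT with h0 | ⟨-, h0⟩
      · rw [h0] at hk; exact absurd hk (Set.notMem_empty k)
      · exact (I.mono (Set.singleton_subset_iff.2 hk) (unheld_sub _)).trans h0
    by_cases hiy : i = y
    · subst hiy
      rw [h.unheld_right hX hT] at hk
      exact absurd hk (Set.notMem_empty k)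
    refine (hX.val_le hk.1 ?_).trans (h.val_le hix hiy)
    intro hw
    rcases h.unheld_cases hX hT hk with h | ⟨h, -⟩ | ⟨-, rfl | rfl⟩
    · exact h.2.2 hw.1
    · exact hX.disj hw.1 h
    · exact hX.free_root x i hw
    · exact hX.free_root y i hw

theorem IsSwap.free_right (hX : I.Stable X) (hT : I.Trouble X x y) (h : I.IsSwap X x y X') :
    I.Free X' y := by
  intro a ha
  rcases h.wants_cases hX hT ha with ⟨h, -⟩ | ⟨-, h, -⟩
  · exact hT.ne h.symm
  · exact h rfl

/-- After the swap, `x` and `y` are safe for all other envied agents. -/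
theorem IsSwap.safe (hX : I.Stable X) (hT : I.Trouble X x y) (h : I.IsSwap X x y X') {i w : ℕ}
    (hix : i ≠ x) (hiy : i ≠ y) (hf : ¬ I.Free X' i) (hw : w = x ∨ w = y) : I.Safe X' i w := by
  have hpool : i ∈ X' w → w ∈ I.good i → w ∈ I.unheld X i ∨ (w ∈ X i ∧
      (i = I.root X x ∨ i = I.root X y)) := by
    intro hi hg
    rcases hw with rfl | rfl
    · have : i ∈ I.pool X w y := by
        obtain ⟨X₁, X₂, -, -, -, ⟨-, hx, -⟩ | ⟨-, hx, -⟩⟩ := h <;> rw [hx] at hi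
        · exact hi.1
        · exact absurd hi hiy
      rcases this with h | rfl
      · exact Or.inl (unheld_symm h hg)
      · exact Or.inr ⟨hT.symm.mem_root hX, Or.inr rfl⟩
    · have : i ∈ I.pool X w x := by
        obtain ⟨X₁, X₂, -, -, -, ⟨-, -, hx⟩ | ⟨-, -, hx⟩⟩ := h <;> rw [hx] at hi
        · exact hi
        · exact hi.1
      rcases this with h | rfl
      · exact Or.inl (unheld_symm h hg)
      · exact Or.inr ⟨hT.mem_root hX, Or.inl rfl⟩
  have hoff : ∀ k ∈ I.offer X' i w, k ∈ I.unheld X i ∨ (k ∈ X i ∧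
      (i = I.root X x ∨ i = I.root X y)) := by
    rintro k (hk | ⟨rfl, hi, hg⟩)
    · rcases h.unheld_cases hX hT hk with h | h | ⟨h, rfl | rfl⟩
      · exact Or.inl h
      · exact Or.inr h
      · rw [hT.root_eq hX] at h
        exact absurd h hiy
      · rw [hT.symm.root_eq hX] at h
        exact absurd h hix
    · exact hpool hi hg
  by_cases hroot : i = I.root X x ∨ i = I.root X y
  · have hch : OnChains I X x y i := by
      rcases hroot with rfl | rfl
      · exact OnChains.root_left
      · exact OnChains.root_right
    have hfi : I.Free X i := by
      rcases hroot with rfl | rfl <;> exact hX.free_root _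
    obtain ⟨q, hq, hwq⟩ := hch.exists_pred hix hiy
    have habs := hX.not_absorb i q
    rw [CanAbsorb, not_and, not_and, not_le] at habs
    rw [Safe, h.eq_of_wants hX hT hq hwq]
    refine (I.mono ?_ (Set.union_subset (hX.sub i) (unheld_sub i))).trans (habs hwq hfi).le
    intro k hk
    rcases hoff k hk with h | h
    · exact Or.inr h
    · exact Or.inl h.1
  · refine (I.mono (T := I.unheld X i) ?_ (unheld_sub i)).trans
      ((?_ : _ ≤ I.val i (X i)).trans (h.val_le hix hiy))
    · intro k hk
      exact (hoff k hk).resolve_right fun h => hroot h.2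
    by_cases hfi : I.Free X i
    · -- an agent who has become envied is envied by `x` or `y`; otherwise she could be released
      have hw' := wants_envier hf
      rcases h.wants_cases hX hT hw' with ⟨h, -⟩ | ⟨-, -, hi, hxy⟩
      · exact absurd h hix
      rcases hxy with hxy | ⟨hw, -⟩
      · have hXi : X i = {I.envier X' i} := by
          rcases h.cases hix hiy with ⟨q, hq, hwq, -⟩ | ⟨-, hz⟩
          · exact absurd ((hq.tail hwq).free hX hfi) hroot
          · rw [← hz, hi]
        have hlt := (good_lt hw'.2.1).2
        have main : ∀ a b, I.Trouble X a b → I.envier X' i = a → ¬ I.Safe X a i := by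
          intro a b hT' ha hs
          refine hT'.2.2.2.2 i hlt hfi ⟨hs, hX.safe_of_not_mem hT'.2.2.2.1 ?_⟩
          rw [hXi, ha]
          exact fun e => hT'.ne (Set.mem_singleton_iff.1 e).symm
        have hrel := hX.not_release (I.envier X' i) i
        have hns : ¬ I.Safe X (I.envier X' i) i ∧ ¬ I.Free X (I.envier X' i) := by
          rcases hxy with e | e
          · exact ⟨by have := main x y hT e; rwa [← e] at this, e ▸ hT.2.2.1⟩
          · exact ⟨by have := main y x hT.symm e; rwa [← e] at this, e ▸ hT.2.2.2.1⟩
        by_contra hlt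
        exact hrel ⟨hns.2, hfi, hns.1, Or.inr ⟨by rw [hXi]; rfl, (not_le.1 hlt).le⟩⟩
      · exact absurd hw (hfi _)
    · exact hX.unheld_le hfi

theorem IsSwap.completable (hX : I.Stable X) (hT : I.Trouble X x y) (h : I.IsSwap X x y X') :
    I.Completable X' where
  toOriented := h.oriented hX hT
  receiver := by
    have hxn := (good_lt hT.1.1).1
    have hyn := (good_lt hT.1.1).2
    have hO := h.oriented hX hT
    have hfy := h.free_right hX hT
    have hxy : y ∈ X' x ∨ x ∈ X' y := by
      obtain ⟨X₁, X₂, -, -, -, ⟨-, -, hx⟩ | ⟨-, hx, -⟩⟩ := h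
      · right; rw [hx]; exact Or.inl hT.2.1
      · left; rw [hx]; rfl
    -- the unheld items of `y` are no goods for `y`
    have of_y : ∀ b, I.adj y b → b ∉ X' y → y ∉ X' b → ∃ w < I.n, I.Receiver X' w y b := by
      intro b hab h1 h2
      have hng : b ∉ I.good y := by
        intro hg
        have : b ∈ I.unheld X' y := ⟨hg, h1, h2⟩
        rw [h.unheld_right hX hT] at this
        exact this
      have hbx : b ≠ x := by
        rintro rfl
        exact hxy.elim h2 h1
      by_cases hc : b ∈ I.chore y
      · by_cases he : ∃ w, I.Wants X' y w
        · obtain ⟨w, hw⟩ := he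
          exact ⟨w, hw.lt_n.2, Or.inr (Or.inr (Or.inr (Or.inl ⟨hw, hc⟩)))⟩
        · have hfx : I.Free X' x := by
            intro a ha
            rcases h.wants_cases hX hT ha with ⟨-, rfl, -⟩ | ⟨h, -⟩
            · exact he ⟨_, ha⟩
            · exact h rfl
          by_cases hb : y ∈ I.good b ∧ I.Free X' b
          · exact ⟨b, I.adj_lt (I.adj_symm hab), Or.inr (Or.inl ⟨rfl, hb.2, I.not_chore hb.1⟩)⟩
          · refine ⟨x, hxn, Or.inr (Or.inr (Or.inl ⟨hT.ne, hbx.symm, hfx,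
              fun h => absurd h hng, fun hg => ?_⟩))⟩
            exact h.safe hX hT hbx (fun e => I.adj_irrefl y (e ▸ hab)) (fun hf => hb ⟨hg, hf⟩)
              (Or.inl rfl)
      · exact ⟨y, hyn, Or.inl ⟨rfl, hfy, hc⟩⟩
    intro a b hab h1 h2
    by_cases hay : a = y
    · subst hay; exact of_y b hab h1 h2
    by_cases hby : b = y
    · subst hby
      obtain ⟨w, hw, hr⟩ := of_y a (I.adj_symm hab) h2 h1
      exact ⟨w, hw, hr.symm⟩
    by_cases ha : b ∈ I.good a ∧ I.Free X' a
    · exact ⟨a, I.adj_lt hab, Or.inl ⟨rfl, ha.2, I.not_chore ha.1⟩⟩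
    by_cases hb : a ∈ I.good b ∧ I.Free X' b
    · exact ⟨b, I.adj_lt (I.adj_symm hab), Or.inr (Or.inl ⟨rfl, hb.2, I.not_chore hb.1⟩)⟩
    have hsafe : ∀ i, i ≠ y → ¬ I.Free X' i → I.Safe X' i y := by
      intro i hiy hf
      by_cases hix : i = x
      · subst hix
        have hc := h.wants_cases hX hT (wants_envier hf)
        rcases hc with ⟨-, -, -, hx, hy⟩ | ⟨h, -⟩
        · have hiy : i ∉ X' y := by rw [hy]; exact fun h => h.2 rfl
          rw [Safe, offer_eq_unheld hiy]
          rcases h.unheld_left hX hT with h0 | h0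
          · rw [h0]
            exact I.mono (Set.empty_subset _) (hO.sub i)
          · exact h0.2
        · exact absurd rfl h
      · exact h.safe hX hT hix hiy hf (Or.inr rfl)
    exact ⟨y, hyn, Or.inr (Or.inr (Or.inl ⟨fun e => hay e.symm, fun e => hby e.symm, hfy,
      fun hg => hsafe a hay fun hf => ha ⟨hg, hf⟩,
      fun hg => hsafe b hby fun hf => hb ⟨hg, hf⟩⟩))⟩

end Swap

/-! ### Picking single items in turn -/

variable (I) in
/-- The state of serial picking when the agents before `i` are done and `i` has considered the items
to agents before `m`: all bundles have at most one element, an agent who has picked prefers her item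
to all others that were not taken by agents before her, and later agents have nothing. -/
structure Picking (X : ℕ → Set ℕ) (i m : ℕ) : Prop where
  sub : ∀ a, X a ⊆ I.good a
  disj : ∀ {a k}, k ∈ X a → a ∉ X k
  subsingleton : ∀ a, (X a).Subsingleton
  empty : ∀ a, i < a → X a = ∅
  done : ∀ a < i, ∀ k ∈ I.good a, ¬ (a ∈ X k ∧ k < a) → I.val a {k} ≤ I.val a (X a)
  current : ∀ k < m, k ∈ I.good i → i ∉ X k → I.val i {k} ≤ I.val i (X i)

variable (I) in
/-- Agent `i` exchanges her bundle for the item to `m` if nobody holds it and she prefers it. -/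
def IsPick (X : ℕ → Set ℕ) (i m : ℕ) (X' : ℕ → Set ℕ) : Prop :=
  (m ∈ I.good i ∧ i ∉ X m ∧ I.val i (X i) < I.val i {m} ∧ X' = Function.update X i {m}) ∨
    (¬ (m ∈ I.good i ∧ i ∉ X m ∧ I.val i (X i) < I.val i {m}) ∧ X' = X)

theorem Picking.step {i m : ℕ} {X' : ℕ → Set ℕ} (hX : I.Picking X i m) (h : I.IsPick X i m X') :
    I.Picking X' i (m + 1) := by
  rcases h with ⟨hm, him, hlt, rfl⟩ | ⟨hm, rfl⟩
  · have hne : m ≠ i := by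
      rintro rfl
      exact not_mem_good _ hm
    refine ⟨fun a => ?_, @fun a k hk ha => ?_, fun a => ?_, fun a ha => ?_, fun a ha k hk h => ?_,
      fun k hk hg h => ?_⟩
    · by_cases hai : a = i
      · subst hai; simpa using hm
      · rw [Function.update_of_ne hai]; exact hX.sub a
    · by_cases hai : a = i <;> by_cases hki : k = i
      · subst hai hki
        rw [Function.update_self] at hk
        exact hne hk.symm
      · subst hai
        rw [Function.update_self] at hk
        rw [Function.update_of_ne hki] at ha
        obtain rfl : k = m := hk
        exact him ha
      · subst hki
        rw [Function.update_self] at ha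
        rw [Function.update_of_ne hai] at hk
        obtain rfl : a = m := ha
        exact him hk
      · rw [Function.update_of_ne hai] at hk
        rw [Function.update_of_ne hki] at ha
        exact hX.disj hk ha
    · by_cases hai : a = i
      · subst hai; rw [Function.update_self]; exact Set.subsingleton_singleton
      · rw [Function.update_of_ne hai]; exact hX.subsingleton a
    · rw [Function.update_of_ne ha.ne']; exact hX.empty a ha
    · rw [Function.update_of_ne ha.ne]
      refine hX.done a ha k hk fun ⟨h1, h2⟩ => h ⟨?_, h2⟩
      rw [Function.update_of_ne (by omega)]
      exact h1
    · have hki : k ≠ i := by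
        rintro rfl
        exact not_mem_good _ hg
      rw [Function.update_of_ne hki] at h
      rw [Function.update_self]
      rcases Nat.lt_succ_iff_lt_or_eq.1 hk with hk | rfl
      · exact (hX.current k hk hg h).trans hlt.le
      · exact le_rfl
  · refine ⟨hX.sub, hX.disj, hX.subsingleton, hX.empty, hX.done, fun k hk hg h => ?_⟩
    rcases Nat.lt_succ_iff_lt_or_eq.1 hk with hk | rfl
    · exact hX.current k hk hg h
    · exact not_lt.1 fun hlt => hm ⟨hg, h, hlt⟩

theorem Picking.next {i : ℕ} (hX : I.Picking X i I.n) : I.Picking X (i + 1) 0 := by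
  refine ⟨hX.sub, hX.disj, hX.subsingleton, fun a ha => hX.empty a (by omega),
    fun a ha k hk h => ?_, fun k hk => absurd hk (Nat.not_lt_zero k)⟩
  rcases Nat.lt_succ_iff_lt_or_eq.1 ha with ha | rfl
  · exact hX.done a ha k hk h
  · refine hX.current k (good_lt hk).2 hk fun hak => h ⟨hak, ?_⟩
    by_contra hle
    rcases (not_lt.1 hle).lt_or_eq with hlt | rfl
    · rw [hX.empty k hlt] at hak; exact hak
    · exact not_mem_good _ hk

theorem Picking.start (hX : ∀ a, X a = ∅) : I.Picking X 0 0 := by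
  refine ⟨fun a => ?_, @fun a k hk => ?_, fun a => ?_, fun a _ => hX a,
    fun a ha => absurd ha (Nat.not_lt_zero a), fun k hk => absurd hk (Nat.not_lt_zero k)⟩
  · rw [hX]; exact Set.empty_subset _
  · rw [hX] at hk; exact absurd hk (Set.notMem_empty k)
  · rw [hX]; exact Set.subsingleton_empty

theorem Picking.inv (hX : I.Picking X I.n 0) : I.Inv X where
  sub := hX.sub
  disj := hX.disj
  single h := Set.eq_singleton_iff_unique_mem.2 ⟨h.1, fun _ h' => hX.subsingleton _ h' h.1⟩
  le {i k} h := hX.done i (good_lt h.1).1 k h.1 fun h' => h.2.2 h'.1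
  lt {l i} h := by
    by_contra hlt
    exact absurd h.2.2 (hX.done l h.lt_n.1 i h.2.1 fun h' => hlt h'.2).not_gt

end LocalInstance
end GraphEFX

/-! ### From local instances to allocations -/

namespace GraphEFX

section Monotone

variable {E : Type*} [Finite E] {w : Set E → ℝ}

theorem le_of_subset_of_good_or_dummy {S T : Set E} (hST : S ⊆ T)
    (h : ∀ e ∈ T, e ∉ S → IsGood w e ∨ IsDummy w e) : w S ≤ w T := by
  have key : ∀ D : Set E, D.Finite → D ⊆ T \ S → w S ≤ w (S ∪ D) := by
    intro D hD
    induction D, hD using Set.Finite.induction_on with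
    | empty => simp
    | @insert a D ha _ ih =>
      intro hsub
      have haT := hsub (Set.mem_insert a D)
      have hn : a ∉ S ∪ D := by
        rintro (h | h)
        · exact haT.2 h
        · exact ha h
      refine (ih ((Set.subset_insert a D).trans hsub)).trans ?_
      rw [Set.union_insert]
      rcases h a haT.1 haT.2 with h | h
      · exact (h _ hn).le
      · exact (h _ hn).ge
  have := key (T \ S) (Set.toFinite _) subset_rfl
  rwa [Set.union_sdiff_cancel hST] at this

theorem le_of_subset_of_chore_or_dummy {S T : Set E} (hST : S ⊆ T)
    (h : ∀ e ∈ T, e ∉ S → IsChore w e ∨ IsDummy w e) : w T ≤ w S := by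
  have := le_of_subset_of_good_or_dummy (w := fun S => - w S) hST fun e he he' =>
    (h e he he').imp (fun h S hS => neg_lt_neg (h S hS)) fun h S hS => congrArg Neg.neg (h S hS)
  simpa using this

end Monotone

variable {G : SimpleGraph (Fin n)} {v : Fin n → Set G.edgeSet → ℝ}

variable (G) in
/-- The items between `i` and the agents in `S`. -/
def itemsTo (i : ℕ) (S : Set ℕ) : Set G.edgeSet :=
  {e | ∃ j k : Fin n, (e : Sym2 (Fin n)) = s(j, k) ∧ (j : ℕ) = i ∧ (k : ℕ) ∈ S}

variable (G v) in
/-- The value for `i` of the items between `i` and `S`. -/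
noncomputable def localVal (i : ℕ) (S : Set ℕ) : ℝ :=
  if h : i < n then v ⟨i, h⟩ (itemsTo G i S) else 0

variable (G) in
/-- Adjacency of the agents named by two numbers. -/
def LocalAdj (i k : ℕ) : Prop := ∃ (hi : i < n) (hk : k < n), G.Adj ⟨i, hi⟩ ⟨k, hk⟩

theorem localVal_val (i : Fin n) (S : Set ℕ) : localVal G v i S = v i (itemsTo G i S) := by
  simp [localVal]

theorem itemsTo_empty (i : ℕ) : itemsTo G i ∅ = ∅ := by
  ext e
  simp [itemsTo]

theorem itemsTo_singleton {i k : Fin n} (h : G.Adj i k) :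
    itemsTo G i {(k : ℕ)} = {⟨s(i, k), h⟩} := by
  ext e
  simp only [itemsTo, Set.mem_singleton_iff, Set.mem_ofPred_eq, Fin.val_inj, Subtype.ext_iff]
  constructor
  · rintro ⟨j, l, he, rfl, rfl⟩; exact he
  · intro h; exact ⟨i, k, h, rfl, rfl⟩

theorem itemsTo_mono {i : ℕ} {S T : Set ℕ} (h : S ⊆ T) : itemsTo G i S ⊆ itemsTo G i T := by
  rintro e ⟨j, k, he, hj, hk⟩
  exact ⟨j, k, he, hj, h hk⟩

/-- The kind of an item is determined by its value as a single item. -/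
theorem IsMixedInstance.kind (hG : IsMixedInstance G v) (i : Fin n) (e : G.edgeSet) :
    (v i ∅ < v i {e} → IsGood (v i) e) ∧ (v i {e} < v i ∅ → IsChore (v i) e) ∧
      (v i {e} = v i ∅ → IsDummy (v i) e) := by
  have h : IsGood (v i) e ∨ IsChore (v i) e ∨ IsDummy (v i) e := by
    by_cases hi : i ∈ (e : Sym2 (Fin n))
    · exact hG.incident i e hi
    · exact Or.inr (Or.inr (hG.not_incident i e hi))
  have h1 := fun h : IsGood (v i) e => h ∅ (Set.notMem_empty e)
  have h2 := fun h : IsChore (v i) e => h ∅ (Set.notMem_empty e)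
  have h3 := fun h : IsDummy (v i) e => h ∅ (Set.notMem_empty e)
  simp only [insert_empty_eq] at h1 h2 h3
  rcases h with h | h | h
  · have := h1 h
    exact ⟨fun _ => h, fun h' => absurd this h'.le.not_gt, fun h' => absurd this h'.le.not_gt⟩
  · have := h2 h
    exact ⟨fun h' => absurd this h'.le.not_gt, fun _ => h, fun h' => absurd this h'.ge.not_gt⟩
  · have := h3 h
    exact ⟨fun h' => absurd h' this.le.not_gt, fun h' => absurd h' this.ge.not_gt, fun _ => h⟩

theorem localAdj_symm {i k : ℕ} (h : LocalAdj G i k) : LocalAdj G k i :=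
  ⟨h.2.1, h.1, h.2.2.symm⟩

/-- The local view of a mixed instance. -/
noncomputable def localInstance (hG : IsMixedInstance G v) : LocalInstance where
  n := n
  adj := LocalAdj G
  good i := {k | LocalAdj G i k ∧ localVal G v i ∅ < localVal G v i {k}}
  chore i := {k | LocalAdj G i k ∧ localVal G v i {k} < localVal G v i ∅}
  val := localVal G v
  adj_symm := localAdj_symm
  adj_irrefl := fun i h => G.loopless.irrefl _ h.2.2
  adj_lt h := h.1
  good_adj h := h.1
  not_chore h h' := h.2.le.not_gt h'.2
  mono := by
    intro i S T hST hT
    by_cases hi : i < n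
    · simp only [localVal, hi, dite_true]
      refine le_of_subset_of_good_or_dummy (itemsTo_mono hST) ?_
      rintro e ⟨j, k, he, rfl, hk⟩ -
      obtain ⟨⟨_, _, hadj⟩, hlt⟩ := hT hk
      simp only [localVal_val, itemsTo_empty] at hlt
      rw [itemsTo_singleton (k := k) hadj] at hlt
      left
      refine (hG.kind j e).1 ?_
      rw [show e = ⟨s(j, k), hadj⟩ from Subtype.ext he]
      exact hlt
    · simp [localVal, hi]

section Final

variable {hG : IsMixedInstance G v} {X : ℕ → Set ℕ} {A : ℕ → ℕ → ℕ}

/-- The item between `i` and `k` is a good (chore) for `i` if and only if this holds for the local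
view. -/
theorem good_iff {i k : Fin n} (h : G.Adj i k) :
    (k : ℕ) ∈ (localInstance hG).good i ↔ v i ∅ < v i {⟨s(i, k), h⟩} := by
  change LocalAdj G i k ∧ localVal G v i ∅ < localVal G v i {(k : ℕ)} ↔ _
  rw [localVal_val, localVal_val, itemsTo_empty, itemsTo_singleton h]
  exact and_iff_right ⟨i.2, k.2, h⟩

theorem chore_iff {i k : Fin n} (h : G.Adj i k) :
    (k : ℕ) ∈ (localInstance hG).chore i ↔ v i {⟨s(i, k), h⟩} < v i ∅ := by
  change LocalAdj G i k ∧ localVal G v i {(k : ℕ)} < localVal G v i ∅ ↔ _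
  rw [localVal_val, localVal_val, itemsTo_empty, itemsTo_singleton h]
  exact and_iff_right ⟨i.2, k.2, h⟩

variable (hG X A) in
/-- The table `A` assigns every held item to its holder and every other item to a receiver. -/
def Completes : Prop :=
  ∀ a b : Fin n, G.Adj a b → A a b = A b a ∧ A a b < n ∧ ((b : ℕ) ∈ X a → A a b = a) ∧
    ((b : ℕ) ∉ X a → (a : ℕ) ∉ X b → (localInstance hG).Receiver X (A a b) a b)

variable (G A) in
/-- The bundles that are described by a table. -/
def tableBundles (i : Fin n) : Set G.edgeSet :=
  {e | ∃ j k : Fin n, (e : Sym2 (Fin n)) = s(j, k) ∧ A j k = (i : ℕ)}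

theorem mem_tableBundles (hA : ∀ a b : Fin n, G.Adj a b → A a b = A b a) {a b i : Fin n}
    (h : G.Adj a b) : (⟨s(a, b), h⟩ : G.edgeSet) ∈ tableBundles G A i ↔ A a b = i := by
  constructor
  · rintro ⟨j, k, he, hi⟩
    simp only [Sym2.eq_iff] at he
    rcases he with ⟨rfl, rfl⟩ | ⟨rfl, rfl⟩
    · exact hi
    · rw [hA _ _ h, hi]
  · exact fun h => ⟨a, b, rfl, h⟩

theorem isAllocation_tableBundles (hA : ∀ a b : Fin n, G.Adj a b → A a b = A b a ∧ A a b < n) :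
    IsAllocation (tableBundles G A) where
  disjoint i j hij := by
    rw [Set.disjoint_left]
    rintro ⟨e, he⟩ hi hj
    induction e using Sym2.ind with
    | _ a b =>
      rw [mem_tableBundles (fun a b h => (hA a b h).1) he] at hi hj
      exact hij (Fin.ext (hi.symm.trans hj))
  cover := by
    refine Set.eq_univ_of_forall ?_
    rintro ⟨e, he⟩
    induction e using Sym2.ind with
    | _ a b =>
      exact Set.mem_iUnion.2 ⟨⟨A a b, (hA a b he).2⟩,
        (mem_tableBundles (fun a b h => (hA a b h).1) he).2 rfl⟩

/-- Dropping the items that are no goods for `i` does not decrease the value. -/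
theorem val_tableBundles_le (hA : Completes hG X A) (i j : Fin n) :
    v i (tableBundles G A j) ≤
      (localInstance hG).val i {k | k ∈ (localInstance hG).good i ∧ A i k = j} := by
  change _ ≤ localVal G v i _
  rw [localVal_val]
  refine le_of_subset_of_chore_or_dummy ?_ ?_
  · rintro ⟨e, he'⟩ ⟨a, k, he, hi, hk⟩
    obtain rfl := Fin.ext hi
    obtain rfl : e = s(a, k) := he
    exact (mem_tableBundles (fun a b h => (hA a b h).1) he').2 hk.2
  · rintro e he hne
    have hk := hG.kind i e
    rcases lt_trichotomy (v i ∅) (v i {e}) with h | h | h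
    · exfalso
      apply hne
      by_cases hie : i ∈ (e : Sym2 (Fin n))
      · obtain ⟨e, he'⟩ := e
        obtain ⟨k, rfl⟩ := hie
        have hadj : G.Adj i k := he'
        exact ⟨i, k, rfl, rfl, (good_iff hadj).2 h,
          (mem_tableBundles (fun a b h => (hA a b h).1) hadj).1 he⟩
      · have := hG.not_incident i e hie ∅ (Set.notMem_empty e)
        rw [insert_empty_eq] at this
        exact absurd h this.le.not_gt
    · exact Or.inr (hk.2.2 h.symm)
    · exact Or.inl (hk.2.1 h)

/-- No agent receives an item that is a chore for her. -/
theorem not_chore_of_mem (hX : (localInstance hG).Completable X) (hA : Completes hG X A) {i : Fin n}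
    {e : G.edgeSet} (he : e ∈ tableBundles G A i) : v i ∅ ≤ v i {e} := by
  by_contra! hlt
  by_cases hie : i ∈ (e : Sym2 (Fin n))
  · obtain ⟨e, he'⟩ := e
    obtain ⟨k, rfl⟩ := hie
    have hadj : G.Adj i k := he'
    have hc := (chore_iff (hG := hG) hadj).2 hlt
    rw [mem_tableBundles (fun a b h => (hA a b h).1) hadj] at he
    obtain ⟨-, -, h1, h2⟩ := hA i k hadj
    have hik : (k : ℕ) ∉ X i := fun h => (localInstance hG).not_chore (hX.sub i h) hc
    have hki : (i : ℕ) ∉ X k := by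
      intro h
      have h3 := (hA k i hadj.symm).2.2.1 h
      rw [← (hA i k hadj).1, he] at h3
      exact hadj.ne (Fin.ext h3)
    have hr := h2 hik hki
    rw [he] at hr
    rcases hr with h | h | h | h | h
    · exact h.2.2 hc
    · exact hadj.ne (Fin.ext h.1)
    · exact h.1 rfl
    · exact hX.disj h.1.1 h.1.1
    · exact hki (by have := hX.single h.1; rw [this] at hik; exact absurd rfl hik)
  · have := hG.not_incident i e hie ∅ (Set.notMem_empty e)
    rw [insert_empty_eq] at this
    exact absurd hlt this.ge.not_gt

theorem le_val_tableBundles (hX : (localInstance hG).Completable X) (hA : Completes hG X A)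
    (i : Fin n) : (localInstance hG).val i (X i) ≤ v i (tableBundles G A i) := by
  change localVal G v i _ ≤ _
  rw [localVal_val]
  refine le_of_subset_of_good_or_dummy ?_ ?_
  · rintro ⟨e, he'⟩ ⟨a, k, he, hi, hk⟩
    obtain rfl := Fin.ext hi
    obtain rfl : e = s(a, k) := he
    exact (mem_tableBundles (fun a b h => (hA a b h).1) he').2 ((hA a k he').2.2.1 hk)
  · intro e he _
    have hk := hG.kind i e
    rcases (not_chore_of_mem hX hA he).lt_or_eq with h | h
    · exact Or.inl (hk.1 h)
    · exact Or.inr (hk.2.2 h.symm)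

theorem isEFXZeroMinus_tableBundles (hX : (localInstance hG).Completable X)
    (hA : Completes hG X A) : IsEFXZeroMinus v (tableBundles G A) := by
  intro i j hij
  set I := localInstance hG
  have hne : i ≠ j := by
    rintro rfl
    exact lt_irrefl _ hij
  have hlow := le_val_tableBundles hX hA i
  -- an agent only envies those that she wants to exchange bundles with
  have hw : I.Wants X i j := by
    by_contra hw
    refine absurd (hij.trans_le (val_tableBundles_le hA i j)) (not_lt.2 (le_trans ?_ hlow))
    have held : ∀ k : ℕ, k ∈ I.good i → A i k = j → (k ∈ I.unheld X i ∧ I.Receiver X j i k) ∨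
        k = j ∧ (i : ℕ) ∈ X j := by
      intro k hk hj
      obtain ⟨⟨_, hkn, hadj⟩, -⟩ := id hk
      lift k to Fin n using hkn
      change G.Adj i k at hadj
      by_cases h1 : (k : ℕ) ∈ X i
      · exact absurd (Fin.ext (((hA i k hadj).2.2.1 h1).symm.trans hj)) hne
      by_cases h2 : (i : ℕ) ∈ X k
      · have h3 := (hA k i hadj.symm).2.2.1 h2
        rw [← (hA i k hadj).1, hj] at h3
        rw [h3]
        exact Or.inr ⟨rfl, h2⟩
      · left
        refine ⟨⟨hk, h1, h2⟩, ?_⟩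
        have := (hA i k hadj).2.2.2 h1 h2
        rwa [hj] at this
    have le_of_sub : ∀ k, {k | k ∈ I.good i ∧ A i k = j} ⊆ {k} → (k ∈ I.good i) →
        I.val i {k} ≤ I.val i (X i) → I.val i {k | k ∈ I.good i ∧ A i k = j} ≤ I.val i (X i) :=
      fun k h hk h' => (I.mono h (Set.singleton_subset_iff.2 hk)).trans h'
    by_cases hall : ∀ k ∈ I.good i, A i k = j → k = j
    · by_cases hj : (j : ℕ) ∈ I.good i
      · exact le_of_sub j (fun k hk => hall k hk.1 hk.2) hj (hX.val_le hj hw)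
      · refine I.mono ?_ (hX.sub i)
        intro k hk
        exact absurd ((hall k hk.1 hk.2) ▸ hk.1) hj
    · push Not at hall
      obtain ⟨k, hk, hkA, hkj⟩ := hall
      obtain ⟨hku, hr⟩ := (held k hk hkA).resolve_right fun h => hkj h.1
      rcases hr with h | h | h | h | h
      · exact absurd (Fin.ext h.1.symm) hne
      · exact absurd h.1.symm hkj
      · refine le_trans (I.mono ?_ (LocalInstance.offer_sub _ _)) (h.2.2.2.1 hk)
        rintro m ⟨hm, hmA⟩
        rcases held m hm hmA with h' | h'
        · exact Or.inl h'.1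
        · exact Or.inr ⟨h'.1, h'.2, h'.1 ▸ hm⟩
      · exact absurd h.1 hw
      · -- `j` is envied by the other endpoint `k`; then `k` is the only such agent
        refine le_of_sub k ?_ hk (hX.le hku)
        rintro m ⟨hm, hmA⟩
        have hXj := hX.single h.1
        rcases held m hm hmA with h' | h'
        · obtain ⟨-, h' | h' | h' | h' | h'⟩ := h'
          · exact absurd h.1 (h'.2.1 k)
          · exact absurd h.1 (h'.2.1 k)
          · exact absurd h.1 (h'.2.2.1 k)
          · exact absurd h'.1 hw
          · exact hX.wants_unique h'.1 h.1
        · rw [hXj] at h'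
          exact absurd (h'.2 : (i : ℕ) = k) fun e =>
            LocalInstance.not_mem_good (I := I) (i : ℕ) (e ▸ hk)
  have hXj := hX.single hw
  have hadj : G.Adj i j := by
    obtain ⟨⟨_, _, h⟩, -⟩ := hw.2.1
    exact h
  -- apart from the item between `i` and `j`, agent `j` has only chores of `i`
  have hrest : ∀ e ∈ tableBundles G A j, e ≠ ⟨s(i, j), hadj⟩ → IsChore (v i) e := by
    rintro ⟨e, he'⟩ he hne'
    induction e using Sym2.ind with
    | _ a b =>
      have hab : G.Adj a b := he'
      rw [mem_tableBundles (fun a b h => (hA a b h).1) hab] at he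
      obtain ⟨h1, -, h2, h3⟩ := hA a b hab
      have ha : (b : ℕ) ∉ X a := by
        intro h
        have h4 := (h2 h).symm.trans he
        rw [h4, hXj] at h
        apply hne'
        obtain rfl := Fin.ext h4
        obtain rfl : b = i := Fin.ext h
        exact Subtype.ext Sym2.eq_swap
      have hb : (a : ℕ) ∉ X b := by
        intro h
        have h4 := ((hA b a hab.symm).2.2.1 h).symm.trans (h1.symm.trans he)
        rw [h4, hXj] at h
        apply hne'
        obtain rfl := Fin.ext h4
        obtain rfl : a = i := Fin.ext h
        rfl
      have hr := h3 ha hb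
      rw [he] at hr
      rcases hr with h | h | h | h | h
      · exact absurd hw (h.2.1 i)
      · exact absurd hw (h.2.1 i)
      · exact absurd hw (h.2.2.1 i)
      · obtain rfl := Fin.ext (hX.wants_unique hw h.1)
        exact (hG.kind i _).2.1 ((chore_iff (hG := hG) hab).1 h.2)
      · obtain rfl := Fin.ext (hX.wants_unique hw h.1)
        refine (hG.kind i _).2.1 ?_
        have := (chore_iff (hG := hG) hab.symm).1 h.2
        rwa [show (⟨s(i, a), hab.symm⟩ : G.edgeSet) = ⟨s(a, i), hab⟩ from
          Subtype.ext Sym2.eq_swap] at this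
  refine ⟨?_, ?_⟩
  · intro e he hle
    by_cases hee : e = ⟨s(i, j), hadj⟩
    · calc v i (tableBundles G A j \ {e}) ≤ v i ∅ := by
            refine le_of_subset_of_chore_or_dummy (Set.empty_subset _) fun f hf _ => Or.inl ?_
            exact hrest f hf.1 fun h => hf.2 (h.trans hee.symm)
        _ ≤ v i (tableBundles G A i) := by
            refine le_of_subset_of_good_or_dummy (Set.empty_subset _) fun f hf _ => ?_
            rcases (not_chore_of_mem hX hA hf).lt_or_eq with h | h
            · exact Or.inl ((hG.kind i f).1 h)
            · exact Or.inr ((hG.kind i f).2.2 h.symm)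
    · have := hrest e he hee (tableBundles G A j \ {e}) fun h => h.2 rfl
      rw [Set.insert_sdiff_singleton, Set.insert_eq_of_mem he] at this
      exact absurd this hle.not_gt
  · intro e he hlt
    exfalso
    refine absurd hlt (not_lt.2 ?_)
    refine le_of_subset_of_good_or_dummy Set.sdiff_subset fun f hf hf' => ?_
    rcases (not_chore_of_mem hX hA hf).lt_or_eq with h | h
    · exact Or.inl ((hG.kind i f).1 h)
    · exact Or.inr ((hG.kind i f).2.2 h.symm)

end Final

/-- With at most two agents there is at most one item, and every allocation is fair. -/
theorem isEFXZeroMinus_of_le_two (hn : n ≤ 2)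
    {X : Fin n → Set G.edgeSet} (hX : IsAllocation X) : IsEFXZeroMinus v X := by
  have hsub : ∀ e f : G.edgeSet, e = f := by
    have main : ∀ a b c d : Fin n, a ≠ b → c ≠ d → s(a, b) = s(c, d) := by
      intro a b c d hab hcd
      rw [Sym2.eq_iff, Fin.ext_iff, Fin.ext_iff, Fin.ext_iff, Fin.ext_iff]
      have := Fin.val_ne_of_ne hab
      have := Fin.val_ne_of_ne hcd
      omega
    rintro ⟨e, he⟩ ⟨f, hf⟩
    induction e using Sym2.ind with
    | _ a b =>
      induction f using Sym2.ind with
      | _ c d => exact Subtype.ext (main a b c d (G.ne_of_adj he) (G.ne_of_adj hf))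
  have hempty : ∀ (e : G.edgeSet) (S : Set G.edgeSet), S \ {e} = ∅ := by
    intro e S
    ext f
    simp [hsub f e]
  intro i j hij
  have hne : i ≠ j := by
    rintro rfl
    exact lt_irrefl _ hij
  refine ⟨fun e he _ => ?_, fun e he hlt => ?_⟩
  · have : X i = ∅ := by
      refine Set.eq_empty_iff_forall_notMem.2 fun f hf => ?_
      rw [hsub f e] at hf
      exact Set.disjoint_left.1 (hX.disjoint i j hne) hf he
    rw [hempty, this]
  · have : X j = ∅ := by
      refine Set.eq_empty_iff_forall_notMem.2 fun f hf => ?_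
      rw [hsub f e] at hf
      exact Set.disjoint_left.1 (hX.disjoint i j hne) he hf
    rw [hempty, this]

end GraphEFX

/-! ### A language of bounded loops -/

namespace GraphEFX

/-- Programs without `while` and without assignments, in which `loop x c` runs `c` with the variable
`x` going from `0` to `n - 1`, where `n` is the number of agents that variable `0` holds. -/
inductive Cmd : Type
  | skip
  | store (a : ℕ) (i j e : Expr)
  | query (r : ℕ) (i : Expr) (a : ℕ)
  | seq (c d : Cmd)
  | ite (b : Test) (c d : Cmd)
  | loop (x : ℕ) (c : Cmd)

namespace Cmd

/-- Translation into the language of the machine. -/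
def prog : Cmd → Prog
  | skip => .skip
  | store a i j e => .store a i j e
  | query r i a => .query r i a
  | seq c d => .seq c.prog d.prog
  | ite b c d => .ite b c.prog d.prog
  | loop x c => .seq (.assign x (.const 0)) (.while (.le (.add (.var x) (.const 1)) (.var 0))
      (.seq c.prog (.assign x (.add (.var x) (.const 1)))))

/-- The loop variables. -/
def vars : Cmd → List ℕ
  | seq c d => c.vars ++ d.vars
  | ite _ c d => c.vars ++ d.vars
  | loop x c => x :: c.vars
  | _ => []

/-- The arrays that are written to. -/
def arrs : Cmd → List ℕ
  | store a _ _ _ => [a]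
  | seq c d => c.arrs ++ d.arrs
  | ite _ c d => c.arrs ++ d.arrs
  | loop _ c => c.arrs
  | _ => []

/-- The real registers that are written to. -/
def regs : Cmd → List ℕ
  | query r _ _ => [r]
  | seq c d => c.regs ++ d.regs
  | ite _ c d => c.regs ++ d.regs
  | loop _ c => c.regs
  | _ => []

/-- Variable `0` is no loop variable, and nested loops have different variables. -/
def ok : Cmd → Bool
  | seq c d => c.ok && d.ok
  | ite _ c d => c.ok && d.ok
  | loop x c => c.ok && !(0 :: c.vars).contains x
  | _ => true

/-- An upper bound for the number of steps, as a polynomial in the number of agents. -/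
noncomputable def cost : Cmd → Polynomial ℕ
  | skip => .C 1
  | store _ i j e => .C (i.cost + j.cost + e.cost + 1)
  | query _ i _ => .C (i.cost + 1)
  | seq c d => c.cost + d.cost
  | ite b c d => .C b.cost + c.cost + d.cost
  | loop _ c => .X * (c.cost + .C 9) + .C 7

variable (O : ℕ → (ℕ → ℕ → ℕ) → ℝ)

open Classical in
/-- The memory after the execution. -/
noncomputable def den : Cmd → Mem → Mem
  | skip, s => s
  | store a i j e, s => s.setArr a (i.eval s) (j.eval s) (e.eval s)
  | query r i a, s => s.setVal r (O (i.eval s) (s.arr a))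
  | seq c d, s => d.den (c.den s)
  | ite b c d, s => if b.Holds s then c.den s else d.den s
  | loop x c, s => Nat.rec (s.setVar x 0) (fun i s' => (c.den s').setVar x (i + 1)) (s.var 0)

variable {O}

theorem den_skip (s : Mem) : skip.den O s = s := by rw [den]

theorem den_seq (c d : Cmd) (s : Mem) : (seq c d).den O s = d.den O (c.den O s) := by rw [den]

theorem den_ite_true {b : Test} {c d : Cmd} {s : Mem} (h : b.Holds s) :
    (ite b c d).den O s = c.den O s := by
  simp [den, h]

theorem den_ite_false {b : Test} {c d : Cmd} {s : Mem} (h : ¬ b.Holds s) :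
    (ite b c d).den O s = d.den O s := by
  simp [den, h]

/-- A command changes only its loop variables. -/
theorem den_var {c : Cmd} {y : ℕ} (hy : y ∉ c.vars) (s : Mem) : (c.den O s).var y = s.var y := by
  induction c generalizing s with
  | skip | store | query => rfl
  | seq c d hc hd =>
    simp only [vars, List.mem_append, not_or] at hy
    rw [den_seq, hd hy.2, hc hy.1]
  | ite b c d hc hd =>
    simp only [vars, List.mem_append, not_or] at hy
    by_cases h : b.Holds s
    · rw [den_ite_true h, hc hy.1]
    · rw [den_ite_false h, hd hy.2]
  | loop x c hc =>
    simp only [vars, List.mem_cons, not_or] at hy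
    simp only [den]
    generalize s.var 0 = m
    induction m with
    | zero => simp [Mem.setVar, hy.1]
    | succ m ih => simpa [Mem.setVar, hy.1, hc hy.2] using ih

/-- A command changes only the arrays that it writes to. -/
theorem den_arr {c : Cmd} {a : ℕ} (ha : a ∉ c.arrs) (s : Mem) : (c.den O s).arr a = s.arr a := by
  induction c generalizing s with
  | skip | query => rfl
  | store b i j e =>
    simp only [arrs, List.mem_singleton] at ha
    funext k l
    simp [den, Mem.setArr, ha]
  | seq c d hc hd =>
    simp only [arrs, List.mem_append, not_or] at ha
    rw [den_seq, hd ha.2, hc ha.1]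
  | ite b c d hc hd =>
    simp only [arrs, List.mem_append, not_or] at ha
    by_cases h : b.Holds s
    · rw [den_ite_true h, hc ha.1]
    · rw [den_ite_false h, hd ha.2]
  | loop x c hc =>
    simp only [arrs] at ha
    simp only [den]
    generalize s.var 0 = m
    induction m with
    | zero => rfl
    | succ m ih => exact (hc ha _).trans ih

/-- A command changes only the registers that it writes to. -/
theorem den_val {c : Cmd} {r : ℕ} (hr : r ∉ c.regs) (s : Mem) : (c.den O s).val r = s.val r := by
  induction c generalizing s with
  | skip | store => rfl
  | query q i a =>
    simp only [regs, List.mem_singleton] at hr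
    simp [den, Mem.setVal, hr]
  | seq c d hc hd =>
    simp only [regs, List.mem_append, not_or] at hr
    rw [den_seq, hd hr.2, hc hr.1]
  | ite b c d hc hd =>
    simp only [regs, List.mem_append, not_or] at hr
    by_cases h : b.Holds s
    · rw [den_ite_true h, hc hr.1]
    · rw [den_ite_false h, hd hr.2]
  | loop x c hc =>
    simp only [regs] at hr
    simp only [den]
    generalize s.var 0 = m
    induction m with
    | zero => rfl
    | succ m ih => exact (hc hr _).trans ih

theorem zero_not_mem_vars {c : Cmd} (hc : c.ok = true) : 0 ∉ c.vars := by
  induction c with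
  | skip | store | query => simp [vars]
  | seq c d h1 h2 =>
    simp only [ok, Bool.and_eq_true] at hc
    simp [vars, h1 hc.1, h2 hc.2]
  | ite b c d h1 h2 =>
    simp only [ok, Bool.and_eq_true] at hc
    simp [vars, h1 hc.1, h2 hc.2]
  | loop x c h =>
    simp only [ok, Bool.and_eq_true, Bool.not_eq_true', List.contains_eq_mem,
      decide_eq_false_iff_not, List.mem_cons, not_or] at hc
    simp only [vars, List.mem_cons, not_or]
    exact ⟨fun e => hc.2.1 e.symm, h hc.1⟩

theorem ok_loop {x : ℕ} {c : Cmd} (h : (loop x c).ok = true) : c.ok = true ∧ x ≠ 0 ∧ x ∉ c.vars := by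
  simp only [ok, Bool.and_eq_true, Bool.not_eq_true', List.contains_eq_mem,
    decide_eq_false_iff_not, List.mem_cons, not_or] at h
  exact h

/-- The machine computes `den` within the cost bound. -/
theorem exec_prog {c : Cmd} (hc : c.ok = true) (s : Mem) :
    ∃ t ≤ c.cost.eval (s.var 0), Exec O c.prog s (c.den O s) t := by
  induction c generalizing s with
  | skip => exact ⟨1, by simp [cost], Exec.skip s⟩
  | store a i j e => exact ⟨_, by simp [cost], Exec.store s a i j e⟩
  | query r i a => exact ⟨_, by simp [cost], Exec.query s r i a⟩
  | seq c d h1 h2 =>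
    simp only [ok, Bool.and_eq_true] at hc
    obtain ⟨t, ht, h⟩ := h1 hc.1 s
    obtain ⟨t', ht', h'⟩ := h2 hc.2 (c.den O s)
    rw [den_var (zero_not_mem_vars hc.1)] at ht'
    exact ⟨t + t', by simp only [cost, Polynomial.eval_add]; omega, h.seq h'⟩
  | ite b c d h1 h2 =>
    simp only [ok, Bool.and_eq_true] at hc
    by_cases hb : b.Holds s
    · obtain ⟨t, ht, h⟩ := h1 hc.1 s
      exact ⟨b.cost + t, by simp only [cost, Polynomial.eval_add, Polynomial.eval_C]; omega,
        by rw [den_ite_true hb]; exact Exec.ite_true hb h⟩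
    · obtain ⟨t, ht, h⟩ := h2 hc.2 s
      exact ⟨b.cost + t, by simp only [cost, Polynomial.eval_add, Polynomial.eval_C]; omega,
        by rw [den_ite_false hb]; exact Exec.ite_false hb h⟩
  | loop x c ih =>
    obtain ⟨hok, hx0, hxc⟩ := ok_loop hc
    have h0c := zero_not_mem_vars hok
    set N := s.var 0 with hN
    set f : ℕ → Mem := fun m =>
      Nat.rec (s.setVar x 0) (fun i s' => (c.den O s').setVar x (i + 1)) m with hf
    have hfs : ∀ m, f (m + 1) = (c.den O (f m)).setVar x (m + 1) := fun m => rfl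
    have hf0 : ∀ m, (f m).var 0 = N := by
      intro m
      induction m with
      | zero => simp [hf, Mem.setVar, hx0.symm, hN]
      | succ m ih => rw [hfs]; simp [Mem.setVar, hx0.symm, den_var h0c, ih]
    have hfx : ∀ m, (f m).var x = m := by
      intro m
      cases m with
      | zero => simp [hf, Mem.setVar]
      | succ m => rw [hfs]; simp [Mem.setVar]
    -- the remaining iterations, from the last one backwards
    have key : ∀ d m, m + d = N → ∃ t ≤ d * (c.cost.eval N + 9) + 5,
        Exec O (.while (.le (.add (.var x) (.const 1)) (.var 0))
          (.seq c.prog (.assign x (.add (.var x) (.const 1))))) (f m) (f N) t := by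
      intro d
      induction d with
      | zero =>
        intro m hm
        obtain rfl : m = N := by omega
        refine ⟨5, by omega, Exec.while_false ?_⟩
        simp [Test.Holds, Expr.eval, hfx, hf0]
      | succ d ihd =>
        intro m hm
        obtain ⟨t', ht', h'⟩ := ihd (m + 1) (by omega)
        obtain ⟨t, ht, h⟩ := ih hok (f m)
        rw [hf0] at ht
        have hb : (Test.le (.add (.var x) (.const 1)) (.var 0)).Holds (f m) := by
          simp only [Test.Holds, Expr.eval, hfx, hf0]; omega
        have ha : Exec O (.assign x (.add (.var x) (.const 1))) (c.den O (f m)) (f (m + 1)) 4 := by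
          have := Exec.assign (O := O) (c.den O (f m)) x (.add (.var x) (.const 1))
          simp only [Expr.eval, den_var hxc, hfx] at this
          exact this
        refine ⟨5 + (t + 4) + t', ?_, Exec.while_true hb (h.seq ha) h'⟩
        rw [Nat.succ_mul]
        omega
    obtain ⟨t, ht, h⟩ := key N 0 (by omega)
    refine ⟨2 + t, ?_, Exec.seq (Exec.assign s x (.const 0)) h⟩
    simp only [cost, Polynomial.eval_add, Polynomial.eval_mul, Polynomial.eval_X,
      Polynomial.eval_C]
    omega

/-- The invariant rule for loops. An invariant speaks about the arrays only; the body may assume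
that everything the loop does not change is as it was before the loop. -/
theorem den_loop (P : ℕ → (ℕ → ℕ → ℕ → ℕ) → Prop) {x : ℕ} {c : Cmd} {s : Mem}
    (hok : (loop x c).ok = true) (h0 : P 0 s.arr)
    (hs : ∀ i < s.var 0, ∀ s' : Mem, s'.var x = i →
      (∀ y, y ∉ (loop x c).vars → s'.var y = s.var y) →
      (∀ a, a ∉ c.arrs → s'.arr a = s.arr a) → P i s'.arr → P (i + 1) (c.den O s').arr) :
    P (s.var 0) ((loop x c).den O s).arr := by
  obtain ⟨hokc, hx0, hxc⟩ := ok_loop hok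
  set f : ℕ → Mem := fun m =>
    Nat.rec (s.setVar x 0) (fun i s' => (c.den O s').setVar x (i + 1)) m with hf
  have hfs : ∀ m, f (m + 1) = (c.den O (f m)).setVar x (m + 1) := fun m => rfl
  have hfx : ∀ m, (f m).var x = m := by
    intro m
    cases m with
    | zero => simp [hf, Mem.setVar]
    | succ m => rw [hfs]; simp [Mem.setVar]
  have hfv : ∀ m y, y ∉ (loop x c).vars → (f m).var y = s.var y := by
    intro m y hy
    simp only [vars, List.mem_cons, not_or] at hy
    induction m with
    | zero => simp [hf, Mem.setVar, hy.1]
    | succ m ih => rw [hfs]; simp [Mem.setVar, hy.1, den_var hy.2, ih]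
  have hfa : ∀ m a, a ∉ c.arrs → (f m).arr a = s.arr a := by
    intro m a ha
    induction m with
    | zero => rfl
    | succ m ih => rw [hfs]; exact (den_arr ha _).trans ih
  have key : ∀ m ≤ s.var 0, P m (f m).arr := by
    intro m
    induction m with
    | zero => exact fun _ => h0
    | succ m ih =>
      intro hm
      exact hs m hm (f m) (hfx m) (hfv m) (hfa m) (ih (by omega))
  exact key _ le_rfl

/-- The rule for a loop that fills a table row by row. -/
theorem den_rows (a : ℕ) (Q : ℕ → (ℕ → ℕ) → Prop) {x : ℕ} {c : Cmd} {s : Mem}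
    (hok : (loop x c).ok = true)
    (hs : ∀ i < s.var 0, ∀ s' : Mem, s'.var x = i →
      (∀ y, y ∉ (loop x c).vars → s'.var y = s.var y) →
      (∀ b, b ∉ c.arrs → s'.arr b = s.arr b) →
      Q i ((c.den O s').arr a i) ∧ ∀ j, j ≠ i → (c.den O s').arr a j = s'.arr a j) :
    ∀ i < s.var 0, Q i (((loop x c).den O s).arr a i) := by
  refine den_loop (fun m M => ∀ i < m, Q i (M a i)) hok (fun i hi => absurd hi (Nat.not_lt_zero i)) ?_
  intro m hm s' hx hv ha ih i hi
  obtain ⟨h1, h2⟩ := hs m hm s' hx hv ha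
  rcases Nat.lt_succ_iff_lt_or_eq.1 hi with hi | rfl
  · rw [h2 i hi.ne]
    exact ih i hi
  · exact h1

/-- The rule for a loop that fills a row of a table cell by cell. -/
theorem den_cells (a r : ℕ) (Q : ℕ → ℕ → Prop) {x : ℕ} {c : Cmd} {s : Mem}
    (hok : (loop x c).ok = true)
    (hs : ∀ k < s.var 0, ∀ s' : Mem, s'.var x = k →
      (∀ y, y ∉ (loop x c).vars → s'.var y = s.var y) →
      (∀ b, b ∉ c.arrs → s'.arr b = s.arr b) →
      Q k ((c.den O s').arr a r k) ∧
        ∀ j l, j ≠ r ∨ l ≠ k → (c.den O s').arr a j l = s'.arr a j l) :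
    (∀ k < s.var 0, Q k (((loop x c).den O s).arr a r k)) ∧
      ∀ j l, j ≠ r ∨ s.var 0 ≤ l → ((loop x c).den O s).arr a j l = s.arr a j l := by
  refine den_loop (fun m M => (∀ k < m, Q k (M a r k)) ∧
    ∀ j l, j ≠ r ∨ m ≤ l → M a j l = s.arr a j l) hok
    ⟨fun i hi => absurd hi (Nat.not_lt_zero i), fun _ _ _ => rfl⟩ ?_
  intro m hm s' hx hv ha ih
  obtain ⟨h1, h2⟩ := hs m hm s' hx hv ha
  refine ⟨fun k hk => ?_, fun j l h => ?_⟩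
  · rcases Nat.lt_succ_iff_lt_or_eq.1 hk with hk | rfl
    · rw [h2 r k (Or.inr hk.ne)]
      exact ih.1 k hk
    · exact h1
  · rw [h2 j l (h.imp_right (by omega)), ih.2 j l (h.imp_right (by omega))]

end Cmd
end GraphEFX

/-! ### Rows of tables and value comparisons -/

namespace GraphEFX

/-- The variables of an expression. -/
def Expr.vars : Expr → List ℕ
  | .const _ => []
  | .var x => [x]
  | .get _ i j => i.vars ++ j.vars
  | .add e f => e.vars ++ f.vars
  | .sub e f => e.vars ++ f.vars

/-- The arrays that an expression reads. -/
def Expr.arrs : Expr → List ℕ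
  | .const _ => []
  | .var _ => []
  | .get a i j => a :: (i.arrs ++ j.arrs)
  | .add e f => e.arrs ++ f.arrs
  | .sub e f => e.arrs ++ f.arrs

/-- The arrays that a test reads. -/
def Test.arrs : Test → List ℕ
  | .le e f => e.arrs ++ f.arrs
  | .valLe _ _ => []
  | .not b => b.arrs
  | .and b c => b.arrs ++ c.arrs

/-- The variables of a test. -/
def Test.vars : Test → List ℕ
  | .le e f => e.vars ++ f.vars
  | .valLe _ _ => []
  | .not b => b.vars
  | .and b c => b.vars ++ c.vars

/-- The test does not involve real registers. -/
def Test.isNat : Test → Bool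
  | .le _ _ => true
  | .valLe _ _ => false
  | .not b => b.isNat
  | .and b c => b.isNat && c.isNat

theorem Expr.eval_congr {e : Expr} {s s' : Mem} (hv : ∀ x ∈ e.vars, s.var x = s'.var x)
    (ha : ∀ a ∈ e.arrs, s.arr a = s'.arr a) : e.eval s = e.eval s' := by
  induction e with
  | const c => rfl
  | var x => exact hv x (by simp [vars])
  | get a i j hi hj =>
    simp only [eval]
    rw [hi (fun x h => hv x (by simp [vars, h])) (fun x h => ha x (by simp [arrs, h])),
      hj (fun x h => hv x (by simp [vars, h])) (fun x h => ha x (by simp [arrs, h])),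
      ha a (by simp [arrs])]
  | add e f hi hj | sub e f hi hj =>
    simp only [eval]
    rw [hi (fun x h => hv x (by simp [vars, h])) (fun x h => ha x (by simp [arrs, h])),
      hj (fun x h => hv x (by simp [vars, h])) (fun x h => ha x (by simp [arrs, h]))]

theorem Test.holds_congr {b : Test} {s s' : Mem} (hb : b.isNat = true)
    (hv : ∀ x ∈ b.vars, s.var x = s'.var x) (ha : ∀ a ∈ b.arrs, s.arr a = s'.arr a) :
    b.Holds s ↔ b.Holds s' := by
  induction b with
  | le e f =>
    simp only [Holds]
    rw [Expr.eval_congr (e := e) (fun x h => hv x (by simp [vars, h]))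
        (fun x h => ha x (by simp [arrs, h])),
      Expr.eval_congr (e := f) (fun x h => hv x (by simp [vars, h]))
        (fun x h => ha x (by simp [arrs, h]))]
  | valLe r r' => simp [isNat] at hb
  | not b ih => exact not_congr (ih hb hv ha)
  | and b c ih ih' =>
    simp only [isNat, Bool.and_eq_true] at hb
    exact and_congr
      (ih hb.1 (fun x h => hv x (by simp [vars, h])) fun x h => ha x (by simp [arrs, h]))
      (ih' hb.2 (fun x h => hv x (by simp [vars, h])) fun x h => ha x (by simp [arrs, h]))

/-- The array entry is not `0`. -/
def Test.nz (a : ℕ) (i j : Expr) : Test := .le (.const 1) (.get a i j)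

/-- Equality of two numbers. -/
def Test.eq (e f : Expr) : Test := .and (.le e f) (.le f e)

/-- Disjunction. -/
def Test.or (b c : Test) : Test := .not (.and (.not b) (.not c))

@[simp]
theorem Test.holds_nz {a : ℕ} {i j : Expr} {s : Mem} :
    (Test.nz a i j).Holds s ↔ s.arr a (i.eval s) (j.eval s) ≠ 0 := by
  simp only [nz, Holds, Expr.eval]
  omega

@[simp]
theorem Test.holds_eq {e f : Expr} {s : Mem} :
    (Test.eq e f).Holds s ↔ e.eval s = f.eval s := by
  simp only [eq, Holds]
  omega

@[simp]
theorem Test.holds_or {b c : Test} {s : Mem} :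
    (Test.or b c).Holds s ↔ b.Holds s ∨ c.Holds s := by
  simp only [or, Holds]
  tauto

@[simp]
theorem Test.holds_and {b c : Test} {s : Mem} :
    (Test.and b c).Holds s ↔ b.Holds s ∧ c.Holds s := Iff.rfl

@[simp]
theorem Test.holds_not {b : Test} {s : Mem} : (Test.not b).Holds s ↔ ¬ b.Holds s := Iff.rfl

@[simp]
theorem Expr.eval_var {x : ℕ} {s : Mem} : (Expr.var x).eval s = s.var x := rfl

@[simp]
theorem Expr.eval_const {c : ℕ} {s : Mem} : (Expr.const c).eval s = c := rfl

@[simp]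
theorem Expr.eval_get {a : ℕ} {i j : Expr} {s : Mem} :
    (Expr.get a i j).eval s = s.arr a (i.eval s) (j.eval s) := rfl

@[simp]
theorem Expr.eval_add {e f : Expr} {s : Mem} : (Expr.add e f).eval s = e.eval s + f.eval s := rfl

@[simp]
theorem Test.holds_le {e f : Expr} {s : Mem} :
    (Test.le e f).Holds s ↔ e.eval s ≤ f.eval s := Iff.rfl

@[simp]
theorem Mem.setVar_var (s : Mem) (x m y : ℕ) :
    (s.setVar x m).var y = if y = x then m else s.var y := rfl

@[simp]
theorem Mem.setVar_arr (s : Mem) (x m : ℕ) : (s.setVar x m).arr = s.arr := rfl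

/-- The sets of numbers less than `n` that the rows of a table mark. -/
def rows (n : ℕ) (B : ℕ → ℕ → ℕ) (i : ℕ) : Set ℕ := {k | k < n ∧ B i k ≠ 0}

namespace Cmd

/-- Row `r` of array `a` becomes the indicator function of the test `t`, which speaks about
variable `20`. -/
def setRow (a : ℕ) (r : Expr) (t : Test) : Cmd :=
  loop 20 (ite t (store a r (.var 20) (.const 1)) (store a r (.var 20) (.const 0)))

section

variable {O : ℕ → (ℕ → ℕ → ℕ) → ℝ} {s : Mem}

theorem den_setRow {a : ℕ} {r : Expr} {t : Test} (ht : t.isNat = true) (hta : a ∉ t.arrs)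
    (hra : a ∉ r.arrs) (hrv : 20 ∉ r.vars) :
    (∀ k < s.var 0, ((setRow a r t).den O s).arr a (r.eval s) k ≠ 0 ↔ t.Holds (s.setVar 20 k)) ∧
      ∀ j l, j ≠ r.eval s ∨ s.var 0 ≤ l → ((setRow a r t).den O s).arr a j l = s.arr a j l := by
  refine den_cells a (r.eval s) (fun k m => m ≠ 0 ↔ t.Holds (s.setVar 20 k)) rfl ?_
  intro k _ s' hx hv ha
  have hr : r.eval s' = r.eval s := by
    refine Expr.eval_congr (fun y hy => hv y ?_) fun b hb => ha b ?_
    · simp only [vars, List.append_nil, List.mem_singleton]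
      rintro rfl
      exact hrv hy
    · simp only [arrs, List.mem_append, List.mem_singleton, or_self]
      rintro rfl
      exact hra hb
  have ht' : t.Holds s' ↔ t.Holds (s.setVar 20 k) := by
    refine Test.holds_congr ht ?_ fun b hb => ha b ?_
    · intro y _
      by_cases hy : y = 20
      · subst hy; simp [hx]
      · simp only [Mem.setVar_var, hy, if_false]
        exact hv y (by simpa [vars] using hy)
    · simp only [arrs, List.mem_append, List.mem_singleton, or_self]
      rintro rfl
      exact hta hb
  by_cases h : t.Holds s'
  · rw [den_ite_true h]
    refine ⟨by simp [den, Mem.setArr, hr, hx, ← ht', h], fun j l hjl => ?_⟩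
    simp only [den, Mem.setArr, hr, Expr.eval_var, hx, true_and]
    rw [if_neg (by omega)]
  · rw [den_ite_false h]
    refine ⟨by simp [den, Mem.setArr, hr, hx, ← ht', h], fun j l hjl => ?_⟩
    simp only [den, Mem.setArr, hr, Expr.eval_var, hx, true_and]
    rw [if_neg (by omega)]

theorem rows_setRow {a : ℕ} {r : Expr} {t : Test} (ht : t.isNat = true) (hta : a ∉ t.arrs)
    (hra : a ∉ r.arrs) (hrv : 20 ∉ r.vars) :
    rows (s.var 0) (((setRow a r t).den O s).arr a) =
      Function.update (rows (s.var 0) (s.arr a)) (r.eval s)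
        {k | k < s.var 0 ∧ t.Holds (s.setVar 20 k)} := by
  obtain ⟨h1, h2⟩ := den_setRow (O := O) (s := s) ht hta hra hrv
  funext i
  by_cases hi : i = r.eval s
  · subst hi
    rw [Function.update_self]
    ext k
    exact and_congr_right fun hk => h1 k hk
  · rw [Function.update_of_ne hi]
    ext k
    simp only [rows, Set.mem_ofPred_eq]
    rw [h2 i k (Or.inl hi)]

/-- Array `2` marks, for the agent `i`, the items to the members of row `ra` of array `a`. -/
def fill (i a : ℕ) (ra : Expr) : Cmd :=
  loop 21 (setRow 2 (.var 21) (.and (.eq (.var 21) (.var i)) (.nz a ra (.var 20))))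

theorem den_fill {i a : ℕ} {ra : Expr} (hi : i < 20) (ha : a ≠ 2) (hr : ra.arrs = [])
    (hr20 : 20 ∉ ra.vars) (hr21 : 21 ∉ ra.vars) :
    ∀ j < s.var 0, ∀ k < s.var 0, ((fill i a ra).den O s).arr 2 j k ≠ 0 ↔
      j = s.var i ∧ s.arr a (ra.eval s) k ≠ 0 := by
  refine den_rows 2 (fun j f => ∀ k < s.var 0, f k ≠ 0 ↔ j = s.var i ∧ s.arr a (ra.eval s) k ≠ 0)
    rfl ?_
  intro j _ s' hx hv hs'
  have h0 : s'.var 0 = s.var 0 := hv 0 (by simp [vars, setRow])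
  obtain ⟨h1, h2⟩ := den_setRow (O := O) (s := s') (a := 2) (r := .var 21)
    (t := .and (.eq (.var 21) (.var i)) (.nz a ra (.var 20))) rfl
    (by simp [Test.arrs, Test.eq, Test.nz, Expr.arrs, hr, ha.symm]) (by simp [Expr.arrs])
    (by simp [Expr.vars])
  simp only [Expr.eval_var, hx] at h1 h2
  refine ⟨fun k hk => ?_, fun l hl => funext fun k => h2 l k (Or.inl hl)⟩
  rw [h1 k (h0 ▸ hk)]
  have he : ra.eval (s'.setVar 20 k) = ra.eval s := by
    refine Expr.eval_congr (fun y hy => ?_) (by simp [hr])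
    have hy20 : y ≠ 20 := fun e => hr20 (e ▸ hy)
    have hy21 : y ≠ 21 := fun e => hr21 (e ▸ hy)
    simp only [Mem.setVar_var, hy20, if_false]
    exact hv y (by simp [vars, setRow, hy20, hy21])
  have hiv : s'.var i = s.var i :=
    hv i (by simp [vars, setRow]; omega)
  have hi20 : i ≠ 20 := by omega
  have hsa : s'.arr a = s.arr a := hs' a (by simp [arrs, setRow, ha])
  simp [he, hiv, hi20, hx, hsa]

/-- Compares, for the agent `i`, the values of row `ra` of array `a` and row `rb` of array `b`; the
entry `[0, 0]` of array `3` becomes `1` if the first is at most the second, and `0` otherwise. -/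
def cmp (i a : ℕ) (ra : Expr) (b : ℕ) (rb : Expr) : Cmd :=
  seq (fill i a ra) (seq (query 0 (.var i) 2) (seq (fill i b rb) (seq (query 1 (.var i) 2)
    (ite (.valLe 0 1) (store 3 (.const 0) (.const 0) (.const 1))
      (store 3 (.const 0) (.const 0) (.const 0))))))

end

variable {G : SimpleGraph (Fin n)} {v : Fin n → Set G.edgeSet → ℝ}

theorem valueOracle_eq {i : ℕ} {B : ℕ → ℕ → ℕ} {S : Set ℕ}
    (h : ∀ j < n, ∀ k < n, B j k ≠ 0 ↔ j = i ∧ k ∈ S) :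
    valueOracle G v i B = localVal G v i S := by
  unfold valueOracle localVal
  split_ifs with hi
  · congr 1
    ext e
    simp only [markedEdges, itemsTo, Set.mem_ofPred_eq]
    refine exists_congr fun j => exists_congr fun k => and_congr_right fun _ => ?_
    exact h j j.2 k k.2
  · rfl

theorem den_cmp {s : Mem} {i a : ℕ} {ra : Expr} {b : ℕ} {rb : Expr} (h0 : s.var 0 = n) (hi : i < 20)
    (ha : a ≠ 2) (hra : ra.arrs = []) (hra20 : 20 ∉ ra.vars) (hra21 : 21 ∉ ra.vars)
    (hb : b ≠ 2) (hrb : rb.arrs = []) (hrb20 : 20 ∉ rb.vars) (hrb21 : 21 ∉ rb.vars) :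
    ((cmp i a ra b rb).den (valueOracle G v) s).arr 3 0 0 ≠ 0 ↔
      localVal G v (s.var i) (rows n (s.arr a) (ra.eval s)) ≤
        localVal G v (s.var i) (rows n (s.arr b) (rb.eval s)) := by
  set O := valueOracle G v
  have hvars : ∀ (c : ℕ) (rc : Expr) (s' : Mem) (y : ℕ), y ≠ 20 → y ≠ 21 →
      ((fill i c rc).den O s').var y = s'.var y := by
    intro c rc s' y hy hy'
    exact den_var (by simp [fill, setRow, vars, hy, hy']) s'
  have hval : ∀ (c : ℕ) (rc : Expr) (s' : Mem), c ≠ 2 → rc.arrs = [] → 20 ∉ rc.vars →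
      21 ∉ rc.vars → s'.var 0 = n → O (s'.var i) (((fill i c rc).den O s').arr 2) =
        localVal G v (s'.var i) (rows n (s'.arr c) (rc.eval s')) := by
    intro c rc s' hc hrc h20 h21 h0'
    refine valueOracle_eq fun j hj k hk => ?_
    rw [den_fill hi hc hrc h20 h21 j (h0' ▸ hj) k (h0' ▸ hk)]
    simp [rows, hk]
  simp only [cmp, den_seq]
  set s1 := (fill i a ra).den O s
  set s2 := (query 0 (.var i) 2).den O s1 with hs2
  set s3 := (fill i b rb).den O s2
  set s4 := (query 1 (.var i) 2).den O s3 with hs4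
  have v1 : ∀ y, y ≠ 20 → y ≠ 21 → s2.var y = s.var y := fun y h h' => hvars a ra s y h h'
  have e0 : s4.val 0 = localVal G v (s.var i) (rows n (s.arr a) (ra.eval s)) := by
    have h1 : s4.val 0 = s3.val 0 := by simp [hs4, den, Mem.setVal]
    have h2 : s3.val 0 = s2.val 0 := den_val (by simp [fill, setRow, regs]) _
    have h3 : s2.val 0 = O (s1.var i) (s1.arr 2) := by simp [hs2, den, Mem.setVal]
    rw [h1, h2, h3, hvars a ra s i (by omega) (by omega), hval a ra s ha hra hra20 hra21 h0]
  have e1 : s4.val 1 = localVal G v (s.var i) (rows n (s.arr b) (rb.eval s)) := by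
    have h3 : s4.val 1 = O (s3.var i) (s3.arr 2) := by simp [hs4, den, Mem.setVal]
    have h4 : s2.arr b = s.arr b := den_arr (c := fill i a ra) (by simp [fill, setRow, arrs, hb]) s
    have h5 : rb.eval s2 = rb.eval s :=
      Expr.eval_congr (fun y hy => v1 y (fun e => hrb20 (e ▸ hy)) fun e => hrb21 (e ▸ hy))
        (by simp [hrb])
    rw [h3, hvars b rb s2 i (by omega) (by omega), hval b rb s2 hb hrb hrb20 hrb21
      ((v1 0 (by omega) (by omega)).trans h0), v1 i (by omega) (by omega), h4, h5]
  rw [← e0, ← e1]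
  by_cases h : s4.val 0 ≤ s4.val 1
  · rw [den_ite_true (by exact h)]
    simp [den, Mem.setArr, h]
  · rw [den_ite_false (by exact h)]
    simp [den, Mem.setArr, h]

end Cmd
end GraphEFX

/-! ### Tables -/

namespace GraphEFX
namespace Cmd

section

variable {O : ℕ → (ℕ → ℕ → ℕ) → ℝ} {s : Mem}

/-- The rule for a double loop that fills a table. -/
theorem den_table (a : ℕ) (Q : ℕ → ℕ → ℕ → Prop) {x y : ℕ} {c : Cmd}
    (hok : (loop x (loop y c)).ok = true)
    (hs : ∀ i < s.var 0, ∀ k < s.var 0, ∀ s' : Mem, s'.var x = i → s'.var y = k →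
      (∀ z, z ∉ (loop x (loop y c)).vars → s'.var z = s.var z) →
      (∀ b, b ∉ c.arrs → s'.arr b = s.arr b) →
      Q i k ((c.den O s').arr a i k) ∧
        ∀ j l, j ≠ i ∨ l ≠ k → (c.den O s').arr a j l = s'.arr a j l) :
    ∀ i < s.var 0, ∀ k < s.var 0, Q i k (((loop x (loop y c)).den O s).arr a i k) := by
  have hok' := ok_loop hok
  have hxy : x ∉ (loop y c).vars := hok'.2.2
  have h0 : 0 ∉ (loop x (loop y c)).vars := zero_not_mem_vars hok
  refine den_rows a (fun i f => ∀ k < s.var 0, Q i k (f k)) hok ?_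
  intro i hi s' hx hv ha
  have h0' : s'.var 0 = s.var 0 := hv 0 h0
  have := den_cells (O := O) (s := s') a i (fun k m => Q i k m) hok'.1 ?_
  · rw [h0'] at this
    exact ⟨this.1, fun j hj => funext fun l => this.2 j l (Or.inl hj)⟩
  · intro k hk s'' hy hv' ha'
    refine hs i hi k (h0' ▸ hk) s'' ((hv' x hxy).trans hx) hy (fun z hz => ?_)
      fun b hb => (ha' b hb).trans (ha b hb)
    exact (hv' z fun h => hz (List.mem_cons_of_mem _ h)).trans (hv z hz)

/-- The table `a` of the pairs of values of the variables `10` and `20` that satisfy a test. -/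
def natTable (a : ℕ) (t : Test) : Cmd := loop 10 (setRow a (.var 10) t)

theorem den_natTable {a : ℕ} {t : Test} (ht : t.isNat = true) (hta : a ∉ t.arrs) :
    ∀ i < s.var 0, ∀ k < s.var 0, ((natTable a t).den O s).arr a i k ≠ 0 ↔
      t.Holds ((s.setVar 10 i).setVar 20 k) := by
  refine den_rows a (fun i f => ∀ k < s.var 0, f k ≠ 0 ↔ t.Holds ((s.setVar 10 i).setVar 20 k))
    rfl ?_
  intro i _ s' hx hv ha
  have h0 : s'.var 0 = s.var 0 := hv 0 (by simp [vars, setRow])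
  obtain ⟨h1, h2⟩ := den_setRow (O := O) (s := s') (r := .var 10) ht hta (by simp [Expr.arrs])
    (by simp [Expr.vars])
  simp only [Expr.eval_var, hx] at h1 h2
  refine ⟨fun k hk => ?_, fun l hl => funext fun k => h2 l k (Or.inl hl)⟩
  rw [h1 k (h0 ▸ hk)]
  refine Test.holds_congr ht ?_ fun b hb => ha b ?_
  · intro y _
    simp only [Mem.setVar_var]
    by_cases hy : y = 20
    · simp [hy]
    by_cases hy' : y = 10
    · simp [hy', hx]
    · simp only [hy, hy', if_false]
      exact hv y (by simp [vars, setRow, hy, hy'])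
  · simp only [setRow, arrs, List.mem_append, List.mem_singleton, or_self]
    rintro rfl
    exact hta hb

/-- The table `a` of the pairs of values of the variables `10` and `11` for which the agent in
variable `10` values the set that the test `t` defines, in terms of variable `20`, at most as much as
the set that `t'` defines. -/
def cmpTable (a : ℕ) (t t' : Test) : Cmd :=
  loop 10 (loop 11 (seq (setRow 10 (.const 0) t) (seq (setRow 10 (.const 1) t')
    (seq (cmp 10 10 (.const 0) 10 (.const 1))
      (store a (.var 10) (.var 11) (.get 3 (.const 0) (.const 0)))))))

theorem cmpTable_arrs {a b : ℕ} {t t' : Test} (h : b ∉ [2, 3, 10, a]) :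
    b ∉ (cmpTable a t t').arrs := by
  simp only [List.mem_cons, List.not_mem_nil, or_false, not_or] at h
  simp [cmpTable, arrs, setRow, cmp, fill, h]

theorem natTable_arrs {a b : ℕ} {t : Test} (h : b ≠ a) : b ∉ (natTable a t).arrs := by
  simp [natTable, arrs, setRow, h]

end

variable {G : SimpleGraph (Fin n)} {v : Fin n → Set G.edgeSet → ℝ} {s : Mem}

theorem den_cmpTable {a : ℕ} {t t' : Test} (h0 : s.var 0 = n) (ht : t.isNat = true)
    (ht' : t'.isNat = true) (hta : ∀ b ∈ [2, 3, 10, a], b ∉ t.arrs)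
    (hta' : ∀ b ∈ [2, 3, 10, a], b ∉ t'.arrs) (htv : 21 ∉ t.vars) (htv' : 21 ∉ t'.vars) (ha : a ∉ [2, 3, 10]) :
    ∀ i < n, ∀ k < n, ((cmpTable a t t').den (valueOracle G v) s).arr a i k ≠ 0 ↔
      localVal G v i {z | z < n ∧ t.Holds (((s.setVar 10 i).setVar 11 k).setVar 20 z)} ≤
        localVal G v i {z | z < n ∧ t'.Holds (((s.setVar 10 i).setVar 11 k).setVar 20 z)} := by
  set O := valueOracle G v with hO
  have hm := den_table (O := O) (s := s) a (fun i k m => m ≠ 0 ↔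
    localVal G v i {z | z < n ∧ t.Holds (((s.setVar 10 i).setVar 11 k).setVar 20 z)} ≤
      localVal G v i {z | z < n ∧ t'.Holds (((s.setVar 10 i).setVar 11 k).setVar 20 z)})
    (x := 10) (y := 11) (c := seq (setRow 10 (.const 0) t) (seq (setRow 10 (.const 1) t')
    (seq (cmp 10 10 (.const 0) 10 (.const 1))
      (store a (.var 10) (.var 11) (.get 3 (.const 0) (.const 0)))))) rfl ?_
  · rwa [h0] at hm
  intro i hi k hk s' hx hy hv hs
  simp only [List.mem_cons, List.not_mem_nil, or_false, not_or] at ha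
  simp only [den_seq]
  set s1 := (setRow 10 (.const 0) t).den O s' with hs1
  set s2 := (setRow 10 (.const 1) t').den O s1 with hs2
  set s3 := (cmp 10 10 (.const 0) 10 (.const 1)).den O s2 with hs3
  have hv1 : ∀ y, y ≠ 20 → s1.var y = s'.var y := fun y h =>
    den_var (by simp [setRow, vars, h]) _
  have hv2 : ∀ y, y ≠ 20 → s2.var y = s'.var y := fun y h =>
    (den_var (by simp [setRow, vars, h]) _).trans (hv1 y h)
  have hv3 : ∀ y, y ≠ 20 → y ≠ 21 → s3.var y = s'.var y := fun y h h' =>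
    (den_var (by simp [setRow, vars, cmp, fill, h, h']) _).trans (hv2 y h)
  have h0' : s'.var 0 = n := (hv 0 (by simp [vars, setRow, cmp, fill])).trans h0
  have hs1a : ∀ b, b ≠ 10 → s1.arr b = s'.arr b := fun b h =>
    den_arr (by simp [setRow, arrs, h]) _
  have hs2a : ∀ b, b ≠ 10 → s2.arr b = s'.arr b := fun b h =>
    (den_arr (by simp [setRow, arrs, h]) _).trans (hs1a b h)
  have hs3a : ∀ b, b ≠ 2 → b ≠ 3 → b ≠ 10 → s3.arr b = s'.arr b := fun b h2 h3 h =>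
    (den_arr (by simp [setRow, cmp, fill, arrs, h2, h3]) _).trans (hs2a b h)
  have hcongr : ∀ {u : Test} {s'' : Mem} {z : ℕ}, u.isNat = true →
      (∀ b ∈ [2, 3, 10, a], b ∉ u.arrs) → 21 ∉ u.vars → (∀ y, y ≠ 20 → s''.var y = s'.var y) →
      (∀ b, b ≠ 10 → s''.arr b = s'.arr b) →
      (u.Holds (s''.setVar 20 z) ↔ u.Holds (((s.setVar 10 i).setVar 11 k).setVar 20 z)) := by
    intro u s'' z hu hua hu21 hv' ha'
    refine Test.holds_congr hu ?_ fun b hb => ?_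
    · intro w hw
      simp only [Mem.setVar_var]
      by_cases h20 : w = 20
      · simp [h20]
      by_cases h11 : w = 11
      · simp [h11, ← hy, hv' 11]
      by_cases h10 : w = 10
      · simp [h10, ← hx, hv' 10]
      · have h21 : w ≠ 21 := fun h => hu21 (h ▸ hw)
        simp only [h20, h11, h10, if_false]
        rw [hv' w h20]
        exact hv w (by simp [vars, setRow, cmp, fill, h20, h11, h10, h21])
    · have hb' : b ∉ [2, 3, 10, a] := fun h => hua b h hb
      simp only [List.mem_cons, List.not_mem_nil, or_false, not_or] at hb'
      simp only [Mem.setVar_arr]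
      rw [ha' b hb'.2.2.1, hs b (by simp [setRow, cmp, fill, arrs, hb'])]
  have hrow0 : rows n (s2.arr 10) 0 =
      {z | z < n ∧ t.Holds (((s.setVar 10 i).setVar 11 k).setVar 20 z)} := by
    have e2 := rows_setRow (O := O) (s := s1) (a := 10) (r := .const 1) (t := t') ht'
      (hta' 10 (by simp)) (by simp [Expr.arrs]) (by simp [Expr.vars])
    have e1 := rows_setRow (O := O) (s := s') (a := 10) (r := .const 0) (t := t) ht
      (hta 10 (by simp)) (by simp [Expr.arrs]) (by simp [Expr.vars])
    rw [hv1 0 (by omega), h0', ← hs2] at e2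
    rw [h0', ← hs1] at e1
    rw [e2, Function.update_of_ne (by simp), e1]
    simp only [Expr.eval_const, Function.update_self]
    ext z
    exact and_congr_right fun _ => hcongr ht hta htv (fun _ _ => rfl) fun _ _ => rfl
  have hrow1 : rows n (s2.arr 10) 1 =
      {z | z < n ∧ t'.Holds (((s.setVar 10 i).setVar 11 k).setVar 20 z)} := by
    have e2 := rows_setRow (O := O) (s := s1) (a := 10) (r := .const 1) (t := t') ht'
      (hta' 10 (by simp)) (by simp [Expr.arrs]) (by simp [Expr.vars])
    rw [hv1 0 (by omega), h0', ← hs2] at e2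
    rw [e2]
    simp only [Expr.eval_const, Function.update_self]
    ext z
    exact and_congr_right fun _ => hcongr ht' hta' htv' hv1 hs1a
  have hc := den_cmp (G := G) (v := v) (s := s2) (i := 10) (a := 10) (ra := .const 0) (b := 10)
    (rb := .const 1) ((hv2 0 (by omega)).trans h0') (by omega) (by omega) rfl (by simp [Expr.vars])
    (by simp [Expr.vars]) (by omega) rfl (by simp [Expr.vars]) (by simp [Expr.vars])
  simp only [Expr.eval_const, hrow0, hrow1, hv2 10 (by omega), hx, ← hO, ← hs3] at hc
  have hx3 : s3.var 10 = i := (hv3 10 (by omega) (by omega)).trans hx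
  have hy3 : s3.var 11 = k := (hv3 11 (by omega) (by omega)).trans hy
  refine ⟨by simpa [den, Mem.setArr, hx3, hy3] using hc, fun j l hjl => ?_⟩
  rw [← hs3a a ha.1 ha.2.1 ha.2.2]
  simp only [den, Mem.setArr, Expr.eval_var, hx3, hy3]
  rw [if_neg (by omega)]

end Cmd
end GraphEFX

/-! ### The tables of an instance and of a partial orientation -/

namespace GraphEFX

variable {G : SimpleGraph (Fin n)} {v : Fin n → Set G.edgeSet → ℝ}

/-- Array `0` is the adjacency matrix, and arrays `4` and `11` hold the goods and the chores. -/
structure Kinds (hG : IsMixedInstance G v) (M : ℕ → ℕ → ℕ → ℕ) : Prop where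
  adj : ∀ i < n, ∀ k < n, M 0 i k ≠ 0 ↔ LocalAdj G i k
  good : ∀ i < n, ∀ k < n, M 4 i k ≠ 0 ↔ k ∈ (localInstance hG).good i
  chore : ∀ i < n, ∀ k < n, M 11 i k ≠ 0 ↔ k ∈ (localInstance hG).chore i

theorem Kinds.congr {hG : IsMixedInstance G v} {M M' : ℕ → ℕ → ℕ → ℕ} (h : Kinds hG M)
    (h0 : M' 0 = M 0) (h4 : M' 4 = M 4) (h11 : M' 11 = M 11) : Kinds hG M' :=
  ⟨by rw [h0]; exact h.adj, by rw [h4]; exact h.good, by rw [h11]; exact h.chore⟩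

/-- The partial orientation in array `5`. -/
def bundles (n : ℕ) (M : ℕ → ℕ → ℕ → ℕ) : ℕ → Set ℕ := rows n (M 5)

/-- The arrays `6` to `9`, `12`, `13`, `16` and `17` hold the data of the partial orientation `X` on
which the decisions of the algorithm depend. -/
structure Tables (I : LocalInstance) (X : ℕ → Set ℕ) (M : ℕ → ℕ → ℕ → ℕ) : Prop where
  unheld : ∀ i < I.n, ∀ k < I.n, M 6 i k ≠ 0 ↔ k ∈ I.unheld X i
  envier : ∀ i < I.n, M 7 0 i = I.envier X i
  root : ∀ i < I.n, M 8 0 i = I.root X i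
  safe : ∀ i < I.n, ∀ k < I.n, M 9 i k ≠ 0 ↔ I.Safe X i k
  replace : ∀ i < I.n, ∀ k < I.n, M 12 i k ≠ 0 ↔ I.val i (X i) ≤ I.val i (I.unheld X i)
  absorb : ∀ i < I.n, ∀ k < I.n, M 13 i k ≠ 0 ↔ I.val i {k} ≤ I.val i (X i ∪ I.unheld X i)
  single : ∀ i < I.n, ∀ k < I.n, M 16 i k ≠ 0 ↔ I.val i {k} ≤ I.val i (X i)
  pool : ∀ i < I.n, ∀ k < I.n, M 17 i k ≠ 0 ↔ I.val i {k} ≤ I.val i (I.pool X i k \ {k})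

namespace LocalInstance

variable {I : LocalInstance} {X : ℕ → Set ℕ}

theorem envier_lt {i : ℕ} (hi : i < I.n) : I.envier X i < I.n := by
  by_cases hf : I.Free X i
  · rwa [envier_of_free hf]
  · exact (wants_envier hf).lt_n.1

theorem iterate_envier_lt {i : ℕ} (hi : i < I.n) (m : ℕ) : (I.envier X)^[m] i < I.n := by
  induction m with
  | zero => exact hi
  | succ m ih => rw [Function.iterate_succ_apply']; exact envier_lt ih

end LocalInstance

namespace Cmd

/-- The test that never holds. -/
def emptyTest : Test := .le (.const 1) (.const 0)

/-- Variable `20` has the same value as variable `11`. -/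
def singletonTest : Test := .eq (.var 20) (.var 11)

/-- Computes the goods and the chores from single items. -/
def kinds : Cmd :=
  seq (cmpTable 16 singletonTest emptyTest)
    (seq (natTable 4 (.and (.nz 0 (.var 10) (.var 20)) (.not (.nz 16 (.var 10) (.var 20)))))
      (seq (cmpTable 16 emptyTest singletonTest)
        (natTable 11 (.and (.nz 0 (.var 10) (.var 20)) (.not (.nz 16 (.var 10) (.var 20)))))))

theorem setOf_lt_and_eq {k : ℕ} (hk : k < n) : {z | z < n ∧ z = k} = {k} := by
  ext z
  simp only [Set.mem_ofPred_eq, Set.mem_singleton_iff]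
  constructor
  · exact fun h => h.2
  · rintro rfl; exact ⟨hk, rfl⟩

theorem den_kinds (hG : IsMixedInstance G v) {s : Mem} (h0 : s.var 0 = n)
    (ha : ∀ i < n, ∀ k < n, s.arr 0 i k ≠ 0 ↔ LocalAdj G i k) :
    Kinds hG ((kinds.den (valueOracle G v) s).arr) := by
  set O := valueOracle G v with hO
  simp only [kinds, den_seq]
  set s1 := (cmpTable 16 singletonTest emptyTest).den O s with hs1
  set s2 := (natTable 4 (.and (.nz 0 (.var 10) (.var 20))
    (.not (.nz 16 (.var 10) (.var 20))))).den O s1 with hs2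
  set s3 := (cmpTable 16 emptyTest singletonTest).den O s2 with hs3
  set s4 := (natTable 11 (.and (.nz 0 (.var 10) (.var 20))
    (.not (.nz 16 (.var 10) (.var 20))))).den O s3 with hs4
  have v1 : s1.var 0 = n := (den_var (by decide) s).trans h0
  have v2 : s2.var 0 = n := (den_var (by decide) s1).trans v1
  have v3 : s3.var 0 = n := (den_var (by decide) s2).trans v2
  have a1 : s1.arr 0 = s.arr 0 := den_arr (by decide) s
  have a3 : s3.arr 0 = s.arr 0 := (den_arr (by decide) s2).trans ((den_arr (by decide) s1).trans a1)
  have a4 : s4.arr 0 = s.arr 0 := (den_arr (by decide) s3).trans a3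
  have b4 : s4.arr 4 = s2.arr 4 := (den_arr (by decide) s3).trans (den_arr (by decide) s2)
  have c1 := den_cmpTable (v := v) (G := G) (s := s) (a := 16) (t := singletonTest) (t' := emptyTest) h0 rfl rfl
    (by decide) (by decide) (by decide) (by decide) (by decide)
  have c3 := den_cmpTable (v := v) (G := G) (s := s2) (a := 16) (t := emptyTest) (t' := singletonTest) v2 rfl rfl
    (by decide) (by decide) (by decide) (by decide) (by decide)
  have c2 := den_natTable (O := O) (s := s1) (a := 4) (t := .and (.nz 0 (.var 10) (.var 20))
    (.not (.nz 16 (.var 10) (.var 20)))) rfl (by decide)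
  have c4 := den_natTable (O := O) (s := s3) (a := 11) (t := .and (.nz 0 (.var 10) (.var 20))
    (.not (.nz 16 (.var 10) (.var 20)))) rfl (by decide)
  simp only [← hO, ← hs1, ← hs2, ← hs3, ← hs4, v1, v3] at c1 c2 c3 c4
  simp only [singletonTest, emptyTest, Test.holds_eq, Test.holds_le, Expr.eval_var, Expr.eval_const,
    Mem.setVar_var, if_true, Test.holds_and, Test.holds_nz, Test.holds_not, Mem.setVar_arr,
    show (11 : ℕ) ≠ 20 by decide, show (10 : ℕ) ≠ 20 by decide, if_false, a1, a3,
    show ¬ (1 ≤ 0) by decide, and_false, Set.ofPred_false] at c1 c2 c3 c4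
  refine ⟨?_, ?_, ?_⟩
  · rw [a4]; exact ha
  · intro i hi k hk
    rw [b4, c2 i hi k hk, c1 i hi k hk, ha i hi k hk, setOf_lt_and_eq hk, not_le]
    rfl
  · intro i hi k hk
    rw [c4 i hi k hk, c3 i hi k hk, ha i hi k hk, setOf_lt_and_eq hk, not_le]
    rfl

/-- Entry `[0, i]` of array `7` becomes the agent who envies `i`, or `i` if there is none. -/
def envierTable : Cmd :=
  loop 10 (seq (store 7 (.const 0) (.var 10) (.var 10)) (loop 11
    (ite (.and (.nz 5 (.var 10) (.var 11)) (.and (.nz 4 (.var 11) (.var 10))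
      (.not (.nz 16 (.var 11) (.var 10))))) (store 7 (.const 0) (.var 10) (.var 11)) skip)))

/-- Entry `[0, i]` of array `8` becomes the root of `i`. -/
def rootTable : Cmd :=
  loop 10 (seq (store 8 (.const 0) (.var 10) (.var 10)) (loop 11
    (store 8 (.const 0) (.var 10) (.get 7 (.const 0) (.get 8 (.const 0) (.var 10))))))

section

variable {O : ℕ → (ℕ → ℕ → ℕ) → ℝ} {s : Mem}

theorem den_envierTable (W : ℕ → ℕ → Prop)
    (hW : ∀ i < s.var 0, ∀ l < s.var 0,
      (s.arr 5 i l ≠ 0 ∧ s.arr 4 l i ≠ 0 ∧ ¬ s.arr 16 l i ≠ 0) ↔ W l i) :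
    ∀ i < s.var 0, ((envierTable.den O s).arr 7 0 i = i ∧ ∀ l < s.var 0, ¬ W l i) ∨
      W ((envierTable.den O s).arr 7 0 i) i := by
  refine (den_cells 7 0 (fun i m => (m = i ∧ ∀ l < s.var 0, ¬ W l i) ∨ W m i) rfl ?_).1
  intro i hi s' hx hv ha
  simp only [den_seq]
  set s1 := (store 7 (.const 0) (.var 10) (.var 10)).den O s' with hs1
  have h0 : s1.var 0 = s.var 0 := hv 0 (by decide)
  have hx1 : s1.var 10 = i := hx
  have h5 : s1.arr 5 = s.arr 5 := (den_arr (by decide) s').trans (ha 5 (by decide))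
  have h4 : s1.arr 4 = s.arr 4 := (den_arr (by decide) s').trans (ha 4 (by decide))
  have h16 : s1.arr 16 = s.arr 16 := (den_arr (by decide) s').trans (ha 16 (by decide))
  have key := den_loop (O := O) (x := 11) (s := s1)
    (c := ite (.and (.nz 5 (.var 10) (.var 11)) (.and (.nz 4 (.var 11) (.var 10))
      (.not (.nz 16 (.var 11) (.var 10))))) (store 7 (.const 0) (.var 10) (.var 11)) skip)
    (fun m M => ((M 7 0 i = i ∧ ∀ l < m, ¬ W l i) ∨ W (M 7 0 i) i) ∧
      ∀ j l, j ≠ 0 ∨ l ≠ i → M 7 j l = s'.arr 7 j l) rfl ?_ ?_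
  · rw [h0] at key
    exact key
  · refine ⟨Or.inl ⟨?_, fun l hl => absurd hl (Nat.not_lt_zero l)⟩, fun j l hjl => ?_⟩
    · simp [hs1, den, Mem.setArr, hx]
    · simp only [hs1, den, Mem.setArr, Expr.eval_const, Expr.eval_var, hx, true_and]
      rw [if_neg (by omega)]
  · intro m hm s2 hy hv2 ha2 ih
    have hx2 : s2.var 10 = i := (hv2 10 (by decide)).trans hx1
    have hmW := hW i hi m (h0 ▸ hm)
    rw [← h5, ← h4, ← h16, ← ha2 5 (by decide), ← ha2 4 (by decide), ← ha2 16 (by decide)] at hmW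
    by_cases hw : W m i
    · rw [den_ite_true (by simpa [hx2, hy] using hmW.2 hw)]
      refine ⟨Or.inr (by simpa [den, Mem.setArr, hx2, hy] using hw), fun j l hjl => ?_⟩
      rw [← ih.2 j l hjl]
      simp only [den, Mem.setArr, Expr.eval_const, Expr.eval_var, hx2, true_and]
      rw [if_neg (by omega)]
    · rw [den_ite_false (by rw [← hmW] at hw; simpa [hx2, hy] using hw)]
      refine ⟨ih.1.imp (fun h => ⟨h.1, fun l hl => ?_⟩) id, ih.2⟩
      rcases Nat.lt_succ_iff_lt_or_eq.1 hl with hl | rfl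
      · exact h.2 l hl
      · exact hw

theorem den_rootTable :
    ∀ i < s.var 0, (rootTable.den O s).arr 8 0 i = (s.arr 7 0)^[s.var 0] i := by
  refine (den_cells 8 0 (fun i m => m = (s.arr 7 0)^[s.var 0] i) rfl ?_).1
  intro i hi s' hx hv ha
  simp only [den_seq]
  set s1 := (store 8 (.const 0) (.var 10) (.var 10)).den O s' with hs1
  have h0 : s1.var 0 = s.var 0 := hv 0 (by decide)
  have hx1 : s1.var 10 = i := hx
  have h7 : s1.arr 7 = s.arr 7 := (den_arr (by decide) s').trans (ha 7 (by decide))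
  have key := den_loop (O := O) (x := 11) (s := s1)
    (c := store 8 (.const 0) (.var 10) (.get 7 (.const 0) (.get 8 (.const 0) (.var 10))))
    (fun m M => M 8 0 i = (s.arr 7 0)^[m] i ∧
      ∀ j l, j ≠ 0 ∨ l ≠ i → M 8 j l = s'.arr 8 j l) rfl ?_ ?_
  · rw [h0] at key
    exact key
  · refine ⟨by simp [hs1, den, Mem.setArr, hx], fun j l hjl => ?_⟩
    simp only [hs1, den, Mem.setArr, Expr.eval_const, Expr.eval_var, hx, true_and]
    rw [if_neg (by omega)]
  · intro m hm s2 hy hv2 ha2 ih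
    have hx2 : s2.var 10 = i := (hv2 10 (by decide)).trans hx1
    have h72 : s2.arr 7 = s.arr 7 := (ha2 7 (by decide)).trans h7
    refine ⟨?_, fun j l hjl => ?_⟩
    · rw [Function.iterate_succ_apply', ← ih.1]
      simp [den, Mem.setArr, hx2, h72]
    · rw [← ih.2 j l hjl]
      simp only [den, Mem.setArr, Expr.eval_const, Expr.eval_var, hx2, true_and]
      rw [if_neg (by omega)]

end

/-- Computes the tables of the partial orientation in array `5`. -/
def analyze : Cmd :=
  seq (natTable 6 (.and (.nz 4 (.var 10) (.var 20)) (.and (.not (.nz 5 (.var 10) (.var 20)))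
    (.not (.nz 5 (.var 20) (.var 10))))))
  (seq (cmpTable 16 singletonTest (.nz 5 (.var 10) (.var 20)))
  (seq envierTable
  (seq rootTable
  (seq (cmpTable 9 (.or (.nz 6 (.var 10) (.var 20)) (.and singletonTest (.and (.nz 5 (.var 11) (.var 10))
    (.nz 4 (.var 10) (.var 11))))) (.nz 5 (.var 10) (.var 20)))
  (seq (cmpTable 12 (.nz 5 (.var 10) (.var 20)) (.nz 6 (.var 10) (.var 20)))
  (seq (cmpTable 13 singletonTest (.or (.nz 5 (.var 10) (.var 20)) (.nz 6 (.var 10) (.var 20))))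
  (cmpTable 17 singletonTest (.and (.or (.nz 6 (.var 10) (.var 20))
    (.eq (.var 20) (.get 8 (.const 0) (.var 11)))) (.not singletonTest)))))))))

theorem den_analyze (hG : IsMixedInstance G v) {s : Mem} (h0 : s.var 0 = n) (hk : Kinds hG s.arr)
    (hX : (localInstance hG).Oriented (bundles n s.arr)) :
    Tables (localInstance hG) (bundles n s.arr) (analyze.den (valueOracle G v) s).arr := by
  set O := valueOracle G v with hO
  set I := localInstance hG
  set X := bundles n s.arr with hXdef
  have hmem : ∀ i, ∀ k < n, s.arr 5 i k ≠ 0 ↔ k ∈ X i := fun i k h => by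
    simp [hXdef, bundles, rows, h]
  have hXset : ∀ i, {z | z < n ∧ s.arr 5 i z ≠ 0} = X i := fun i => rfl
  have hUlt : ∀ i k, k ∈ I.unheld X i → k < n := fun i k h => (LocalInstance.good_lt h.1).2
  simp only [analyze, den_seq]
  set s1 := (natTable 6 (.and (.nz 4 (.var 10) (.var 20)) (.and (.not (.nz 5 (.var 10) (.var 20)))
    (.not (.nz 5 (.var 20) (.var 10)))))).den O s with hs1
  set s2 := (cmpTable 16 singletonTest (.nz 5 (.var 10) (.var 20))).den O s1 with hs2
  set s3 := envierTable.den O s2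
  set s4 := rootTable.den O s3 with hs4
  set s5 := (cmpTable 9 (.or (.nz 6 (.var 10) (.var 20)) (.and singletonTest (.and (.nz 5 (.var 11) (.var 10))
    (.nz 4 (.var 10) (.var 11))))) (.nz 5 (.var 10) (.var 20))).den O s4 with hs5
  set s6 := (cmpTable 12 (.nz 5 (.var 10) (.var 20)) (.nz 6 (.var 10) (.var 20))).den O s5 with hs6
  set s7 := (cmpTable 13 singletonTest (.or (.nz 5 (.var 10) (.var 20))
    (.nz 6 (.var 10) (.var 20)))).den O s6 with hs7
  set s8 := (cmpTable 17 singletonTest (.and (.or (.nz 6 (.var 10) (.var 20))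
    (.eq (.var 20) (.get 8 (.const 0) (.var 11)))) (.not singletonTest))).den O s7 with hs8
  have v1 : s1.var 0 = n := (den_var (by decide) s).trans h0
  have v2 : s2.var 0 = n := (den_var (by decide) s1).trans v1
  have v3 : s3.var 0 = n := (den_var (by decide) s2).trans v2
  have v4 : s4.var 0 = n := (den_var (by decide) s3).trans v3
  have v5 : s5.var 0 = n := (den_var (by decide) s4).trans v4
  have v6 : s6.var 0 = n := (den_var (by decide) s5).trans v5
  have v7 : s7.var 0 = n := (den_var (by decide) s6).trans v6
  -- the arrays `4` and `5` do not change, and each table remains after it has been computed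
  have p1 : ∀ a ∈ [4, 5], s1.arr a = s.arr a := fun a ha => den_arr (natTable_arrs (by
    rintro rfl; revert ha; decide)) s
  have p2 : ∀ a ∈ [4, 5, 6], s2.arr a = s1.arr a := fun a ha => den_arr (cmpTable_arrs (by
    revert a; decide)) s1
  have p3 : ∀ a ∈ [4, 5, 6, 16], s3.arr a = s2.arr a := fun a ha => den_arr (by
    revert a; decide) s2
  have p4 : ∀ a ∈ [4, 5, 6, 16, 7], s4.arr a = s3.arr a := fun a ha => den_arr (by
    revert a; decide) s3
  have p5 : ∀ a ∈ [4, 5, 6, 16, 7, 8], s5.arr a = s4.arr a := fun a ha => den_arr (cmpTable_arrs (by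
    revert a; decide)) s4
  have p6 : ∀ a ∈ [4, 5, 6, 16, 7, 8, 9], s6.arr a = s5.arr a := fun a ha =>
    den_arr (cmpTable_arrs (by revert a; decide)) s5
  have p7 : ∀ a ∈ [4, 5, 6, 16, 7, 8, 9, 12], s7.arr a = s6.arr a := fun a ha =>
    den_arr (cmpTable_arrs (by revert a; decide)) s6
  have p8 : ∀ a ∈ [4, 5, 6, 16, 7, 8, 9, 12, 13], s8.arr a = s7.arr a := fun a ha =>
    den_arr (cmpTable_arrs (by revert a; decide)) s7
  have q2 : ∀ a ∈ [4, 5], s2.arr a = s.arr a := fun a ha =>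
    (p2 a (by revert a; decide)).trans (p1 a ha)
  have q4 : ∀ a ∈ [4, 5], s4.arr a = s.arr a := fun a ha =>
    ((p4 a (by revert a; decide)).trans (p3 a (by revert a; decide))).trans (q2 a ha)
  have q5 : ∀ a ∈ [4, 5], s5.arr a = s.arr a := fun a ha =>
    (p5 a (by revert a; decide)).trans (q4 a ha)
  have q6 : ∀ a ∈ [4, 5], s6.arr a = s.arr a := fun a ha =>
    (p6 a (by revert a; decide)).trans (q5 a ha)
  have r4 : s4.arr 6 = s1.arr 6 :=
    ((p4 6 (by decide)).trans (p3 6 (by decide))).trans (p2 6 (by decide))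
  have r5 : s5.arr 6 = s1.arr 6 := (p5 6 (by decide)).trans r4
  have r6 : s6.arr 6 = s1.arr 6 := (p6 6 (by decide)).trans r5
  have r7 : s7.arr 6 = s1.arr 6 := (p7 6 (by decide)).trans r6
  have t7 : s7.arr 8 = s4.arr 8 :=
    ((p7 8 (by decide)).trans (p6 8 (by decide))).trans (p5 8 (by decide))
  have cU : ∀ i < n, ∀ k < n, s1.arr 6 i k ≠ 0 ↔ k ∈ I.unheld X i := by
    intro i hi k hk'
    have := den_natTable (O := O) (s := s) (a := 6) (t := .and (.nz 4 (.var 10) (.var 20))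
      (.and (.not (.nz 5 (.var 10) (.var 20))) (.not (.nz 5 (.var 20) (.var 10))))) rfl (by decide)
      i (h0.symm ▸ hi) k (h0.symm ▸ hk')
    rw [← hs1] at this
    rw [this]
    simp only [Test.holds_and, Test.holds_nz, Test.holds_not, Expr.eval_var, Mem.setVar_var,
      Mem.setVar_arr, if_true, show (10 : ℕ) ≠ 20 by decide, if_false, hk.good i hi k hk',
      hmem i k hk', hmem k i hi]
    rfl
  have hUset : ∀ i < n, {z | z < n ∧ s1.arr 6 i z ≠ 0} = I.unheld X i := by
    intro i hi
    ext z
    exact ⟨fun h => (cU i hi z h.1).1 h.2, fun h => ⟨hUlt i z h, (cU i hi z (hUlt i z h)).2 h⟩⟩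
  have c16 : ∀ i < n, ∀ k < n, s2.arr 16 i k ≠ 0 ↔ I.val i {k} ≤ I.val i (X i) := by
    intro i hi k hk'
    have := den_cmpTable (v := v) (s := s1) (a := 16) (t := singletonTest) (t' := .nz 5 (.var 10) (.var 20))
      v1 rfl rfl (by decide) (by decide) (by decide) (by decide) (by decide) i hi k hk'
    rw [← hO, ← hs2] at this
    rw [this]
    simp only [singletonTest, Test.holds_eq, Test.holds_nz, Expr.eval_var, Mem.setVar_var, Mem.setVar_arr,
      if_true, show (10 : ℕ) ≠ 20 by decide, show (11 : ℕ) ≠ 20 by decide,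
      show (10 : ℕ) ≠ 11 by decide, if_false, p1 5 (by decide), setOf_lt_and_eq hk', hXset]
    rfl
  have cW : ∀ i < n, ∀ l < n,
      (s2.arr 5 i l ≠ 0 ∧ s2.arr 4 l i ≠ 0 ∧ ¬ s2.arr 16 l i ≠ 0) ↔ I.Wants X l i := by
    intro i hi l hl
    rw [q2 5 (by decide), q2 4 (by decide), hmem i l hl, hk.good l hl i hi, c16 l hl i hi, not_le]
    rfl
  have cE : ∀ i < n, s3.arr 7 0 i = I.envier X i := by
    intro i hi
    rcases den_envierTable (O := O) (s := s2) (I.Wants X) (by rw [v2]; exact cW) i (by rw [v2]; exact hi)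
      with ⟨h, h'⟩ | h
    · rw [h, LocalInstance.envier_of_free]
      exact fun l hl => h' l (v2.symm ▸ hl.lt_n.1) hl
    · exact (hX.envier_eq h).symm
  have cR : ∀ i < n, s4.arr 8 0 i = I.root X i := by
    intro i hi
    have := den_rootTable (O := O) (s := s3) i (by rw [v3]; exact hi)
    rw [← hs4, v3] at this
    rw [this, LocalInstance.root]
    change _ = (I.envier X)^[n] i
    have key : ∀ m, (s3.arr 7 0)^[m] i = (I.envier X)^[m] i := by
      intro m
      induction m with
      | zero => rfl
      | succ m ih =>
        rw [Function.iterate_succ_apply', Function.iterate_succ_apply', ih,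
          cE _ (LocalInstance.iterate_envier_lt hi m)]
    exact key n
  refine ⟨fun i hi k hk' => ?_, fun i hi => ?_, fun i hi => ?_, fun i hi k hk' => ?_,
    fun i hi k hk' => ?_, fun i hi k hk' => ?_, fun i hi k hk' => ?_, fun i hi k hk' => ?_⟩
  · rw [p8 6 (by decide), r7]
    exact cU i hi k hk'
  · rw [p8 7 (by decide), p7 7 (by decide), p6 7 (by decide), p5 7 (by decide), p4 7 (by decide)]
    exact cE i hi
  · rw [p8 8 (by decide), t7]
    exact cR i hi
  · rw [p8 9 (by decide), p7 9 (by decide), p6 9 (by decide)]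
    have := den_cmpTable (v := v) (s := s4) (a := 9) (t := .or (.nz 6 (.var 10) (.var 20))
      (.and singletonTest (.and (.nz 5 (.var 11) (.var 10)) (.nz 4 (.var 10) (.var 11)))))
      (t' := .nz 5 (.var 10) (.var 20))
      v4 rfl rfl (by decide) (by decide) (by decide) (by decide) (by decide) i hi k hk'
    rw [← hO, ← hs5] at this
    rw [this]
    simp only [singletonTest, Test.holds_eq, Test.holds_nz, Test.holds_or, Test.holds_and, Expr.eval_var,
      Mem.setVar_var, Mem.setVar_arr, if_true, show (10 : ℕ) ≠ 20 by decide,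
      show (11 : ℕ) ≠ 20 by decide, show (10 : ℕ) ≠ 11 by decide, if_false, q4 5 (by decide),
      q4 4 (by decide), r4, hXset, hmem k i hi, hk.good i hi k hk']
    have e : {z | z < n ∧ (s1.arr 6 i z ≠ 0 ∨ z = k ∧ i ∈ X k ∧ k ∈ I.good i)} = I.offer X i k := by
      ext z
      constructor
      · rintro ⟨h, h' | h'⟩
        · exact Or.inl ((cU i hi z h).1 h')
        · exact Or.inr h'
      · rintro (h | ⟨rfl, h⟩)
        · exact ⟨hUlt i z h, Or.inl ((cU i hi z (hUlt i z h)).2 h)⟩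
        · exact ⟨hk', Or.inr ⟨rfl, h⟩⟩
    rw [e]
    rfl
  · rw [p8 12 (by decide), p7 12 (by decide)]
    have := den_cmpTable (v := v) (s := s5) (a := 12) (t := .nz 5 (.var 10) (.var 20))
      (t' := .nz 6 (.var 10) (.var 20))
      v5 rfl rfl (by decide) (by decide) (by decide) (by decide) (by decide) i hi k hk'
    rw [← hO, ← hs6] at this
    rw [this]
    simp only [Test.holds_nz, Expr.eval_var, Mem.setVar_var, Mem.setVar_arr, if_true,
      show (10 : ℕ) ≠ 20 by decide, show (10 : ℕ) ≠ 11 by decide, if_false, q5 5 (by decide),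
      r5, hXset, hUset i hi]
    rfl
  · rw [p8 13 (by decide)]
    have := den_cmpTable (v := v) (s := s6) (a := 13) (t := singletonTest)
      (t' := .or (.nz 5 (.var 10) (.var 20)) (.nz 6 (.var 10) (.var 20)))
      v6 rfl rfl (by decide) (by decide) (by decide) (by decide) (by decide) i hi k hk'
    rw [← hO, ← hs7] at this
    rw [this]
    simp only [singletonTest, Test.holds_eq, Test.holds_nz, Test.holds_or, Expr.eval_var, Mem.setVar_var,
      Mem.setVar_arr, if_true, show (10 : ℕ) ≠ 20 by decide, show (11 : ℕ) ≠ 20 by decide,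
      show (10 : ℕ) ≠ 11 by decide, if_false, q6 5 (by decide), r6, setOf_lt_and_eq (n := n) hk']
    rw [← hXset i, ← hUset i hi]
    simp only [and_or_left, Set.ofPred_or]
    rfl
  · rw [p8 16 (by decide), p7 16 (by decide), p6 16 (by decide), p5 16 (by decide),
      p4 16 (by decide), p3 16 (by decide)]
    exact c16 i hi k hk'
  · have := den_cmpTable (v := v) (s := s7) (a := 17) (t := singletonTest)
      (t' := .and (.or (.nz 6 (.var 10) (.var 20)) (.eq (.var 20) (.get 8 (.const 0) (.var 11))))
        (.not singletonTest))
      v7 rfl rfl (by decide) (by decide) (by decide) (by decide) (by decide) i hi k hk'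
    rw [← hO, ← hs8] at this
    rw [this]
    simp only [singletonTest, Test.holds_eq, Test.holds_nz, Test.holds_or, Test.holds_and, Test.holds_not,
      Expr.eval_var, Expr.eval_get, Expr.eval_const, Mem.setVar_var, Mem.setVar_arr, if_true,
      show (10 : ℕ) ≠ 20 by decide, show (11 : ℕ) ≠ 20 by decide, show (10 : ℕ) ≠ 11 by decide,
      if_false, r7, t7, cR k hk', setOf_lt_and_eq (n := n) hk']
    have e : {z | z < n ∧ (s1.arr 6 i z ≠ 0 ∨ z = I.root X k) ∧ ¬ z = k} = I.pool X i k \ {k} := by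
      ext z
      constructor
      · rintro ⟨h, h' | h', hz⟩
        · exact ⟨Or.inl ((cU i hi z h).1 h'), hz⟩
        · exact ⟨Or.inr h', hz⟩
      · rintro ⟨h | rfl, hz⟩
        · exact ⟨hUlt i z h, Or.inl ((cU i hi z (hUlt i z h)).2 h), hz⟩
        · exact ⟨LocalInstance.root_lt hk', Or.inr rfl, hz⟩
    rw [e]
    rfl

end Cmd
end GraphEFX

/-! ### Programs that change the partial orientation -/

namespace GraphEFX
namespace Cmd

variable {G : SimpleGraph (Fin n)} {v : Fin n → Set G.edgeSet → ℝ} {s : Mem}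

theorem mem_bundles {M : ℕ → ℕ → ℕ → ℕ} {i k : ℕ} (hk : k < n) :
    M 5 i k ≠ 0 ↔ k ∈ bundles n M i := by
  simp [bundles, rows, hk]

/-- Assigning a row of array `5`. -/
theorem bundles_setRow {O : ℕ → (ℕ → ℕ → ℕ) → ℝ} {r : Expr} {t : Test} (h0 : s.var 0 = n)
    (ht : t.isNat = true) (hta : 5 ∉ t.arrs) (hra : 5 ∉ r.arrs) (hrv : 20 ∉ r.vars) :
    bundles n ((setRow 5 r t).den O s).arr = Function.update (bundles n s.arr) (r.eval s)
      {k | k < n ∧ t.Holds (s.setVar 20 k)} := by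
  have := rows_setRow (O := O) (s := s) (a := 5) ht hta hra hrv
  rwa [h0] at this

/-- All agents in turn look at all their goods and take the best one nobody holds. -/
def serial : Cmd :=
  loop 2 (loop 3 (seq (cmpTable 16 singletonTest (.nz 5 (.var 10) (.var 20)))
    (ite (.and (.nz 4 (.var 2) (.var 3)) (.and (.not (.nz 5 (.var 3) (.var 2)))
      (.not (.nz 16 (.var 2) (.var 3))))) (setRow 5 (.var 2) (.eq (.var 20) (.var 3))) skip)))

theorem den_serial (hG : IsMixedInstance G v) (h0 : s.var 0 = n) (hk : Kinds hG s.arr)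
    (hX : ∀ i, bundles n s.arr i = ∅) :
    (localInstance hG).Picking (bundles n (serial.den (valueOracle G v) s).arr) n 0 := by
  set O := valueOracle G v with hO
  set I := localInstance hG
  have key := den_loop (O := O) (s := s) (x := 2) (c := loop 3
    (seq (cmpTable 16 singletonTest (.nz 5 (.var 10) (.var 20)))
    (ite (.and (.nz 4 (.var 2) (.var 3)) (.and (.not (.nz 5 (.var 3) (.var 2)))
      (.not (.nz 16 (.var 2) (.var 3))))) (setRow 5 (.var 2) (.eq (.var 20) (.var 3))) skip)))
    (fun i M => I.Picking (bundles n M) i 0) rfl (LocalInstance.Picking.start hX) ?_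
  · rwa [h0] at key
  intro i hi s1 hx1 hv1 ha1 ih1
  have h01 : s1.var 0 = n := (hv1 0 (by decide)).trans h0
  have key := den_loop (O := O) (s := s1) (x := 3) (c :=
    (seq (cmpTable 16 singletonTest (.nz 5 (.var 10) (.var 20)))
    (ite (.and (.nz 4 (.var 2) (.var 3)) (.and (.not (.nz 5 (.var 3) (.var 2)))
      (.not (.nz 16 (.var 2) (.var 3))))) (setRow 5 (.var 2) (.eq (.var 20) (.var 3))) skip)))
    (fun m M => I.Picking (bundles n M) i m) rfl ih1 ?_
  · rw [h01] at key
    exact key.next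
  intro m hm s2 hx2 hv2 ha2 ih2
  refine ih2.step ?_
  simp only [den_seq]
  have h02 : s2.var 0 = n := (hv2 0 (by decide)).trans h01
  have hi2 : s2.var 2 = i := (hv2 2 (by decide)).trans hx1
  rw [h0] at hi
  rw [h01] at hm
  set s3 := (cmpTable 16 singletonTest (.nz 5 (.var 10) (.var 20))).den O s2 with hs3
  have h03 : s3.var 0 = n := (den_var (by decide) s2).trans h02
  have hi3 : s3.var 2 = i := (den_var (by decide) s2).trans hi2
  have hm3 : s3.var 3 = m := (den_var (by decide) s2).trans hx2
  have e5 : s3.arr 5 = s2.arr 5 := den_arr (by decide) s2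
  have e4 : s3.arr 4 = s.arr 4 :=
    (den_arr (by decide) s2).trans ((ha2 4 (by decide)).trans (ha1 4 (by decide)))
  have eX : bundles n s3.arr = bundles n s2.arr := congrArg (rows n) e5
  have h16 : s3.arr 16 i m ≠ 0 ↔ I.val i {m} ≤ I.val i (bundles n s2.arr i) := by
    have := den_cmpTable (v := v) (s := s2) (a := 16) (t := singletonTest) (t' := .nz 5 (.var 10) (.var 20))
      h02 rfl rfl (by decide) (by decide) (by decide) (by decide) (by decide) i hi m hm
    rw [← hO, ← hs3] at this
    rw [this]
    simp only [singletonTest, Test.holds_eq, Test.holds_nz, Expr.eval_var, Mem.setVar_var, Mem.setVar_arr,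
      if_true, show (10 : ℕ) ≠ 20 by decide, show (11 : ℕ) ≠ 20 by decide,
      show (10 : ℕ) ≠ 11 by decide, if_false, setOf_lt_and_eq hm]
    rfl
  have ht : (Test.and (.nz 4 (.var 2) (.var 3)) (.and (.not (.nz 5 (.var 3) (.var 2)))
      (.not (.nz 16 (.var 2) (.var 3))))).Holds s3 ↔
      m ∈ I.good i ∧ i ∉ bundles n s2.arr m ∧ I.val i (bundles n s2.arr i) < I.val i {m} := by
    simp only [Test.holds_and, Test.holds_nz, Test.holds_not, Expr.eval_var, hi3, hm3, h16, e4, e5,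
      hk.good i hi m hm, mem_bundles hi, not_le]
    rfl
  by_cases h : (Test.and (.nz 4 (.var 2) (.var 3)) (.and (.not (.nz 5 (.var 3) (.var 2)))
      (.not (.nz 16 (.var 2) (.var 3))))).Holds s3
  · rw [den_ite_true h]
    rw [ht] at h
    refine Or.inl ⟨h.1, h.2.1, h.2.2, ?_⟩
    rw [bundles_setRow h03 rfl (by decide) (by decide) (by decide), eX]
    simp [hi3, hm3, setOf_lt_and_eq hm]
  · rw [den_ite_false h, den_skip]
    rw [ht] at h
    exact Or.inr ⟨h, eX⟩

/-- The body of a double loop over all pairs of agents carries out an exchange `S` if its condition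
`T` holds, and does nothing otherwise, provided that the partial orientation satisfies `R`. -/
def Exchanges (hG : IsMixedInstance G v) (c : Cmd) (R : (ℕ → Set ℕ) → Prop) (T : (ℕ → Set ℕ) → ℕ → ℕ → Prop)
    (S : (ℕ → Set ℕ) → ℕ → ℕ → (ℕ → Set ℕ) → Prop) : Prop :=
  ∀ s : Mem, s.var 0 = n → s.var 2 < n → s.var 3 < n → Kinds hG s.arr →
    ∀ X, bundles n s.arr = X → R X →
      (bundles n (c.den (valueOracle G v) s).arr = X ∧ ¬ T X (s.var 2) (s.var 3)) ∨
      (T X (s.var 2) (s.var 3) ∧ S X (s.var 2) (s.var 3) (bundles n (c.den (valueOracle G v) s).arr))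

/-- If no exchange was carried out, then the condition for it held for no pair. -/
theorem den_sweep (hG : IsMixedInstance G v) {c : Cmd} (hok : (loop 2 (loop 3 c)).ok = true)
    (harr : 0 ∉ c.arrs ∧ 4 ∉ c.arrs ∧ 11 ∉ c.arrs) {R : (ℕ → Set ℕ) → Prop}
    {T : (ℕ → Set ℕ) → ℕ → ℕ → Prop} {S : (ℕ → Set ℕ) → ℕ → ℕ → (ℕ → Set ℕ) → Prop}
    (hc : Exchanges hG c R T S)
    {X : ℕ → Set ℕ} {Q : (ℕ → Set ℕ) → Prop}
    (hX : R X) (hQ : ∀ Y, Q Y → R Y)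
    (hS : ∀ Y x y Z, Y = X ∨ Q Y → T Y x y → S Y x y Z → Q Z)
    (h0 : s.var 0 = n) (hk : Kinds hG s.arr) (hs : bundles n s.arr = X ∨ Q (bundles n s.arr)) :
    (bundles n ((loop 2 (loop 3 c)).den (valueOracle G v) s).arr = X ∧
      ∀ x < n, ∀ y < n, ¬ T X x y) ∨
      Q (bundles n ((loop 2 (loop 3 c)).den (valueOracle G v) s).arr) := by
  set O := valueOracle G v with hO
  obtain ⟨hok1, h20, h2c⟩ := ok_loop hok
  obtain ⟨hok2, h30, h3c⟩ := ok_loop hok1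
  have h0c := zero_not_mem_vars hok
  have h0c' := zero_not_mem_vars hok1
  have key := den_loop (O := O) (s := s) (x := 2) (c := loop 3 c)
    (fun i M => (bundles n M = X ∧ ∀ x < i, ∀ y < n, ¬ T X x y) ∨ Q (bundles n M)) hok
    (hs.imp (fun h => ⟨h, fun x hx => absurd hx (Nat.not_lt_zero x)⟩) id) ?_
  · rwa [h0] at key
  intro i hi s1 hx1 hv1 ha1 ih1
  have h01 : s1.var 0 = n := (hv1 0 h0c).trans h0
  have key := den_loop (O := O) (s := s1) (x := 3) (c := c)
    (fun m M => (bundles n M = X ∧ (∀ x < i, ∀ y < n, ¬ T X x y) ∧ ∀ y < m, ¬ T X i y) ∨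
      Q (bundles n M)) hok1
    (ih1.imp (fun h => ⟨h.1, h.2, fun x hx => absurd hx (Nat.not_lt_zero x)⟩) id) ?_
  · rw [h01] at key
    refine key.imp (fun h => ⟨h.1, fun x hx => ?_⟩) id
    rcases Nat.lt_succ_iff_lt_or_eq.1 hx with hx | rfl
    · exact h.2.1 x hx
    · exact h.2.2
  intro m hm s2 hx2 hv2 ha2 ih2
  have h02 : s2.var 0 = n := (hv2 0 h0c').trans h01
  have hi2 : s2.var 2 = i := (hv2 2 h2c).trans hx1
  have hk2 : Kinds hG s2.arr :=
    hk.congr ((ha2 0 harr.1).trans (ha1 0 harr.1)) ((ha2 4 harr.2.1).trans (ha1 4 harr.2.1))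
      ((ha2 11 harr.2.2).trans (ha1 11 harr.2.2))
  have hX2 : bundles n s2.arr = X ∨ Q (bundles n s2.arr) := ih2.imp (fun h => h.1) id
  have hI2 : R (bundles n s2.arr) := by
    rcases hX2 with h | h
    · rwa [h]
    · exact hQ _ h
  rcases hc s2 h02 (by omega) (by omega) hk2 _ rfl hI2 with ⟨h1, h2⟩ | ⟨h1, h2⟩
  · rw [← hO] at h1
    rw [h1]
    refine ih2.imp (fun h => ⟨h.1, h.2.1, fun y hy => ?_⟩) id
    rcases Nat.lt_succ_iff_lt_or_eq.1 hy with hy | rfl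
    · exact h.2.2 y hy
    · rw [h.1, hi2, hx2] at h2
      exact h2
  · exact Or.inr (hS _ _ _ _ hX2 h1 h2)

/-- The agent whom the chain of enviers has reached. -/
def current : Expr := .get 14 (.const 0) (.const 0)

/-- Along the chain of enviers from `l`, every agent takes the item that she envies her predecessor
for. -/
def shift (l : Expr) : Cmd :=
  seq (store 14 (.const 0) (.const 0) l)
    (loop 12 (seq (ite (.not (.eq (.get 7 (.const 0) current) current))
      (setRow 5 (.get 7 (.const 0) current) (.eq (.var 20) current)) skip)
      (store 14 (.const 0) (.const 0) (.get 7 (.const 0) current))))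

theorem den_shift {O : ℕ → (ℕ → ℕ → ℕ) → ℝ} {I : LocalInstance} {X : ℕ → Set ℕ} {l : Expr}
    (h0 : s.var 0 = I.n) (hX : I.Inv X) (henv : ∀ i < I.n, s.arr 7 0 i = I.envier X i)
    (hl : l.eval s < I.n) :
    I.IsShift X (l.eval s) (bundles I.n s.arr) (bundles I.n ((shift l).den O s).arr) := by
  simp only [shift, den_seq]
  set s1 := (store 14 (.const 0) (.const 0) l).den O s with hs1
  have h01 : s1.var 0 = I.n := h0
  have key := den_loop (O := O) (s := s1) (x := 12) (c :=
    (seq (ite (.not (.eq (.get 7 (.const 0) current) current))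
      (setRow 5 (.get 7 (.const 0) current) (.eq (.var 20) current)) skip)
      (store 14 (.const 0) (.const 0) (.get 7 (.const 0) current))))
    (fun m M => M 14 0 0 = (I.envier X)^[m] (l.eval s) ∧ ∀ z,
      (∃ m' < m, I.Wants X z ((I.envier X)^[m'] (l.eval s)) ∧
        bundles I.n M z = {(I.envier X)^[m'] (l.eval s)}) ∨
      ((∀ m' < m, ¬ I.Wants X z ((I.envier X)^[m'] (l.eval s))) ∧
        bundles I.n M z = bundles I.n s.arr z)) rfl ?_ ?_
  · intro z
    rw [h01] at key
    rcases key.2 z with ⟨m', -, hw, hz⟩ | ⟨hw, hz⟩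
    · exact Or.inl ⟨_, LocalInstance.onChain_iterate _ _, hw, hz⟩
    · refine Or.inr ⟨fun q hq hqw => ?_, hz⟩
      obtain ⟨m', hm', rfl⟩ := hq.exists_iterate hX hqw
      exact hw m' hm' hqw
  · refine ⟨by simp [hs1, den, Mem.setArr], fun z => Or.inr ⟨fun m' h => absurd h (Nat.not_lt_zero _), ?_⟩⟩
    have : s1.arr 5 = s.arr 5 := den_arr (by simp [arrs]) s
    simp only [bundles, this]
  · intro m hm s2 hx2 hv2 ha2 ⟨ihc, ih⟩
    set q := (I.envier X)^[m] (l.eval s) with hq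
    have hqn : q < I.n := LocalInstance.iterate_envier_lt hl m
    have h02 : s2.var 0 = I.n := (hv2 0 (by decide)).trans h01
    have h7 : s2.arr 7 = s.arr 7 :=
      (ha2 7 (by decide)).trans (den_arr (c := store 14 (.const 0) (.const 0) l) (by simp [arrs]) s)
    have hcur : current.eval s2 = q := by simp [current, ihc]
    have henv2 : (Expr.get 7 (.const 0) current).eval s2 = I.envier X q := by
      simp only [Expr.eval_get, Expr.eval_const, hcur, h7]
      exact henv q hqn
    simp only [den_seq]
    set s3 := (ite (.not (.eq (.get 7 (.const 0) current) current))
      (setRow 5 (.get 7 (.const 0) current) (.eq (.var 20) current)) skip).den O s2 with hs3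
    have h73 : s3.arr 7 = s2.arr 7 := den_arr (by decide) s2
    have h143 : s3.arr 14 = s2.arr 14 := den_arr (by decide) s2
    have h5 : ((store 14 (.const 0) (.const 0) (.get 7 (.const 0) current)).den O s3).arr 5 =
      s3.arr 5 := den_arr (by decide) s3
    refine ⟨?_, ?_⟩
    · rw [Function.iterate_succ_apply', ← hq, ← henv2]
      simp [den, Mem.setArr, current, h73, h143]
    have hb : bundles I.n ((store 14 (.const 0) (.const 0) (.get 7 (.const 0) current)).den O s3).arr
        = bundles I.n s3.arr := congrArg (rows I.n) h5
    rw [hb]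
    -- the bundles of the agents who do not envy `q` stay as they are
    have old : ∀ z, bundles I.n s3.arr z = bundles I.n s2.arr z → ¬ I.Wants X z q →
        (∃ m' < m + 1, I.Wants X z ((I.envier X)^[m'] (l.eval s)) ∧
          bundles I.n s3.arr z = {(I.envier X)^[m'] (l.eval s)}) ∨
        ((∀ m' < m + 1, ¬ I.Wants X z ((I.envier X)^[m'] (l.eval s))) ∧
          bundles I.n s3.arr z = bundles I.n s.arr z) := by
      intro z hz hw
      rw [hz]
      rcases ih z with ⟨m', hm', h⟩ | ⟨h, h'⟩
      · exact Or.inl ⟨m', by omega, h⟩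
      · refine Or.inr ⟨fun m' hm' => ?_, h'⟩
        rcases Nat.lt_succ_iff_lt_or_eq.1 hm' with hm' | rfl
        · exact h m' hm'
        · exact hw
    by_cases hf : I.Free X q
    · have ht : ¬ (Test.not (.eq (.get 7 (.const 0) current) current)).Holds s2 := by
        rw [Test.holds_not, Test.holds_eq, henv2, hcur, LocalInstance.envier_of_free hf]
        simp
      rw [hs3, den_ite_false ht] at old ⊢
      exact fun z => old z rfl (hf z)
    · have hw := LocalInstance.wants_envier hf
      have ht : (Test.not (.eq (.get 7 (.const 0) current) current)).Holds s2 := by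
        rw [Test.holds_not, Test.holds_eq, henv2, hcur, hX.envier_eq_iff]
        exact hf
      have hrow := bundles_setRow (O := O) (s := s2) (r := .get 7 (.const 0) current)
        (t := .eq (.var 20) current) h02 rfl (by decide) (by decide) (by decide)
      rw [henv2] at hrow
      have hset : {k | k < I.n ∧ (Test.eq (.var 20) current).Holds (s2.setVar 20 k)} = {q} := by
        rw [← setOf_lt_and_eq hqn]
        ext k
        simp [current, ihc]
      rw [hset] at hrow
      rw [hs3, den_ite_true ht] at old ⊢
      intro z
      by_cases hz : z = I.envier X q
      · subst hz
        exact Or.inl ⟨m, by omega, hw, by rw [hrow, Function.update_self]⟩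
      · refine old z (by rw [hrow, Function.update_of_ne hz]) fun hzw => hz ?_
        exact (hX.envier_eq hzw).symm

end Cmd
end GraphEFX

/-! ### The improvement phase -/

namespace GraphEFX
namespace Cmd

variable {G : SimpleGraph (Fin n)} {v : Fin n → Set G.edgeSet → ℝ} {s : Mem}

/-- Nobody envies the agent. -/
def free (i : Expr) : Test := .eq (.get 7 (.const 0) i) i

theorem holds_free {I : LocalInstance} {X : ℕ → Set ℕ} {i : Expr} (hX : I.Oriented X)
    (hT : Tables I X s.arr) (hi : i.eval s < I.n) : (free i).Holds s ↔ I.Free X (i.eval s) := by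
  simp only [free, Test.holds_eq, Expr.eval_get, Expr.eval_const]
  rw [hT.envier _ hi, hX.envier_eq_iff]

/-- The condition for a release. -/
def releaseTest : Test :=
  .and (.not (free (.var 2))) (.and (free (.var 3)) (.and (.not (.nz 9 (.var 2) (.var 3)))
    (.or (.eq (.get 8 (.const 0) (.var 2)) (.var 3))
      (.and (.nz 5 (.var 3) (.var 2)) (.nz 12 (.var 3) (.var 3))))))

/-- The exchange of `IsRelease`, if possible for the agents in variables `2` and `3`. -/
def release : Cmd :=
  seq analyze (ite releaseTest
    (seq (setRow 10 (.const 0) (.or (.nz 6 (.var 2) (.var 20)) (.and (.eq (.var 20) (.var 3))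
      (.and (.nz 5 (.var 3) (.var 2)) (.nz 4 (.var 2) (.var 3))))))
    (seq (setRow 5 (.var 3) (.nz 6 (.var 3) (.var 20)))
    (seq (setRow 5 (.var 2) (.nz 10 (.const 0) (.var 20)))
    (shift (.var 2))))) skip)

theorem setOf_row {S : Set ℕ} {f : ℕ → ℕ} (h : ∀ k < n, f k ≠ 0 ↔ k ∈ S) (hS : ∀ k ∈ S, k < n) :
    {k | k < n ∧ f k ≠ 0} = S := by
  ext k
  exact ⟨fun h' => (h k h'.1).1 h'.2, fun h' => ⟨hS k h', (h k (hS k h')).2 h'⟩⟩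

theorem den_release (hG : IsMixedInstance G v) :
    Exchanges hG release (localInstance hG).Inv (localInstance hG).CanRelease
      (localInstance hG).IsRelease := by
  intro s h0 hl hw hk X hXs hX
  set I := localInstance hG
  set O := valueOracle G v
  set l := s.var 2
  set w := s.var 3
  subst hXs
  set X := bundles n s.arr
  have hT : Tables I X (analyze.den O s).arr := den_analyze hG h0 hk hX.toOriented
  simp only [release, den_seq]
  set s1 := analyze.den O s
  have h01 : s1.var 0 = n := (den_var (by decide) s).trans h0
  have hl1 : s1.var 2 = l := den_var (by decide) s
  have hw1 : s1.var 3 = w := den_var (by decide) s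
  have e5 : s1.arr 5 = s.arr 5 := den_arr (by decide) s
  have e4 : s1.arr 4 = s.arr 4 := den_arr (by decide) s
  have eX : bundles n s1.arr = X := congrArg (rows n) e5
  -- only the facts above matter about the memory, not how it was computed
  clear_value s1
  have hmem : ∀ i, ∀ k < n, s1.arr 5 i k ≠ 0 ↔ k ∈ X i := fun i k h => by rw [e5]; exact mem_bundles h
  have ht : releaseTest.Holds s1 ↔ I.CanRelease X l w := by
    simp only [releaseTest, Test.holds_and, Test.holds_not, Test.holds_or, Test.holds_nz,
      Test.holds_eq, Expr.eval_var, Expr.eval_get, Expr.eval_const]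
    rw [holds_free hX.toOriented hT (by rw [Expr.eval_var, hl1]; exact hl),
      holds_free hX.toOriented hT (by rw [Expr.eval_var, hw1]; exact hw)]
    simp only [Expr.eval_var, hl1, hw1]
    rw [hT.root l hl, hT.safe l hl w hw, hT.replace w hw w hw, hmem w l hl]
    rfl
  by_cases h : releaseTest.Holds s1
  swap
  · rw [den_ite_false h, den_skip]
    exact Or.inl ⟨eX, fun h' => h (ht.2 h')⟩
  refine Or.inr ⟨ht.1 h, ?_⟩
  rw [den_ite_true h]
  simp only [den_seq]
  set s2 := (setRow 10 (.const 0) (.or (.nz 6 (.var 2) (.var 20)) (.and (.eq (.var 20) (.var 3))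
    (.and (.nz 5 (.var 3) (.var 2)) (.nz 4 (.var 2) (.var 3)))))).den O s1 with hs2
  set s3 := (setRow 5 (.var 3) (.nz 6 (.var 3) (.var 20))).den O s2 with hs3
  set s4 := (setRow 5 (.var 2) (.nz 10 (.const 0) (.var 20))).den O s3 with hs4
  have h02 : s2.var 0 = n := (den_var (by decide) s1).trans h01
  have h03 : s3.var 0 = n := (den_var (by decide) s2).trans h02
  have h04 : s4.var 0 = n := (den_var (by decide) s3).trans h03
  have hl2 : s2.var 2 = l := (den_var (by decide) s1).trans hl1
  have hw2 : s2.var 3 = w := (den_var (by decide) s1).trans hw1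
  have hl3 : s3.var 2 = l := (den_var (by decide) s2).trans hl2
  have hl4 : s4.var 2 = l := (den_var (by decide) s3).trans hl3
  have hU : ∀ i < n, {z | z < n ∧ s1.arr 6 i z ≠ 0} = I.unheld X i := fun i hi =>
    setOf_row (hT.unheld i hi) fun k hk => (LocalInstance.good_lt hk.1).2
  have r2 : rows n (s2.arr 10) 0 = I.offer X l w := by
    have := rows_setRow (O := O) (s := s1) (a := 10) (r := .const 0)
      (t := .or (.nz 6 (.var 2) (.var 20)) (.and (.eq (.var 20) (.var 3))
      (.and (.nz 5 (.var 3) (.var 2)) (.nz 4 (.var 2) (.var 3))))) rfl (by decide) (by decide)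
      (by decide)
    rw [← hs2, h01] at this
    rw [this]
    simp only [Expr.eval_const, Function.update_self, Test.holds_and, Test.holds_or, Test.holds_nz,
      Test.holds_eq, Expr.eval_var, Mem.setVar_var, Mem.setVar_arr, if_true, and_or_left,
      show (2 : ℕ) ≠ 20 by decide, show (3 : ℕ) ≠ 20 by decide, if_false, hl1, hw1, hmem w l hl, e4,
      hk.good l hl w hw, Set.ofPred_or, hU l hl]
    ext k
    constructor
    · rintro (h | h)
      · exact Or.inl h
      · exact Or.inr h.2
    · rintro (h | ⟨rfl, h⟩)
      · exact Or.inl h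
      · exact Or.inr ⟨hw, rfl, h⟩
  have b2 : bundles n s2.arr = X :=
    (congrArg (rows n) (den_arr (by decide) s1 : s2.arr 5 = s1.arr 5)).trans eX
  have b3 : bundles n s3.arr = Function.update X w (I.unheld X w) := by
    rw [hs3, bundles_setRow h02 rfl (by decide) (by decide) (by decide), b2]
    have : s2.arr 6 = s1.arr 6 := den_arr (by decide) s1
    simp only [Expr.eval_var, Test.holds_nz, Mem.setVar_var, Mem.setVar_arr, if_true,
      show (3 : ℕ) ≠ 20 by decide, if_false, hw2, this, hU w hw]
  have b4 : bundles n s4.arr =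
      Function.update (Function.update X w (I.unheld X w)) l (I.offer X l w) := by
    rw [hs4, bundles_setRow h03 rfl (by decide) (by decide) (by decide), b3, ← r2]
    have : s3.arr 10 = s2.arr 10 := den_arr (by decide) s2
    simp only [Expr.eval_var, Test.holds_nz, Mem.setVar_var, Mem.setVar_arr, if_true,
      Expr.eval_const, hl3, this]
    rfl
  have e7 : s4.arr 7 = s1.arr 7 := ((den_arr (by decide) s3).trans (den_arr (by decide) s2)).trans
    (den_arr (by decide) s1)
  have := den_shift (O := O) (s := s4) (I := I) (l := .var 2) h04 hX
    (fun i hi => by rw [e7]; exact hT.envier i hi) (by rw [Expr.eval_var, hl4]; exact hl)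
  simp only [Expr.eval_var, hl4] at this
  rw [show I.n = n from rfl, b4] at this
  exact this

/-- The condition for `CanAbsorb`. -/
def absorbTest : Test :=
  .and (.nz 5 (.var 3) (.var 2)) (.and (.nz 4 (.var 2) (.var 3))
    (.and (.not (.nz 16 (.var 2) (.var 3))) (.and (free (.var 2)) (.nz 13 (.var 2) (.var 3)))))

/-- The agent in variable `2` takes all her unheld goods if she thereby stops envying the agent in
variable `3`. -/
def absorb : Cmd :=
  seq analyze (ite absorbTest
    (seq (setRow 10 (.const 0) (.or (.nz 5 (.var 2) (.var 20)) (.nz 6 (.var 2) (.var 20))))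
    (setRow 5 (.var 2) (.nz 10 (.const 0) (.var 20)))) skip)

theorem den_absorb (hG : IsMixedInstance G v) :
    Exchanges hG absorb (localInstance hG).Inv (localInstance hG).CanAbsorb
      fun X w _ X' => X' = Function.update X w (X w ∪ (localInstance hG).unheld X w) := by
  intro s h0 hw hi hk X hXs hX
  set I := localInstance hG
  set O := valueOracle G v
  set w := s.var 2
  set i := s.var 3
  subst hXs
  set X := bundles n s.arr
  have hT : Tables I X (analyze.den O s).arr := den_analyze hG h0 hk hX.toOriented
  simp only [absorb, den_seq]
  set s1 := analyze.den O s
  have h01 : s1.var 0 = n := (den_var (by decide) s).trans h0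
  have hw1 : s1.var 2 = w := den_var (by decide) s
  have hi1 : s1.var 3 = i := den_var (by decide) s
  have e5 : s1.arr 5 = s.arr 5 := den_arr (by decide) s
  have e4 : s1.arr 4 = s.arr 4 := den_arr (by decide) s
  have eX : bundles n s1.arr = X := congrArg (rows n) e5
  -- only the facts above matter about the memory, not how it was computed
  clear_value s1
  have hmem : ∀ i, ∀ k < n, s1.arr 5 i k ≠ 0 ↔ k ∈ X i := fun i k h => by rw [e5]; exact mem_bundles h
  have ht : absorbTest.Holds s1 ↔ I.CanAbsorb X w i := by
    simp only [absorbTest, Test.holds_and, Test.holds_not, Test.holds_nz, Expr.eval_var]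
    rw [holds_free hX.toOriented hT (by rw [Expr.eval_var, hw1]; exact hw)]
    simp only [Expr.eval_var, hw1, hi1]
    rw [hT.single w hw i hi, hT.absorb w hw i hi, hmem i w hw, e4, hk.good w hw i hi]
    simp only [LocalInstance.CanAbsorb, LocalInstance.Wants, not_le, and_assoc]
    rfl
  by_cases h : absorbTest.Holds s1
  swap
  · rw [den_ite_false h, den_skip]
    exact Or.inl ⟨eX, fun h' => h (ht.2 h')⟩
  refine Or.inr ⟨ht.1 h, ?_⟩
  rw [den_ite_true h]
  simp only [den_seq]
  set s2 := (setRow 10 (.const 0) (.or (.nz 5 (.var 2) (.var 20))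
    (.nz 6 (.var 2) (.var 20)))).den O s1 with hs2
  have h02 : s2.var 0 = n := (den_var (by decide) s1).trans h01
  have hw2 : s2.var 2 = w := (den_var (by decide) s1).trans hw1
  have hU : ∀ i < n, {z | z < n ∧ s1.arr 6 i z ≠ 0} = I.unheld X i := fun i hi =>
    setOf_row (hT.unheld i hi) fun k hk => (LocalInstance.good_lt hk.1).2
  have r2 : rows n (s2.arr 10) 0 = X w ∪ I.unheld X w := by
    have := rows_setRow (O := O) (s := s1) (a := 10) (r := .const 0)
      (t := .or (.nz 5 (.var 2) (.var 20)) (.nz 6 (.var 2) (.var 20))) rfl (by decide) (by decide)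
      (by decide)
    rw [← hs2, h01] at this
    rw [this]
    simp only [Expr.eval_const, Function.update_self, Test.holds_or, Test.holds_nz,
      Expr.eval_var, Mem.setVar_var, Mem.setVar_arr, if_true, and_or_left,
      show (2 : ℕ) ≠ 20 by decide, if_false, hw1, Set.ofPred_or, hU w hw, e5]
    rfl
  have b2 : bundles n s2.arr = X :=
    (congrArg (rows n) (den_arr (by decide) s1 : s2.arr 5 = s1.arr 5)).trans eX
  rw [bundles_setRow h02 rfl (by decide) (by decide) (by decide), b2, ← r2]
  simp only [Expr.eval_var, Test.holds_nz, Mem.setVar_var, Mem.setVar_arr, if_true,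
    Expr.eval_const, hw2]
  rfl

/-- All releases and absorptions that are possible. -/
def improve : Cmd := loop 1 (seq (loop 2 (loop 3 release)) (loop 2 (loop 3 absorb)))

theorem improve_ok : improve.ok = true := by decide

/-- Every pass that changes something reduces the number of envied agents, and a pass that changes
nothing leaves no exchange possible. -/
theorem den_improve (hG : IsMixedInstance G v) (hn : 0 < n) (h0 : s.var 0 = n)
    (hk : Kinds hG s.arr) (hX : (localInstance hG).Inv (bundles n s.arr))
    (hX' : ∀ i, (bundles n s.arr i).Subsingleton) :
    (localInstance hG).Stable (bundles n (improve.den (valueOracle G v) s).arr) := by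
  set O := valueOracle G v with hO
  set I := localInstance hG
  have key := den_loop (O := O) (s := s) (x := 1)
    (c := seq (loop 2 (loop 3 release)) (loop 2 (loop 3 absorb)))
    (fun p M => I.Stable (bundles n M) ∨ (I.Inv (bundles n M) ∧
      ((∀ i, (bundles n M i).Subsingleton) ∨ ∃ u, I.Clean (bundles n M) u) ∧
      (I.envied (bundles n M)).card + p < n)) improve_ok ?_ ?_
  · rw [h0] at key
    refine key.resolve_right fun h => ?_
    have := h.2.2
    omega
  · exact Or.inr ⟨hX, Or.inl hX', hX.card_envied_lt hn⟩
  intro p hp s1 hx1 hv1 ha1 ih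
  have h01 : s1.var 0 = n := (hv1 0 (by decide)).trans h0
  have hk1 : Kinds hG s1.arr := hk.congr (ha1 0 (by decide)) (ha1 4 (by decide)) (ha1 11 (by decide))
  have hI1 : I.Inv (bundles n s1.arr) := by
    rcases ih with h | h
    · exact h.toInv
    · exact h.1
  have hC1 : (∀ i, (bundles n s1.arr i).Subsingleton) ∨ ∃ u, I.Clean (bundles n s1.arr) u := by
    rcases ih with h | h
    · exact h.subsingleton_or_clean
    · exact h.2.1
  set X := bundles n s1.arr
  simp only [den_seq]
  let Q : (ℕ → Set ℕ) → Prop := fun Y => ¬ I.Stable X ∧ I.Inv Y ∧ (∃ u, I.Clean Y u) ∧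
    (I.envied Y).card < (I.envied X).card
  have hQ : ∀ Y, Q Y → I.Inv Y := fun Y h => h.2.1
  have hYI : ∀ Y, Y = X ∨ Q Y → I.Inv Y := by
    rintro Y (rfl | h)
    · exact hI1
    · exact h.2.1
  have hYc : ∀ Y, Y = X ∨ Q Y → (I.envied Y).card ≤ (I.envied X).card := by
    rintro Y (rfl | h)
    · exact le_rfl
    · exact h.2.2.2.le
  have hYs : ∀ Y, Y = X ∨ Q Y → ¬ I.Stable Y → ¬ I.Stable X := by
    rintro Y (rfl | h) h'
    · exact h'
    · exact h.1
  have hR : ∀ Y l w Z, Y = X ∨ Q Y → I.CanRelease Y l w → I.IsRelease Y l w Z → Q Z :=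
    fun Y l w Z hY hc hr => ⟨hYs Y hY fun h => h.not_release l w hc, hr.inv (hYI Y hY) hc,
      ⟨_, hr.clean (hYI Y hY) hc⟩, (hr.card_lt (hYI Y hY) hc).trans_le (hYc Y hY)⟩
  have hA : ∀ Y w i Z, Y = X ∨ Q Y → I.CanAbsorb Y w i →
      Z = Function.update Y w (Y w ∪ I.unheld Y w) → Q Z := by
    rintro Y w i Z hY hc rfl
    exact ⟨hYs Y hY fun h => h.not_absorb w i hc, hc.inv (hYI Y hY), ⟨_, hc.clean (hYI Y hY)⟩,
      (hc.card_lt (hYI Y hY)).trans_le (hYc Y hY)⟩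
  have sw1 := den_sweep hG (s := s1) (c := release) (by decide) (by decide) (den_release hG) (X := X)
    (Q := Q) hI1 hQ hR h01 hk1 (Or.inl rfl)
  rw [← hO] at sw1
  set s2 := (loop 2 (loop 3 release)).den O s1
  have h02 : s2.var 0 = n := (den_var (by decide) s1).trans h01
  have hk2 : Kinds hG s2.arr := hk1.congr (den_arr (by decide) s1) (den_arr (by decide) s1)
    (den_arr (by decide) s1)
  have hfin : ∀ Y, Q Y → I.Stable Y ∨ (I.Inv Y ∧ ((∀ i, (Y i).Subsingleton) ∨ ∃ u, I.Clean Y u) ∧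
      (I.envied Y).card + (p + 1) < n) := by
    intro Y hY
    rcases ih with h | h
    · exact absurd h hY.1
    · have h1 := h.2.2
      have h2 := hY.2.2.2
      exact Or.inr ⟨hY.2.1, Or.inr hY.2.2.1, by omega⟩
  rcases sw1 with ⟨hX2, hno⟩ | hQ2
  · have sw2 := den_sweep hG (s := s2) (c := absorb) (by decide) (by decide) (den_absorb hG) (X := X)
      (Q := Q) hI1 hQ hA h02 hk2 (Or.inl hX2)
    rw [← hO] at sw2
    rcases sw2 with ⟨h, hno'⟩ | h
    · rw [h]
      refine Or.inl ⟨hI1, hC1, fun l w hc => hno l ?_ w ?_ hc, fun w i hc => hno' w ?_ i ?_ hc⟩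
      · exact (LocalInstance.wants_envier hc.1).lt_n.2
      · rcases hc.2.2.2 with h | h
        · rw [← h]; exact LocalInstance.root_lt (LocalInstance.wants_envier hc.1).lt_n.2
        · exact (LocalInstance.good_lt (hI1.sub w h.1)).1
      · exact hc.1.lt_n.1
      · exact hc.1.lt_n.2
    · exact hfin _ h
  · have sw2 := den_sweep hG (s := s2) (c := absorb) (by decide) (by decide) (den_absorb hG)
      (X := bundles n s2.arr) (Q := Q) (hQ _ hQ2) hQ
      (fun Y w i Z hY => hA Y w i Z (Or.inr (hY.elim (fun h => h ▸ hQ2) id))) h02 hk2 (Or.inl rfl)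
    rw [← hO] at sw2
    rcases sw2 with ⟨h, -⟩ | h
    · rw [h]; exact hfin _ hQ2
    · exact hfin _ h

end Cmd
end GraphEFX

/-! ### Items without a receiver, and the final distribution -/

namespace GraphEFX
namespace Cmd

variable {G : SimpleGraph (Fin n)} {v : Fin n → Set G.edgeSet → ℝ} {s : Mem}

/-- Entry `[0, 0]` of array `15` tells whether the test holds for some value of variable `12`. -/
def search (t : Test) : Cmd :=
  seq (store 15 (.const 0) (.const 0) (.const 0))
    (loop 12 (ite t (store 15 (.const 0) (.const 0) (.const 1)) skip))

theorem den_search {O : ℕ → (ℕ → ℕ → ℕ) → ℝ} {t : Test} (ht : t.isNat = true)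
    (hta : 15 ∉ t.arrs) : ((search t).den O s).arr 15 0 0 ≠ 0 ↔
      ∃ k < s.var 0, t.Holds (s.setVar 12 k) := by
  simp only [search, den_seq]
  set s1 := (store 15 (.const 0) (.const 0) (.const 0)).den O s with hs1
  refine den_loop (O := O) (s := s1) (x := 12)
    (c := ite t (store 15 (.const 0) (.const 0) (.const 1)) skip)
    (fun m M => M 15 0 0 ≠ 0 ↔ ∃ k < m, t.Holds (s.setVar 12 k)) rfl ?_ ?_
  · simp [hs1, den, Mem.setArr]
  intro m hm s2 hx hv ha ih
  have ht' : t.Holds s2 ↔ t.Holds (s.setVar 12 m) := by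
    refine Test.holds_congr ht (fun y _ => ?_) fun b hb => ?_
    · by_cases hy : y = 12
      · subst hy; simp [hx]
      · simp only [Mem.setVar_var, hy, if_false]
        exact hv y (by simpa [vars] using hy)
    · have hb : b ≠ 15 := fun h => hta (h ▸ hb)
      exact (ha b (by simpa [arrs] using hb)).trans (den_arr (by simpa [arrs] using hb) s)
  by_cases h : t.Holds s2
  · rw [den_ite_true h]
    refine iff_of_true (by simp [den, Mem.setArr]) ⟨m, by omega, ht'.1 h⟩
  · rw [den_ite_false h, den_skip, ih]
    constructor
    · rintro ⟨k, hk, h'⟩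
      exact ⟨k, by omega, h'⟩
    · rintro ⟨k, hk, h'⟩
      rcases Nat.lt_succ_iff_lt_or_eq.1 hk with hk | rfl
      · exact ⟨k, hk, h'⟩
      · exact absurd (ht'.2 h') h

/-- The agent in variable `12` is free, and safe for the agents in variables `2` and `3`. -/
def safeTest : Test := .and (free (.var 12)) (.and (.nz 9 (.var 2) (.var 12)) (.nz 9 (.var 3) (.var 12)))

/-- The condition `Trouble`. -/
def troubleTest : Test :=
  .and (.nz 6 (.var 2) (.var 3)) (.and (.nz 6 (.var 3) (.var 2)) (.and (.not (free (.var 2)))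
    (.and (.not (free (.var 3))) (.not (.nz 15 (.const 0) (.const 0))))))

/-- Variable `20` is in the pool of `x` and `y`. -/
def poolTest (x y : ℕ) : Test :=
  .or (.nz 6 (.var x) (.var 20)) (.eq (.var 20) (.get 8 (.const 0) (.var y)))

/-- The exchange of `IsSwap`, if the item between the agents in variables `2` and `3` needs it. -/
def swap : Cmd :=
  seq analyze (seq (search safeTest) (ite troubleTest
    (seq (shift (.var 2)) (seq (shift (.var 3))
      (ite (.nz 17 (.var 2) (.var 3))
        (seq (setRow 5 (.var 2) (.and (poolTest 2 3) (.not (.eq (.var 20) (.var 3)))))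
          (setRow 5 (.var 3) (poolTest 3 2)))
        (seq (setRow 5 (.var 2) (.eq (.var 20) (.var 3)))
          (setRow 5 (.var 3) (.and (poolTest 3 2) (.not (.eq (.var 20) (.var 2)))))))))
    skip))

theorem den_swap (hG : IsMixedInstance G v) :
    Exchanges hG swap (fun X => (localInstance hG).Stable X ∨ (localInstance hG).Completable X)
      (localInstance hG).Trouble (localInstance hG).IsSwap := by
  intro s h0 hx hy hk X hXs hXR
  set I := localInstance hG
  set O := valueOracle G v
  set x := s.var 2
  set y := s.var 3
  subst hXs
  set X := bundles n s.arr
  have hXO : I.Oriented X := by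
    rcases hXR with h | h
    · exact h.toOriented
    · exact h.toOriented
  have hT : Tables I X (analyze.den O s).arr := den_analyze hG h0 hk hXO
  simp only [swap, den_seq]
  set s1 := analyze.den O s
  have h01 : s1.var 0 = n := (den_var (by decide) s).trans h0
  have hx1 : s1.var 2 = x := den_var (by decide) s
  have hy1 : s1.var 3 = y := den_var (by decide) s
  have e5 : s1.arr 5 = s.arr 5 := den_arr (by decide) s
  have eX : bundles n s1.arr = X := congrArg (rows n) e5
  -- only the facts above matter about the memory, not how it was computed
  clear_value s1
  have h15 : ((search safeTest).den O s1).arr 15 0 0 ≠ 0 ↔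
      ∃ k < n, I.Free X k ∧ I.Safe X x k ∧ I.Safe X y k := by
    rw [den_search rfl (by decide), h01]
    refine exists_congr fun k => and_congr_right fun hkn => ?_
    simp only [safeTest, Test.holds_and]
    rw [holds_free (s := s1.setVar 12 k) hXO (i := .var 12) hT hkn]
    simp only [Test.holds_nz, Expr.eval_var, Mem.setVar_var, Mem.setVar_arr, if_true,
      show (2 : ℕ) ≠ 12 by decide, show (3 : ℕ) ≠ 12 by decide, if_false, hx1, hy1]
    rw [hT.safe x hx k hkn, hT.safe y hy k hkn]
  set s2 := (search safeTest).den O s1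
  have h02 : s2.var 0 = n := (den_var (by decide) s1).trans h01
  have hx2 : s2.var 2 = x := (den_var (by decide) s1).trans hx1
  have hy2 : s2.var 3 = y := (den_var (by decide) s1).trans hy1
  have eX2 : bundles n s2.arr = X :=
    (congrArg (rows n) (den_arr (by decide) s1 : s2.arr 5 = s1.arr 5)).trans eX
  have a6 : s2.arr 6 = s1.arr 6 := den_arr (by decide) s1
  have a7 : s2.arr 7 = s1.arr 7 := den_arr (by decide) s1
  have a8 : s2.arr 8 = s1.arr 8 := den_arr (by decide) s1
  have a17 : s2.arr 17 = s1.arr 17 := den_arr (by decide) s1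
  clear_value s2
  have hfree : ∀ i < n, s2.arr 7 0 i = i ↔ I.Free X i := fun i hi => by
    rw [a7, hT.envier i hi, hXO.envier_eq_iff]
  have ht : troubleTest.Holds s2 ↔ I.Trouble X x y := by
    simp only [troubleTest, free, Test.holds_and, Test.holds_not, Test.holds_nz, Test.holds_eq,
      Expr.eval_var, Expr.eval_get, Expr.eval_const, hx2, hy2, hfree x hx, hfree y hy, h15, a6]
    rw [hT.unheld x hx y hy, hT.unheld y hy x hx]
    simp only [LocalInstance.Trouble, not_exists, not_and]
    rfl
  by_cases h : troubleTest.Holds s2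
  swap
  · rw [den_ite_false h, den_skip]
    exact Or.inl ⟨eX2, fun h' => h (ht.2 h')⟩
  have hTr := ht.1 h
  refine Or.inr ⟨hTr, ?_⟩
  have hXS : I.Stable X := by
    rcases hXR with h | h
    · exact h
    · exact absurd hTr (h.not_trouble x y)
  rw [den_ite_true h]
  simp only [den_seq]
  have sh1 := den_shift (O := O) (s := s2) (I := I) (X := X) (l := .var 2) h02 hXS.toInv
    (fun i hi => by rw [a7]; exact hT.envier i hi) (by rw [Expr.eval_var, hx2]; exact hx)
  set s3 := (shift (.var 2)).den O s2
  have h03 : s3.var 0 = n := (den_var (by decide) s2).trans h02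
  have hx3 : s3.var 2 = x := (den_var (by decide) s2).trans hx2
  have hy3 : s3.var 3 = y := (den_var (by decide) s2).trans hy2
  have b6 : s3.arr 6 = s1.arr 6 := (den_arr (by decide) s2).trans a6
  have b7 : s3.arr 7 = s1.arr 7 := (den_arr (by decide) s2).trans a7
  have b8 : s3.arr 8 = s1.arr 8 := (den_arr (by decide) s2).trans a8
  have b17 : s3.arr 17 = s1.arr 17 := (den_arr (by decide) s2).trans a17
  clear_value s3
  have sh2 := den_shift (O := O) (s := s3) (I := I) (X := X) (l := .var 3) h03 hXS.toInv
    (fun i hi => by rw [b7]; exact hT.envier i hi) (by rw [Expr.eval_var, hy3]; exact hy)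
  set s4 := (shift (.var 3)).den O s3
  have h04 : s4.var 0 = n := (den_var (by decide) s3).trans h03
  have hx4 : s4.var 2 = x := (den_var (by decide) s3).trans hx3
  have hy4 : s4.var 3 = y := (den_var (by decide) s3).trans hy3
  have c6 : s4.arr 6 = s1.arr 6 := (den_arr (by decide) s3).trans b6
  have c8 : s4.arr 8 = s1.arr 8 := (den_arr (by decide) s3).trans b8
  have c17 : s4.arr 17 = s1.arr 17 := (den_arr (by decide) s3).trans b17
  clear_value s4
  rw [Expr.eval_var, hx2, show I.n = n from rfl, eX2] at sh1
  rw [Expr.eval_var, hy3, show I.n = n from rfl] at sh2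
  refine ⟨_, _, sh1, sh2, ?_⟩
  have hpool : ∀ i < n, ∀ k < n, {z | z < n ∧ (s1.arr 6 i z ≠ 0 ∨ z = s1.arr 8 0 k)} = I.pool X i k := by
    intro i hi k hkn
    ext z
    rw [hT.root k hkn]
    constructor
    · rintro ⟨h, h' | h'⟩
      · exact Or.inl ((hT.unheld i hi z h).1 h')
      · exact Or.inr h'
    · rintro (h | rfl)
      · have hz := (LocalInstance.good_lt h.1).2
        exact ⟨hz, Or.inl ((hT.unheld i hi z hz).2 h)⟩
      · exact ⟨LocalInstance.root_lt hkn, Or.inr rfl⟩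
  have hpool' : ∀ i < n, ∀ k < n, {z | z < n ∧ (s1.arr 6 i z ≠ 0 ∨ z = s1.arr 8 0 k) ∧ ¬ z = k} =
      I.pool X i k \ {k} := by
    intro i hi k hkn
    rw [← hpool i hi k hkn]
    ext z
    simp [and_assoc]
  have hxy : x ≠ y := hTr.ne
  by_cases h17 : (Test.nz 17 (.var 2) (.var 3)).Holds s4
  · rw [den_ite_true h17, den_seq]
    set s5 := (setRow 5 (.var 2) (.and (poolTest 2 3) (.not (.eq (.var 20) (.var 3))))).den O s4
      with hs5
    have h05 : s5.var 0 = n := (den_var (by decide) s4).trans h04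
    have hx5 : s5.var 2 = x := (den_var (by decide) s4).trans hx4
    have hy5 : s5.var 3 = y := (den_var (by decide) s4).trans hy4
    have d6 : s5.arr 6 = s1.arr 6 := (den_arr (by decide) s4).trans c6
    have d8 : s5.arr 8 = s1.arr 8 := (den_arr (by decide) s4).trans c8
    have r5 : bundles n s5.arr = Function.update (bundles n s4.arr) x (I.pool X x y \ {y}) := by
      rw [hs5, bundles_setRow h04 rfl (by decide) (by decide) (by decide), ← hpool' x hx y hy]
      simp [poolTest, hx4, hy4, c6, c8]
    clear_value s5
    have r6 : bundles n ((setRow 5 (.var 3) (poolTest 3 2)).den O s5).arr =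
        Function.update (bundles n s5.arr) y (I.pool X y x) := by
      rw [bundles_setRow h05 rfl (by decide) (by decide) (by decide), ← hpool y hy x hx]
      simp [poolTest, hx5, hy5, d6, d8]
    rw [r6, r5]
    refine ⟨fun z hzx hzy => by rw [Function.update_of_ne hzy, Function.update_of_ne hzx],
      Or.inl ⟨?_, ?_, Function.update_self ..⟩⟩
    · rw [Test.holds_nz, Expr.eval_var, Expr.eval_var, hx4, hy4, c17] at h17
      exact (hT.pool x hx y hy).1 h17
    · rw [Function.update_of_ne hxy, Function.update_self]
  · rw [den_ite_false h17, den_seq]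
    set s5 := (setRow 5 (.var 2) (.eq (.var 20) (.var 3))).den O s4 with hs5
    have h05 : s5.var 0 = n := (den_var (by decide) s4).trans h04
    have hx5 : s5.var 2 = x := (den_var (by decide) s4).trans hx4
    have hy5 : s5.var 3 = y := (den_var (by decide) s4).trans hy4
    have d6 : s5.arr 6 = s1.arr 6 := (den_arr (by decide) s4).trans c6
    have d8 : s5.arr 8 = s1.arr 8 := (den_arr (by decide) s4).trans c8
    have r5 : bundles n s5.arr = Function.update (bundles n s4.arr) x {y} := by
      rw [hs5, bundles_setRow h04 rfl (by decide) (by decide) (by decide), ← setOf_lt_and_eq hy]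
      simp [hx4, hy4]
    clear_value s5
    have r6 : bundles n ((setRow 5 (.var 3) (.and (poolTest 3 2)
        (.not (.eq (.var 20) (.var 2))))).den O s5).arr =
        Function.update (bundles n s5.arr) y (I.pool X y x \ {x}) := by
      rw [bundles_setRow h05 rfl (by decide) (by decide) (by decide), ← hpool' y hy x hx]
      simp [poolTest, hx5, hy5, d6, d8]
    rw [r6, r5]
    refine ⟨fun z hzx hzy => by rw [Function.update_of_ne hzy, Function.update_of_ne hzx],
      Or.inr ⟨?_, ?_, Function.update_self ..⟩⟩
    · rw [Test.holds_nz, Expr.eval_var, Expr.eval_var, hx4, hy4, c17, hT.pool x hx y hy] at h17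
      exact not_le.1 h17
    · rw [Function.update_of_ne hxy, Function.update_self]

/-- Looks at all pairs of agents. After the first swap, every item has a receiver. -/
def settle : Cmd := loop 2 (loop 3 swap)

theorem den_settle (hG : IsMixedInstance G v) (hn : 2 < n) (h0 : s.var 0 = n)
    (hk : Kinds hG s.arr) (hX : (localInstance hG).Stable (bundles n s.arr)) :
    (localInstance hG).Completable (bundles n (settle.den (valueOracle G v) s).arr) := by
  set I := localInstance hG
  have hS : ∀ Y x y Z, Y = bundles n s.arr ∨ I.Completable Y → I.Trouble Y x y →
      I.IsSwap Y x y Z → I.Completable Z := by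
    rintro Y x y Z (rfl | hY) hT hS
    · exact hS.completable hX hT
    · exact absurd hT (hY.not_trouble x y)
  rcases den_sweep hG (s := s) (c := swap) (by decide) (by decide) (den_swap hG)
    (X := bundles n s.arr) (Q := I.Completable) (Or.inl hX) (fun Y h => Or.inr h) hS h0 hk
    (Or.inl rfl) with ⟨h1, h2⟩ | h
  · rw [settle, h1]
    refine hX.completable (fun x y hT => h2 x ?_ y ?_ hT) hn
    · exact (LocalInstance.good_lt hT.1.1).1
    · exact (LocalInstance.good_lt hT.1.1).2
  · exact h

/-- The agent in variable `i` envies the agent in variable `4`. -/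
def wantsTest (i : ℕ) : Test :=
  .and (.nz 5 (.var 4) (.var i)) (.and (.nz 4 (.var i) (.var 4)) (.not (.nz 16 (.var i) (.var 4))))

/-- The agent in variable `4` is a receiver for the item between the agents in variables `2` and
`3`. -/
def receiverTest : Test :=
  .or (.and (.eq (.var 4) (.var 2)) (.and (free (.var 4)) (.not (.nz 11 (.var 2) (.var 3)))))
  (.or (.and (.eq (.var 4) (.var 3)) (.and (free (.var 4)) (.not (.nz 11 (.var 3) (.var 2)))))
  (.or (.and (.not (.eq (.var 4) (.var 2))) (.and (.not (.eq (.var 4) (.var 3)))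
    (.and (free (.var 4)) (.and (.or (.not (.nz 4 (.var 2) (.var 3))) (.nz 9 (.var 2) (.var 4)))
      (.or (.not (.nz 4 (.var 3) (.var 2))) (.nz 9 (.var 3) (.var 4)))))))
  (.or (.and (wantsTest 2) (.nz 11 (.var 2) (.var 3)))
    (.and (wantsTest 3) (.nz 11 (.var 3) (.var 2))))))

theorem holds_receiverTest (hG : IsMixedInstance G v) {X : ℕ → Set ℕ}
    (hX : (localInstance hG).Oriented X) (hk : Kinds hG s.arr) (hb : bundles n s.arr = X)
    (hT : Tables (localInstance hG) X s.arr) (h2 : s.var 2 < n) (h3 : s.var 3 < n)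
    (h4 : s.var 4 < n) :
    receiverTest.Holds s ↔ (localInstance hG).Receiver X (s.var 4) (s.var 2) (s.var 3) := by
  set I := localInstance hG
  subst hb
  have hw : ∀ i, s.var i < n →
      ((wantsTest i).Holds s ↔ I.Wants (bundles n s.arr) (s.var i) (s.var 4)) := by
    intro i hi
    simp only [wantsTest, Test.holds_and, Test.holds_nz, Test.holds_not, Expr.eval_var]
    rw [mem_bundles hi, hk.good _ hi _ h4, hT.single _ hi _ h4, not_le]
    rfl
  simp only [receiverTest, Test.holds_or, Test.holds_and, hw 2 h2, hw 3 h3,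
    holds_free (i := .var 4) hX hT h4, Test.holds_not, Test.holds_nz, Test.holds_eq, Expr.eval_var,
    hk.good _ h2 _ h3, hk.good _ h3 _ h2, hk.chore _ h2 _ h3, hk.chore _ h3 _ h2,
    hT.safe _ h2 _ h4, hT.safe _ h3 _ h4, ← imp_iff_not_or]
  rfl

/-- Every held item goes to its holder, and every other item to a receiver. In array `18`, the two
entries for an item may name different receivers. -/
def distribute : Cmd :=
  seq analyze (seq
    (loop 2 (loop 3 (ite (.nz 5 (.var 2) (.var 3)) (store 18 (.var 2) (.var 3) (.var 2))
      (ite (.nz 5 (.var 3) (.var 2)) (store 18 (.var 2) (.var 3) (.var 3))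
        (loop 4 (ite receiverTest (store 18 (.var 2) (.var 3) (.var 4)) skip))))))
    (loop 2 (loop 3 (ite (.le (.var 2) (.var 3))
      (store 1 (.var 2) (.var 3) (.get 18 (.var 2) (.var 3)))
      (store 1 (.var 2) (.var 3) (.get 18 (.var 3) (.var 2)))))))

theorem den_distribute (hG : IsMixedInstance G v) (h0 : s.var 0 = n) (hk : Kinds hG s.arr)
    (hX : (localInstance hG).Completable (bundles n s.arr)) :
    Completes hG (bundles n s.arr) ((distribute.den (valueOracle G v) s).arr 1) := by
  set I := localInstance hG
  set O := valueOracle G v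
  set X := bundles n s.arr
  have hT : Tables I X (analyze.den O s).arr := den_analyze hG h0 hk hX.toOriented
  simp only [distribute, den_seq]
  set s1 := analyze.den O s
  have h01 : s1.var 0 = n := (den_var (by decide) s).trans h0
  have e5 : s1.arr 5 = s.arr 5 := den_arr (by decide) s
  have hk1 : Kinds hG s1.arr :=
    hk.congr (den_arr (by decide) s) (den_arr (by decide) s) (den_arr (by decide) s)
  have eX : bundles n s1.arr = X := congrArg (rows n) e5
  -- only the facts above matter about the memory, not how it was computed
  clear_value s1
  let P : ℕ → ℕ → ℕ → Prop := fun a b m => LocalAdj G a b → m < n ∧ (b ∈ X a → m = a) ∧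
    (a ∈ X b → m = b) ∧ (b ∉ X a → a ∉ X b → I.Receiver X m a b)
  have hPs : ∀ {a b m}, P a b m → P b a m := fun h hab =>
    have h := h (localAdj_symm hab)
    ⟨h.1, h.2.2.1, h.2.1, fun h1 h2 => (h.2.2.2 h2 h1).symm⟩
  have h18 := den_table (O := O) (s := s1) 18 P (x := 2) (y := 3)
    (c := ite (.nz 5 (.var 2) (.var 3)) (store 18 (.var 2) (.var 3) (.var 2))
      (ite (.nz 5 (.var 3) (.var 2)) (store 18 (.var 2) (.var 3) (.var 3))
        (loop 4 (ite receiverTest (store 18 (.var 2) (.var 3) (.var 4)) skip)))) rfl ?_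
  swap
  · intro a ha b hb s2 hx hy hv hs
    rw [h01] at ha hb
    have h02 : s2.var 0 = n := (hv 0 (by decide)).trans h01
    have hk2 : Kinds hG s2.arr := hk1.congr (hs 0 (by decide)) (hs 4 (by decide)) (hs 11 (by decide))
    have e52 : s2.arr 5 = s1.arr 5 := hs 5 (by decide)
    have eX2 : bundles n s2.arr = X := (congrArg (rows n) e52).trans eX
    have hstore : ∀ (e : Expr) (s3 : Mem), s3.var 2 = a → s3.var 3 = b → ∀ j l, j ≠ a ∨ l ≠ b →
        ((store 18 (.var 2) (.var 3) e).den O s3).arr 18 j l = s3.arr 18 j l := by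
      intro e s3 hx hy j l hjl
      simp only [den, Mem.setArr, Expr.eval_var, hx, hy, true_and]
      rw [if_neg (by omega)]
    have hself : ∀ (e : Expr) (s3 : Mem), s3.var 2 = a → s3.var 3 = b →
        ((store 18 (.var 2) (.var 3) e).den O s3).arr 18 a b = e.eval s3 := by
      intro e s3 hx hy
      simp [den, Mem.setArr, hx, hy]
    have m1 : (Test.nz 5 (.var 2) (.var 3)).Holds s2 ↔ b ∈ X a := by
      rw [Test.holds_nz, Expr.eval_var, Expr.eval_var, hx, hy, mem_bundles hb, eX2]
    have m2 : (Test.nz 5 (.var 3) (.var 2)).Holds s2 ↔ a ∈ X b := by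
      rw [Test.holds_nz, Expr.eval_var, Expr.eval_var, hx, hy, mem_bundles ha, eX2]
    by_cases h1 : b ∈ X a
    · rw [den_ite_true (m1.2 h1)]
      refine ⟨?_, hstore _ s2 hx hy⟩
      rw [hself _ s2 hx hy, Expr.eval_var, hx]
      exact fun _ => ⟨ha, fun _ => rfl, fun h => absurd h (hX.disj h1), fun h => absurd h1 h⟩
    rw [den_ite_false (fun h => h1 (m1.1 h))]
    by_cases h2 : a ∈ X b
    · rw [den_ite_true (m2.2 h2)]
      refine ⟨?_, hstore _ s2 hx hy⟩
      rw [hself _ s2 hx hy, Expr.eval_var, hy]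
      exact fun _ => ⟨hb, fun h => absurd h h1, fun _ => rfl, fun _ h => absurd h2 h⟩
    rw [den_ite_false (fun h => h2 (m2.1 h))]
    have key := den_loop (O := O) (s := s2) (x := 4)
      (c := ite receiverTest (store 18 (.var 2) (.var 3) (.var 4)) skip)
      (fun m M => ((∃ w < m, I.Receiver X w a b) → M 18 a b < n ∧ I.Receiver X (M 18 a b) a b) ∧
        ∀ j l, j ≠ a ∨ l ≠ b → M 18 j l = s2.arr 18 j l) rfl
      ⟨fun ⟨w, hw, _⟩ => absurd hw (Nat.not_lt_zero w), fun _ _ _ => rfl⟩ ?_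
    · rw [h02] at key
      refine ⟨fun hab => ?_, key.2⟩
      have := key.1 (hX.receiver hab h1 h2)
      exact ⟨this.1, fun h => absurd h h1, fun h => absurd h h2, fun _ _ => this.2⟩
    intro m hm s3 hx3 hv3 ha3 ih
    have hx3' : s3.var 2 = a := (hv3 2 (by decide)).trans hx
    have hy3 : s3.var 3 = b := (hv3 3 (by decide)).trans hy
    have hk3 : Kinds hG s3.arr :=
      hk2.congr (ha3 0 (by decide)) (ha3 4 (by decide)) (ha3 11 (by decide))
    have eX3 : bundles n s3.arr = X := (congrArg (rows n) (ha3 5 (by decide))).trans eX2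
    have e3 : ∀ d, d ≠ 18 → s3.arr d = s1.arr d := fun d hd =>
      (ha3 d (by simpa [arrs] using hd)).trans (hs d (by simpa [arrs] using hd))
    have hT3 : Tables I X s3.arr := by
      constructor
      · rw [e3 6 (by decide)]; exact hT.unheld
      · rw [e3 7 (by decide)]; exact hT.envier
      · rw [e3 8 (by decide)]; exact hT.root
      · rw [e3 9 (by decide)]; exact hT.safe
      · rw [e3 12 (by decide)]; exact hT.replace
      · rw [e3 13 (by decide)]; exact hT.absorb
      · rw [e3 16 (by decide)]; exact hT.single
      · rw [e3 17 (by decide)]; exact hT.pool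
    have ht := holds_receiverTest hG hX.toOriented hk3 eX3 hT3 (by omega) (by omega) (by omega)
    rw [hx3, hx3', hy3] at ht
    by_cases h : receiverTest.Holds s3
    · rw [den_ite_true h]
      refine ⟨fun _ => ?_, fun j l hjl => ?_⟩
      · rw [hself _ s3 hx3' hy3, Expr.eval_var, hx3]
        exact ⟨by omega, ht.1 h⟩
      · rw [hstore _ s3 hx3' hy3 j l hjl]
        exact ih.2 j l hjl
    · rw [den_ite_false h, den_skip]
      refine ⟨fun ⟨w, hw, hr⟩ => ih.1 ?_, ih.2⟩
      rcases Nat.lt_succ_iff_lt_or_eq.1 hw with hw | rfl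
      · exact ⟨w, hw, hr⟩
      · exact absurd (ht.2 hr) h
  set s2 := (loop 2 (loop 3 (ite (.nz 5 (.var 2) (.var 3)) (store 18 (.var 2) (.var 3) (.var 2))
      (ite (.nz 5 (.var 3) (.var 2)) (store 18 (.var 2) (.var 3) (.var 3))
        (loop 4 (ite receiverTest (store 18 (.var 2) (.var 3) (.var 4)) skip)))))).den O s1
  have h02 : s2.var 0 = n := (den_var (by decide) s1).trans h01
  clear_value s2
  rw [h01] at h18
  have h1 := den_table (O := O) (s := s2) 1
    (fun a b m => m = if a ≤ b then s2.arr 18 a b else s2.arr 18 b a) (x := 2) (y := 3)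
    (c := ite (.le (.var 2) (.var 3))
      (store 1 (.var 2) (.var 3) (.get 18 (.var 2) (.var 3)))
      (store 1 (.var 2) (.var 3) (.get 18 (.var 3) (.var 2)))) rfl ?_
  swap
  · intro a ha b hb s3 hx hy hv hs
    have e18 : s3.arr 18 = s2.arr 18 := hs 18 (by decide)
    by_cases h : (Test.le (.var 2) (.var 3)).Holds s3
    · have h' : a ≤ b := by simpa [hx, hy] using h
      rw [den_ite_true h, if_pos h']
      refine ⟨by simp [den, Mem.setArr, hx, hy, e18], fun j l hjl => ?_⟩
      simp only [den, Mem.setArr, Expr.eval_var, hx, hy, true_and]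
      rw [if_neg (by omega)]
    · have h' : ¬ a ≤ b := by simpa [hx, hy] using h
      rw [den_ite_false h, if_neg h']
      refine ⟨by simp [den, Mem.setArr, hx, hy, e18], fun j l hjl => ?_⟩
      simp only [den, Mem.setArr, Expr.eval_var, hx, hy, true_and]
      rw [if_neg (by omega)]
  rw [h02] at h1
  intro a b hab
  have hab' : LocalAdj G a b := ⟨a.2, b.2, hab⟩
  have hne : (a : ℕ) ≠ b := fun h => G.loopless.irrefl _ (by rw [Fin.ext h] at hab; exact hab)
  have hA := h1 a a.2 b b.2
  have hB := h1 b b.2 a a.2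
  have hP : P a b (if (a : ℕ) ≤ b then s2.arr 18 a b else s2.arr 18 b a) := by
    split_ifs with h
    · exact h18 a a.2 b b.2
    · exact hPs (h18 b b.2 a a.2)
  have hP := hP hab'
  rw [← hA] at hP
  refine ⟨?_, hP.1, hP.2.1, hP.2.2.2⟩
  rw [hA, hB]
  rcases hne.lt_or_gt with h | h
  · rw [if_pos h.le, if_neg (by omega)]
  · rw [if_neg (by omega), if_pos h.le]

/-- The algorithm for at least three agents. -/
def main : Cmd := seq kinds (seq serial (seq improve (seq settle distribute)))

theorem main_ok : main.ok = true := rfl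

theorem den_main (hG : IsMixedInstance G v) (hn : 2 < n) :
    IsAllocation (outputBundles G (main.den (valueOracle G v) (inputMem G))) ∧
      IsEFXZeroMinus v (outputBundles G (main.den (valueOracle G v) (inputMem G))) := by
  set I := localInstance hG
  set O := valueOracle G v with hO
  set s := inputMem G with hs
  have h0 : s.var 0 = n := rfl
  simp only [main, den_seq]
  have hk : Kinds hG (kinds.den O s).arr := den_kinds hG h0 (by
    intro i hi k hk
    simp only [hs, inputMem, true_and, LocalAdj]
    split_ifs with h
    · exact iff_of_true one_ne_zero h.2
    · exact iff_of_false (fun h => h rfl) fun h' => h ⟨rfl, h'⟩)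
  set s1 := kinds.den O s
  have h01 : s1.var 0 = n := (den_var (by decide) s).trans h0
  have e5 : s1.arr 5 = s.arr 5 := den_arr (by decide) s
  have hX1 : ∀ i, bundles n s1.arr i = ∅ := by
    intro i
    ext k
    simp [bundles, rows, e5, hs, inputMem]
  -- only the facts above matter about the memory, not how it was computed
  clear_value s1
  have hP := den_serial hG h01 hk hX1
  rw [← hO] at hP
  set s2 := serial.den O s1
  have h02 : s2.var 0 = n := (den_var (by decide) s1).trans h01
  have hk2 : Kinds hG s2.arr :=
    hk.congr (den_arr (by decide) s1) (den_arr (by decide) s1) (den_arr (by decide) s1)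
  clear_value s2
  have hS := den_improve hG (by omega) h02 hk2 hP.inv hP.subsingleton
  rw [← hO] at hS
  set s3 := improve.den O s2
  have h03 : s3.var 0 = n := (den_var (by decide) s2).trans h02
  have hk3 : Kinds hG s3.arr :=
    hk2.congr (den_arr (by decide) s2) (den_arr (by decide) s2) (den_arr (by decide) s2)
  clear_value s3
  have hC := den_settle hG hn h03 hk3 hS
  rw [← hO] at hC
  set s4 := settle.den O s3
  have h04 : s4.var 0 = n := (den_var (by decide) s3).trans h03
  have hk4 : Kinds hG s4.arr :=
    hk3.congr (den_arr (by decide) s3) (den_arr (by decide) s3) (den_arr (by decide) s3)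
  clear_value s4
  have hA := den_distribute hG h04 hk4 hC
  rw [← hO] at hA
  exact ⟨isAllocation_tableBundles fun a b h => ⟨(hA a b h).1, (hA a b h).2.1⟩,
    isEFXZeroMinus_tableBundles hC hA⟩

end Cmd

theorem exists_program : ∃ (P : Prog) (p : Polynomial ℕ),
    ∀ (n : ℕ) (G : SimpleGraph (Fin n)) (v : Fin n → Set G.edgeSet → ℝ),
      IsMixedInstance G v → ∃ (s : Mem) (t : ℕ), Exec (valueOracle G v) P (inputMem G) s t ∧
        t ≤ p.eval n ∧ IsAllocation (outputBundles G s) ∧ IsEFXZeroMinus v (outputBundles G s) := by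
  refine ⟨.ite (.le (.var 0) (.const 2)) .skip Cmd.main.prog, Cmd.main.cost + .C 4, ?_⟩
  intro n G v hG
  by_cases hn : n ≤ 2
  · -- all items go to agent `0`
    have hA : IsAllocation (outputBundles G (inputMem G)) := by
      refine isAllocation_tableBundles (A := (inputMem G).arr 1) fun a b _ => ?_
      simp only [inputMem, one_ne_zero, false_and, if_false, true_and]
      exact (Nat.zero_le _).trans_lt a.2
    exact ⟨_, _, Exec.ite_true hn (Exec.skip _), by
      simp [Test.cost, Expr.cost], hA, isEFXZeroMinus_of_le_two hn hA⟩
  · obtain ⟨t, ht, h⟩ := Cmd.exec_prog (O := valueOracle G v) Cmd.main_ok (inputMem G)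
    have hm := Cmd.den_main hG (not_le.1 hn)
    refine ⟨_, _, Exec.ite_false hn h, ?_, hm.1, hm.2⟩
    have ht : t ≤ Cmd.main.cost.eval n := ht
    simp only [Polynomial.eval_add, Polynomial.eval_C, Test.cost, Expr.cost]
    omega

end GraphEFX

theorem mainTheorem1 :
    (∀ (n : ℕ) (G : SimpleGraph (Fin n)) (v : Fin n → Set G.edgeSet → ℝ),
      GraphEFX.IsMixedInstance G v →
        ∃ X : Fin n → Set G.edgeSet,
          GraphEFX.IsAllocation X ∧ GraphEFX.IsEFXZeroMinus v X) ∧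
    (∃ (P : GraphEFX.Prog) (p : Polynomial ℕ),
      ∀ (n : ℕ) (G : SimpleGraph (Fin n)) (v : Fin n → Set G.edgeSet → ℝ),
        GraphEFX.IsMixedInstance G v →
          ∃ (s : GraphEFX.Mem) (t : ℕ),
            GraphEFX.Exec (GraphEFX.valueOracle G v) P (GraphEFX.inputMem G) s t ∧
            t ≤ p.eval n ∧
            GraphEFX.IsAllocation (GraphEFX.outputBundles G s) ∧
            GraphEFX.IsEFXZeroMinus v (GraphEFX.outputBundles G s)) := by
  obtain ⟨P, p, h⟩ := GraphEFX.exists_program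
  refine ⟨fun n G v hG => ?_, P, p, h⟩
  obtain ⟨s, t, -, -, h1, h2⟩ := h n G v hG
  exact ⟨_, h1, h2⟩
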